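/- Let $(M,F)$ be a connected $n$-dimensional Finsler manifold (smooth, Hausdorff, second countable, without boundary), i.e. $F:TM\to[0,\infty)$ is smooth off the zero section and restricts to a Minkowski norm on each $T_xM$; here $F(x,\lambda y)=\lambda F(x,y)$ only for $\lambda>0$, so $F$ need not be reversible. Put $g_y(y,v)=\tfrac12\frac{d}{ds}\big|_{s=0}F^2(y+sv)$. The gradient of $f$ is defined by $df(v)=g_{\nabla f}(\nabla f,v)$. Let $d_F(p,q)$ be the infimum of the $F$-lengths of piecewise smooth curves from $p$ to $q$, and $d_F(A,q)=\inf_{p\in A}d_F(p,q)$. Assume that $F$ is forward and backward complete: every forward Cauchy sequence and every backward Cauchy sequence for $d_F$ converges. Let $f:M\to\mathbb R$ be smooth with $f(M)=[a,b]$ and $F$-transnormal: $F^2(\nabla f)=\mathfrak b(f)$ with $\mathfrak b$ continuous on $[a,b]$. Assume that $f$ has no critical values in $(a,b)$, i.e. $\mathfrak b>0$ on $(a,b)$, and that $f^{-1}(b)$ has empty interior. Write $r_{c,d}=\int_c^d ds/\sqrt{\mathfrak b(s)}$. For a set $A\subset M$, the wavefront at time $t\ge 0$ of the wave starting from $A$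 at time $0$ is $\{q: d_F(A,q)=t\}$; write $\phi_q(s)=\{p:d_F(q,p)=s\}$ for the wavefront started at a point $q$. A wave ray from $A$ is a piecewise smooth curve $\gamma:[0,T]\to M$ with $F(\gamma')=1$ and $\gamma(0)\in A$ which is a shortest path from $A$ to $\gamma(T)$, i.e. has length $d_F(A,\gamma(T))$. A vector $y\ne0$ at $p$ is orthogonal to a set $S$ if $g_y(y,v)=0$ for each velocity $v$ at $p$ of a curve in $S$ through $p$ that is differentiable there (for a submanifold $S$: for each $v\in T_pS$). Two sets are called tangent at a common point $p$ if some $y\neq 0$ at $p$ is orthogonal to both. Consider the wave that starts from $f^{-1}(a)$ at time $0$. Then: a) $1/\sqrt{\mathfrak b}$ is integrable on $[a,b]$, and for every $c\in[a,b]$, $f^{-1}(c)$ is the wavefront at time $r_{a,c}$. b) (Huygens' envelope principle) For all $c<d$ in $[a,b]$, $f^{-1}(d)$ is the envelope, ahead of the front $f^{-1}(c)$, of the wavefronts $\phi_q(r_{c,d})$, $q\in f^{-1}(c)$. That is: $f^{-1}(d)$ is the set of the points $p$ with $d_F(f^{-1}(a),p)>r_{a,c}$ that lie on $\phi_q(r_{c,d})$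 for some $q\in f^{-1}(c)$ and satisfy $d_F(q,p)\ge r_{c,d}$ for all $q\in f^{-1}(c)$; at each of its points $f^{-1}(d)$ is tangent to one of the $\phi_q(r_{c,d})$ passing through that point; and, if $c>a$, each $\phi_q(r_{c,d})$ with $q\in f^{-1}(c)$ is tangent to $f^{-1}(d)$ at some common point. c) Every $q\in M$ is the endpoint $\gamma(T)$ of a wave ray $\gamma:[0,T]\to M$ from $f^{-1}(a)$, with $T=r_{a,f(q)}$. Every wave ray $\gamma:[0,T]\to M$ from $f^{-1}(a)$ with $T>0$ is an $F$-geodesic (smooth on $[0,T]$ and length minimizing between any two of its points); it is on $f^{-1}(c)$ exactly at time $r_{a,c}$ (for $c\in[a,b]$ and times in $[0,T]$); its velocity is orthogonal to every wavefront $f^{-1}(c)$ that it meets, including the ends; and it is the initial part of a wave ray $[0,r_{a,b}]\to M$ that joins $f^{-1}(a)$ to $f^{-1}(b)$. -/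

import Mathlib

open Set Filter MeasureTheory
open scoped Topology Manifold ContDiff ENNReal

noncomputable section

namespace Finsler

variable {n : ℕ} {M : Type*} [TopologicalSpace M] [ChartedSpace (EuclideanSpace ℝ (Fin n)) M]
  [IsManifold (𝓡 n) ∞ M]

/-- The fundamental tensor `g_y(u, v) = (1/2) ∂²/∂t∂s F²(y + t u + s v)` at `t = s = 0`, for a
function `F` on the tangent bundle and `y, u, v` in the tangent space at `x`. -/
def fundamentalTensor (F : TangentBundle (𝓡 n) M → ℝ) (x : M)
    (y u v : TangentSpace (𝓡 n) x) : ℝ :=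
  (1 / 2) * deriv (fun t : ℝ => deriv (fun s : ℝ => F ⟨x, y + t • u + s • v⟩ ^ 2) 0) 0

/-- The velocity `(γ(t), γ'(t))` of a curve, as a point of the tangent bundle. -/
def velocity (γ : ℝ → M) (t : ℝ) : TangentBundle (𝓡 n) M :=
  ⟨γ t, mfderiv 𝓘(ℝ, ℝ) (𝓡 n) γ t (1 : ℝ)⟩

/-- The derivative at `t` of a curve defined on the interval `[0, T]`: one-sided at the ends. -/
def derivOn (γ : ℝ → M) (T t : ℝ) : TangentSpace (𝓡 n) (γ t) :=
  mfderivWithin 𝓘(ℝ, ℝ) (𝓡 n) γ (Icc 0 T) t (1 : ℝ)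

/-- A curve is piecewise smooth on `[s, t]`: it is a concatenation of finitely many curves, each
of them smooth on a closed interval. -/
inductive PiecewiseSmooth (n : ℕ) {M : Type*} [TopologicalSpace M]
    [ChartedSpace (EuclideanSpace ℝ (Fin n)) M] (γ : ℝ → M) : ℝ → ℝ → Prop
  | smooth {s t : ℝ} (hst : s ≤ t) (h : ContMDiffOn 𝓘(ℝ, ℝ) (𝓡 n) ∞ γ (Icc s t)) :
      PiecewiseSmooth n γ s t
  | concat {s t u : ℝ} (h₁ : PiecewiseSmooth n γ s t) (h₂ : PiecewiseSmooth n γ t u) :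
      PiecewiseSmooth n γ s u

/-- The vectors tangent to a set `S` at `p`: velocities of curves in `S` through `p`.
If `S` is a submanifold this is its tangent space at `p`. -/
def tangentVectors (S : Set M) (p : M) : Set (TangentSpace (𝓡 n) p) :=
  {v | ∃ σ : ℝ → M, (∀ᶠ s in 𝓝 (0 : ℝ), σ s ∈ S) ∧ MDifferentiableAt 𝓘(ℝ, ℝ) (𝓡 n) σ 0 ∧
    velocity σ 0 = (⟨p, v⟩ : TangentBundle (𝓡 n) M)}

/-- The time `∫_c^d ds / √𝔟(s)`. -/
def travelTime (𝔟 : ℝ → ℝ) (c d : ℝ) : ℝ := ∫ s in c..d, 1 / √(𝔟 s)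

end Finsler

open Finsler

/-- A Finsler structure on the `n`-dimensional manifold `M`: a nonnegative function on the tangent
bundle, smooth off the zero section, whose restriction to each tangent space is a Minkowski
norm. -/
structure FinslerStructure (n : ℕ) (M : Type*) [TopologicalSpace M]
    [ChartedSpace (EuclideanSpace ℝ (Fin n)) M] [IsManifold (𝓡 n) ∞ M] where
  toFun : TangentBundle (𝓡 n) M → ℝ
  nonneg : ∀ v, 0 ≤ toFun v
  smooth : ContMDiffOn ((𝓡 n).tangent) 𝓘(ℝ, ℝ) ∞ toFun {v | v.2 ≠ 0}
  homogeneous : ∀ (x : M) (y : TangentSpace (𝓡 n) x) (r : ℝ), 0 < r →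
    toFun ⟨x, r • y⟩ = r * toFun ⟨x, y⟩
  posDef : ∀ (x : M) (y u : TangentSpace (𝓡 n) x), y ≠ 0 → u ≠ 0 →
    0 < fundamentalTensor toFun x y u u

namespace FinslerStructure

variable {n : ℕ} {M : Type*} [TopologicalSpace M] [ChartedSpace (EuclideanSpace ℝ (Fin n)) M]
  [IsManifold (𝓡 n) ∞ M]

/-- `g_y(y, v) = (1/2) ∂/∂s F²(y + s v)` at `s = 0`. For `y = 0` this is `0`. -/
def legendre (F : FinslerStructure n M) (x : M) (y v : TangentSpace (𝓡 n) x) : ℝ :=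
  (1 / 2) * deriv (fun s : ℝ => F.toFun ⟨x, y + s • v⟩ ^ 2) 0

/-- `y` is the gradient of `f` at `x`: `df_x(v) = g_y(y, v)` for all `v`. -/
def IsGradientAt (F : FinslerStructure n M) (f : M → ℝ) (x : M) (y : TangentSpace (𝓡 n) x) :
    Prop :=
  ∀ v : TangentSpace (𝓡 n) x, (mfderiv (𝓡 n) 𝓘(ℝ, ℝ) f x v : ℝ) = F.legendre x y v

/-- `f` is `F`-transnormal with `F²(∇f) = 𝔟 ∘ f`. (The gradient exists and is unique at every
point, since `y ↦ g_y(y, ·)` is a bijection of the tangent space onto its dual.) -/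
structure IsTransnormal (F : FinslerStructure n M) (f : M → ℝ) (𝔟 : ℝ → ℝ) : Prop where
  smooth : ContMDiff (𝓡 n) 𝓘(ℝ, ℝ) ∞ f
  continuousOn : ContinuousOn 𝔟 (range f)
  gradient : ∀ x : M, ∃ y : TangentSpace (𝓡 n) x,
    F.IsGradientAt f x y ∧ F.toFun ⟨x, y⟩ ^ 2 = 𝔟 (f x)

/-- A non-zero vector `y` at `p` is orthogonal to the set `S`: `g_y(y, v) = 0` for every `v`
tangent to `S` at `p`. -/
def IsOrthogonal (F : FinslerStructure n M) (p : M) (y : TangentSpace (𝓡 n) p) (S : Set M) :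
    Prop :=
  y ≠ 0 ∧ ∀ v ∈ tangentVectors S p, F.legendre p y v = 0

/-- The length of the curve `γ` over `[s, t]`. -/
def length (F : FinslerStructure n M) (γ : ℝ → M) (s t : ℝ) : ℝ≥0∞ :=
  ∫⁻ u in Icc s t, ENNReal.ofReal (F.toFun (velocity γ u))

/-- The (in general non-symmetric) distance `d_F(p, q)`: the infimum of the lengths of the
piecewise smooth curves from `p` to `q`. -/
def dist (F : FinslerStructure n M) (p q : M) : ℝ≥0∞ :=
  ⨅ (γ : ℝ → M) (s : ℝ) (t : ℝ) (_ : PiecewiseSmooth n γ s t) (_ : γ s = p) (_ : γ t = q),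
    F.length γ s t

/-- The distance `d_F(A, q)` from a set to a point. -/
def distFrom (F : FinslerStructure n M) (A : Set M) (q : M) : ℝ≥0∞ := ⨅ p ∈ A, F.dist p q

/-- Every forward Cauchy sequence converges. -/
def ForwardComplete (F : FinslerStructure n M) : Prop :=
  ∀ x : ℕ → M, (∀ ε : ℝ≥0∞, 0 < ε → ∃ N, ∀ i j, N ≤ i → i ≤ j → F.dist (x i) (x j) < ε) →
    ∃ p, Tendsto x atTop (𝓝 p)

/-- Every backward Cauchy sequence converges. -/
def BackwardComplete (F : FinslerStructure n M) : Prop :=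
  ∀ x : ℕ → M, (∀ ε : ℝ≥0∞, 0 < ε → ∃ N, ∀ i j, N ≤ i → i ≤ j → F.dist (x j) (x i) < ε) →
    ∃ p, Tendsto x atTop (𝓝 p)

/-- The wavefront at time `t` of a wave that starts from the set `A` at time `0` and travels with
unit `F`-speed: the points that the wave first reaches at time `t`. -/
def wavefront (F : FinslerStructure n M) (A : Set M) (t : ℝ) : Set M :=
  {q | F.distFrom A q = ENNReal.ofReal t}

/-- The wavefront that started at the point `q`, after time `s`, passes through `p` and is tangent
there to `E`: the two sets have a common orthogonal vector at `p`. -/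
def TouchesAt (F : FinslerStructure n M) (q : M) (s : ℝ) (E : Set M) (p : M) : Prop :=
  p ∈ F.wavefront {q} s ∧ ∃ y : TangentSpace (𝓡 n) p,
    F.IsOrthogonal p y E ∧ F.IsOrthogonal p y (F.wavefront {q} s)

/-- `E` is the envelope, ahead of the front at time `t`, of the wavefronts after time `s` that
start at the points of the front at time `t` (of the wave that starts from `A`). -/
structure IsHuygensEnvelope (F : FinslerStructure n M) (A : Set M) (t s : ℝ) (E : Set M) :
    Prop where
  /-- The points of `E` are the points not yet swept at time `t` that lie on one of the wavefronts
  and inside none of them. -/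
  mem_iff : ∀ p, p ∈ E ↔ ENNReal.ofReal t < F.distFrom A p ∧
    (∃ q ∈ F.wavefront A t, p ∈ F.wavefront {q} s) ∧
    ∀ q ∈ F.wavefront A t, ENNReal.ofReal s ≤ F.dist q p
  /-- At each of its points, `E` is tangent to one of the wavefronts. -/
  tangent : ∀ p ∈ E, ∃ q ∈ F.wavefront A t, F.TouchesAt q s E p
  /-- Each of the wavefronts is tangent to `E` at some point. (Only for `t > 0`, since
  the source `A` may have interior points.) -/
  touches : 0 < t → ∀ q ∈ F.wavefront A t, ∃ p ∈ E, F.TouchesAt q s E p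

/-- A wave ray of the wave that starts from `A`, parametrized by travel time `t ∈ [0, T]`: a
shortest path from `A` to `γ(T)`. -/
structure IsWaveRay (F : FinslerStructure n M) (A : Set M) (γ : ℝ → M) (T : ℝ) : Prop where
  nonneg : 0 ≤ T
  piecewiseSmooth : PiecewiseSmooth n γ 0 T
  unitSpeed : ∀ t ∈ Ioo 0 T, MDifferentiableAt 𝓘(ℝ, ℝ) (𝓡 n) γ t → F.toFun (velocity γ t) = 1
  source : γ 0 ∈ A
  shortest : F.length γ 0 T = F.distFrom A (γ T)

/-- `γ` is a geodesic on `[0, T]`: a smooth curve that minimizes length between any two of its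
points. -/
def IsGeodesic (F : FinslerStructure n M) (γ : ℝ → M) (T : ℝ) : Prop :=
  ContMDiffOn 𝓘(ℝ, ℝ) (𝓡 n) ∞ γ (Icc 0 T) ∧
    ∀ s t, 0 ≤ s → s ≤ t → t ≤ T → F.length γ s t = F.dist (γ s) (γ t)

end FinslerStructure

end

/-! Let ρ = ∫_a^f ds/√𝔟 be the arrival time (`arrival`) and R = r_{a,b}. Where a < f < b, the
gradient of ρ is ∇f/√𝔟(f), a unit vector, and the fundamental inequality g_y(y, v) ≤ F(y) F(v) shows
that ρ grows along a curve at most by its length. In fact ρ(y) - ρ(x) ≤ d_F(x, y) for all points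
(`ofReal_arrival_sub_le_dist`). This is proved first with 𝔟 + ε, for which critical levels are
harmless, and then by Fatou's lemma; since d_F is finite, the same estimate makes 1/√𝔟 integrable.

Everything else comes from curves on which the bound is attained. A curve is calibrated if ρ(γ(t)) =
t and d_F(γ(s), γ(t)) ≤ t - s. Short integral curves of ∇ρ are calibrated. A maximal calibrated set,
given by Zorn's lemma, reaches ρ = R by forward completeness and ρ = 0 by backward completeness, so
that a calibrated curve on [0, R] passes through every regular point (`exists_calibratedCurve`).
Since f⁻¹(b) has empty interior, its points are limits of regular points, and limits of calibrated
curves are calibrated (`exists_calibratedCurve_last`). Nothing similar is needed on f⁻¹(a), where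
the distance from the source is 0. Hence d_F(f⁻¹(a), ·) = ρ (`distFrom_eq`), the level sets are the
wavefronts, and wave rays are calibrated (`isCalibratedCurve_of_isWaveRay`).

Calibrated curves are smooth. At interior times, equality in the fundamental inequality forces γ' =
∇ρ (`hasDerivAt_of_calibrated`). The ends may lie on critical levels, where ρ can fail to be
differentiable; but the momentum dρ along γ is Lipschitz by the Euler-Lagrange equation, and
position and momentum together solve a Hamiltonian equation that is smooth up to the ends
(`contDiffWithinAt_Icc`). Orthogonality is a first variation argument: no point of the front is
nearer than the one on the ray (`isOrthogonal_derivOn`). Huygens' principle is then arithmetic with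
ρ and with distances along calibrated curves. -/

noncomputable section

/-! ### Minkowski norms: strict convexity and the fundamental inequality -/

section Minkowski

variable {E : Type*} [NormedAddCommGroup E] [NormedSpace ℝ E]

/-- A Minkowski norm on a vector space: not necessarily reversible. -/
structure IsMinkowskiNorm (N : E → ℝ) : Prop where
  nonneg : ∀ y, 0 ≤ N y
  smooth : ContDiffOn ℝ ∞ N {0}ᶜ
  homogeneous : ∀ (y : E) (r : ℝ), 0 < r → N (r • y) = r * N y
  posDef : ∀ y u : E, y ≠ 0 → u ≠ 0 →
    0 < (1 / 2) * deriv (fun t : ℝ => deriv (fun s : ℝ => N (y + t • u + s • u) ^ 2) 0) 0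

/-- `g_y(y, v)` for the Minkowski norm `N`. -/
def minkowskiLegendre (N : E → ℝ) (y v : E) : ℝ :=
  (1 / 2) * deriv (fun s : ℝ => N (y + s • v) ^ 2) 0

namespace IsMinkowskiNorm

variable {N : E → ℝ}

theorem map_zero (hN : IsMinkowskiNorm N) : N 0 = 0 := by
  have := hN.homogeneous 0 2 two_pos
  rw [smul_zero] at this
  linarith

theorem map_smul_of_nonneg (hN : IsMinkowskiNorm N) (y : E) {r : ℝ} (hr : 0 ≤ r) :
    N (r • y) = r * N y := by
  rcases hr.eq_or_lt with rfl | hr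
  · simp [hN.map_zero]
  · exact hN.homogeneous y r hr

theorem contDiffAt (hN : IsMinkowskiNorm N) {y : E} (hy : y ≠ 0) : ContDiffAt ℝ ∞ N y :=
  hN.smooth.contDiffAt (isOpen_compl_singleton.mem_nhds hy)

theorem contDiffAt_sq (hN : IsMinkowskiNorm N) {y : E} (hy : y ≠ 0) :
    ContDiffAt ℝ ∞ (fun y => N y ^ 2) y :=
  (hN.contDiffAt hy).pow 2

theorem hasDerivAt_sq (hN : IsMinkowskiNorm N) {y : E} (hy : y ≠ 0) (v : E) (c : ℝ → E) (t : ℝ)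
    (hc : HasDerivAt c v t) (hct : c t = y) :
    HasDerivAt (fun s : ℝ => N (c s) ^ 2) (fderiv ℝ (fun y => N y ^ 2) y v) t := by
  have h1 : HasFDerivAt (fun y => N y ^ 2) (fderiv ℝ (fun y => N y ^ 2) y) (c t) := by
    rw [hct]
    exact ((hN.contDiffAt_sq hy).differentiableAt (by simp)).hasFDerivAt
  exact h1.comp_hasDerivAt t hc

theorem legendre_eq_fderiv (hN : IsMinkowskiNorm N) {y : E} (hy : y ≠ 0) (v : E) :
    minkowskiLegendre N y v = (1 / 2) * fderiv ℝ (fun y => N y ^ 2) y v := by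
  unfold minkowskiLegendre
  congr 1
  refine (hN.hasDerivAt_sq hy v (fun s => y + s • v) 0 ?_ (by simp)).deriv
  simpa using ((hasDerivAt_id (0 : ℝ)).smul_const v).const_add y

theorem legendre_self (hN : IsMinkowskiNorm N) (y : E) : minkowskiLegendre N y y = N y ^ 2 := by
  have h : (fun s : ℝ => N (y + s • y) ^ 2) =ᶠ[𝓝 0] fun s => (1 + s) ^ 2 * N y ^ 2 := by
    filter_upwards [lt_mem_nhds (show (-1 : ℝ) < 0 by norm_num)] with s hs
    rw [show y + s • y = (1 + s) • y by rw [add_smul, one_smul],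
      hN.homogeneous y _ (by linarith), mul_pow]
  have h2 : HasDerivAt (fun s : ℝ => (1 + s) ^ 2 * N y ^ 2) (2 * N y ^ 2) 0 := by
    have := ((((hasDerivAt_id (0 : ℝ)).const_add 1).pow 2).mul_const (N y ^ 2))
    simpa using this
  rw [minkowskiLegendre, h.deriv_eq, h2.deriv]
  ring

/-- By homogeneity N² is quadratic along the ray of y, so the positive number g_y(y, y) equals
N(y)². -/
theorem pos (hN : IsMinkowskiNorm N) {y : E} (hy : y ≠ 0) : 0 < N y := by
  have h := hN.posDef y y hy hy
  have h1 : (fun t : ℝ => deriv (fun s : ℝ => N (y + t • y + s • y) ^ 2) 0) =ᶠ[𝓝 0]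
      fun t => 2 * (1 + t) * N y ^ 2 := by
    filter_upwards [lt_mem_nhds (show (-1 : ℝ) < 0 by norm_num)] with t ht
    have h0 : (fun s : ℝ => N (y + t • y + s • y) ^ 2) =ᶠ[𝓝 0]
        fun s => (1 + t + s) ^ 2 * N y ^ 2 := by
      have : ∀ᶠ s : ℝ in 𝓝 0, -(1 + t) < s := lt_mem_nhds (by linarith)
      filter_upwards [this] with s hs
      rw [show y + t • y + s • y = (1 + t + s) • y by simp only [add_smul, one_smul],
        hN.homogeneous y _ (by linarith), mul_pow]
    have h2 : HasDerivAt (fun s : ℝ => (1 + t + s) ^ 2 * N y ^ 2) (2 * (1 + t) * N y ^ 2) 0 := by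
      have := ((((hasDerivAt_id (0 : ℝ)).const_add (1 + t)).pow 2).mul_const (N y ^ 2))
      simpa using this
    rw [h0.deriv_eq, h2.deriv]
  have h3 : HasDerivAt (fun t : ℝ => 2 * (1 + t) * N y ^ 2) (2 * N y ^ 2) 0 := by
    simpa using ((((hasDerivAt_id (0 : ℝ)).const_add 1).const_mul 2).mul_const (N y ^ 2))
  rw [h1.deriv_eq, h3.deriv] at h
  rcases (hN.nonneg y).eq_or_lt with h4 | h4
  · rw [← h4] at h; norm_num at h
  · exact h4

theorem legendre_smul_neg (hN : IsMinkowskiNorm N) {y : E} (hy : y ≠ 0) (μ : ℝ) :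
    minkowskiLegendre N y (μ • y) = μ * N y ^ 2 := by
  rw [hN.legendre_eq_fderiv hy, map_smul, ← hN.legendre_self, hN.legendre_eq_fderiv hy,
    smul_eq_mul]
  ring

/-- Strict convexity of `N² / 2` along segments that do not meet the origin. -/
theorem legendre_lt_of_segment (hN : IsMinkowskiNorm N) {y v : E} (hvy : v ≠ y)
    (hseg : ∀ s ∈ Icc (0 : ℝ) 1, y + s • (v - y) ≠ 0) :
    2 * minkowskiLegendre N y v < N y ^ 2 + N v ^ 2 := by
  have hy : y ≠ 0 := by simpa using hseg 0 (by simp)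
  set w := v - y with hw
  have hw0 : w ≠ 0 := sub_ne_zero.2 hvy
  set φ : ℝ → ℝ := fun s => N (y + s • w) ^ 2 with hφ
  set φ' : ℝ → ℝ := fun s => fderiv ℝ (fun y => N y ^ 2) (y + s • w) w with hφ'
  have hline : ∀ s : ℝ, HasDerivAt (fun s : ℝ => y + s • w) w s := fun s => by
    simpa using ((hasDerivAt_id s).smul_const w).const_add y
  have hd : ∀ s : ℝ, y + s • w ≠ 0 → HasDerivAt φ (φ' s) s := fun s hs =>
    hN.hasDerivAt_sq hs w _ s (hline s) rfl
  have hd2 : ∀ s ∈ Icc (0 : ℝ) 1, DifferentiableAt ℝ φ' s ∧ 0 < deriv φ' s := by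
    intro s hs
    have hs0 := hseg s hs
    constructor
    · have h1 : ContDiffAt ℝ 1 (fderiv ℝ (fun y => N y ^ 2)) (y + s • w) :=
        (hN.contDiffAt_sq hs0).fderiv_right (by norm_cast)
      have h2 := (h1.differentiableAt (by simp)).comp s
        (hline s).differentiableAt
      exact h2.clm_apply (differentiableAt_const w)
    · have h1 := hN.posDef _ w hs0 hw0
      have h2 : (fun t : ℝ => deriv (fun r : ℝ => N (y + s • w + t • w + r • w) ^ 2) 0)
          =ᶠ[𝓝 0] fun t => φ' (s + t) := by
        have hc : ContinuousAt (fun t : ℝ => y + s • w + t • w) 0 := by fun_prop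
        filter_upwards [hc.eventually_ne (by simpa using hs0)] with t ht
        refine (hN.hasDerivAt_sq (y := y + (s + t) • w) ?_ w _ 0 ?_ ?_).deriv
        · rwa [add_smul, ← add_assoc]
        · simpa using ((hasDerivAt_id (0 : ℝ)).smul_const w).const_add (y + s • w + t • w)
        · simp [add_smul, add_assoc]
      rw [h2.deriv_eq, deriv_comp_const_add, add_zero] at h1
      linarith
  -- Mean value theorem: φ(1) - φ(0) = φ'(c) with c > 0, and φ' is strictly increasing because φ''
  -- is twice the fundamental tensor in the direction w.
  obtain ⟨c, hc, hc1⟩ := exists_hasDerivAt_eq_slope φ φ' one_pos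
    (fun s hs => (hd s (hseg s hs)).continuousAt.continuousWithinAt)
    (fun s hs => hd s (hseg s (Ioo_subset_Icc_self hs)))
  have hmono : StrictMonoOn φ' (Icc 0 1) := by
    refine strictMonoOn_of_deriv_pos (convex_Icc 0 1)
      (fun s hs => (hd2 s hs).1.continuousAt.continuousWithinAt) fun s hs => ?_
    rw [interior_Icc] at hs
    exact (hd2 s (Ioo_subset_Icc_self hs)).2
  have h0 : φ' 0 < φ' c := hmono (by simp) (Ioo_subset_Icc_self hc) hc.1
  have e1 : φ 1 = N v ^ 2 := by simp [hφ, hw]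
  have e0 : φ 0 = N y ^ 2 := by simp [hφ]
  have e2 : φ' 0 = 2 * minkowskiLegendre N y v - 2 * N y ^ 2 := by
    rw [← hN.legendre_self, hN.legendre_eq_fderiv hy, hN.legendre_eq_fderiv hy]
    simp only [hφ', zero_smul, add_zero, hw, map_sub]
    ring
  rw [hc1, e1, e0, e2] at h0
  norm_num at h0
  linarith

/-- If the segment from y to v meets the origin, where N² need not be smooth, then v is a
nonpositive multiple of y and the left side is at most 0. -/
theorem two_mul_legendre_lt (hN : IsMinkowskiNorm N) {y v : E} (hy : y ≠ 0) (hvy : v ≠ y) :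
    2 * minkowskiLegendre N y v < N y ^ 2 + N v ^ 2 := by
  by_cases hseg : ∀ s ∈ Icc (0 : ℝ) 1, y + s • (v - y) ≠ 0
  · exact hN.legendre_lt_of_segment hvy hseg
  · push Not at hseg
    obtain ⟨s, hs, h0⟩ := hseg
    have hs0 : s ≠ 0 := by rintro rfl; simp at h0; exact hy h0
    have hv : v = (-((1 - s) / s)) • y := by
      have : s • v = (-(1 - s)) • y := by
        have h1 : s • v = (y + s • (v - y)) + (-(1 - s)) • y := by module
        rw [h1, h0, zero_add]
      rw [← inv_smul_smul₀ hs0 v, this, smul_smul]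
      congr 1
      field_simp
    have hpos : 0 < N y ^ 2 := pow_pos (hN.pos hy) 2
    have h3 : 0 ≤ (1 - s) / s := div_nonneg (by linarith [hs.2]) hs.1
    have : minkowskiLegendre N y v ≤ 0 := by
      rw [hv, hN.legendre_smul_neg hy]
      nlinarith
    nlinarith [sq_nonneg (N v)]

theorem legendre_smul_right (hN : IsMinkowskiNorm N) {y : E} (hy : y ≠ 0) (r : ℝ) (v : E) :
    minkowskiLegendre N y (r • v) = r * minkowskiLegendre N y v := by
  rw [hN.legendre_eq_fderiv hy, hN.legendre_eq_fderiv hy, map_smul, smul_eq_mul]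
  ring

/-- Strict convexity is applied to the multiple of v that has the same norm as y. -/
theorem legendre_lt_of_ne (hN : IsMinkowskiNorm N) {y v : E} (hy : y ≠ 0) (hv : v ≠ 0)
    (hvy : N y • v ≠ N v • y) : minkowskiLegendre N y v < N y * N v := by
  have py := hN.pos hy
  have pv := hN.pos hv
  have h := hN.two_mul_legendre_lt (v := (N y / N v) • v) hy (by
    intro h
    apply hvy
    have : N y • v = N v • ((N y / N v) • v) := by rw [smul_smul, mul_div_cancel₀ _ pv.ne']
    rw [this, h])
  rw [hN.legendre_smul_right hy, hN.homogeneous _ _ (by positivity)] at h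
  rw [div_mul_cancel₀ _ pv.ne'] at h
  have h2 : N y / N v * minkowskiLegendre N y v < N y ^ 2 := by linarith
  rw [div_mul_eq_mul_div, div_lt_iff₀ pv] at h2
  nlinarith

/-- The fundamental inequality `g_y(y, v) ≤ N(y) N(v)`. -/
theorem legendre_le (hN : IsMinkowskiNorm N) (y v : E) :
    minkowskiLegendre N y v ≤ N y * N v := by
  by_cases hy : y = 0
  · subst hy
    rw [hN.map_zero, zero_mul]
    -- N² is quadratic on each of the two half lines spanned by v and -v, with possibly different
    -- constants, so its derivative at 0 exists and vanishes.
    have : HasDerivAt (fun s : ℝ => N ((0 : E) + s • v) ^ 2) 0 0 := by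
      rw [hasDerivAt_iff_isLittleO]
      have hb : (fun s : ℝ => N ((0 : E) + s • v) ^ 2) =O[𝓝 0] fun s : ℝ => s * s := by
        refine Asymptotics.IsBigO.of_bound (N v ^ 2 + N (-v) ^ 2) (Eventually.of_forall fun s => ?_)
        rw [zero_add]
        rcases le_total 0 s with hs | hs
        · rw [hN.map_smul_of_nonneg v hs, Real.norm_eq_abs, Real.norm_eq_abs,
            abs_of_nonneg (by positivity), abs_of_nonneg (by positivity)]
          nlinarith [mul_nonneg (mul_nonneg hs hs) (sq_nonneg (N (-v)))]
        · rw [← neg_smul_neg s v, hN.map_smul_of_nonneg (-v) (neg_nonneg.2 hs), Real.norm_eq_abs,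
            Real.norm_eq_abs, abs_of_nonneg (by positivity), abs_of_nonneg (by nlinarith)]
          nlinarith [mul_nonneg (mul_self_nonneg s) (sq_nonneg (N v))]
      have hl : (fun s : ℝ => s * s) =o[𝓝 0] fun s : ℝ => s := by
        simpa [pow_two] using Asymptotics.isLittleO_pow_id (𝕜 := ℝ) one_lt_two
      simpa [hN.map_zero] using hb.trans_isLittleO hl
    rw [minkowskiLegendre, this.deriv, mul_zero]
  by_cases hv : v = 0
  · subst hv
    rw [hN.legendre_eq_fderiv hy]
    simp [hN.map_zero]
  by_cases h : N y • v = N v • y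
  · have py := hN.pos hy
    have : v = (N v / N y) • y := by
      rw [div_eq_inv_mul, mul_smul, ← h, inv_smul_smul₀ py.ne']
    have h2 : minkowskiLegendre N y v = N v / N y * N y ^ 2 := by
      conv_lhs => rw [this]
      exact hN.legendre_smul_neg hy _
    rw [h2]
    apply le_of_eq
    field_simp
  · exact (hN.legendre_lt_of_ne hy hv h).le

/-- The case of equality in the fundamental inequality, for unit vectors. -/
theorem eq_of_le_legendre (hN : IsMinkowskiNorm N) {y v : E} (hy : N y = 1) (hv : N v ≤ 1)
    (h : 1 ≤ minkowskiLegendre N y v) : v = y := by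
  have hy0 : y ≠ 0 := by rintro rfl; rw [hN.map_zero] at hy; norm_num at hy
  by_contra hne
  have := hN.two_mul_legendre_lt hy0 hne
  rw [hy] at this
  nlinarith [hN.nonneg v]

/-- Equal transforms give N(y)² = g_z(z, y) ≤ N(z) N(y) and the reverse, hence equal norms; for
distinct vectors strict convexity is then violated. -/
theorem legendre_injective (hN : IsMinkowskiNorm N) {y z : E}
    (h : ∀ v, minkowskiLegendre N y v = minkowskiLegendre N z v) : y = z := by
  by_contra hne
  have key : ∀ {y z : E}, (∀ v, minkowskiLegendre N y v = minkowskiLegendre N z v) →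
      N y ≤ N z := by
    intro y z h
    have h1 := h y
    rw [hN.legendre_self] at h1
    have h2 := hN.legendre_le z y
    rcases (hN.nonneg y).eq_or_lt with h3 | h3
    · rw [← h3]; exact hN.nonneg z
    · nlinarith
  have e : N y = N z := le_antisymm (key h) (key fun v => (h v).symm)
  have hy : y ≠ 0 := by
    rintro rfl
    exact (hN.pos (Ne.symm hne)).ne' (by rw [← e, hN.map_zero])
  have h1 := hN.two_mul_legendre_lt hy (Ne.symm hne)
  rw [h z, hN.legendre_self, e] at h1
  linarith

end IsMinkowskiNorm

end Minkowski

/-! ### Tangent vectors and the Finsler structure in chart coordinates -/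

namespace Finsler

open Bundle

variable {n : ℕ} {M : Type*} [TopologicalSpace M]
  [ChartedSpace (EuclideanSpace ℝ (Fin n)) M] [IsManifold (𝓡 n) ∞ M]

/-- The coordinates of a tangent vector in the chart at `p`. -/
def vecCoord (p : M) (w : TangentBundle (𝓡 n) M) : EuclideanSpace ℝ (Fin n) :=
  (trivializationAt (EuclideanSpace ℝ (Fin n)) (TangentSpace (𝓡 n)) p w).2

/-- The coordinates of tangent vectors at `q`, as a linear equivalence. -/
def coordEquiv (p q : M) (hq : q ∈ (extChartAt (𝓡 n) p).source) :
    TangentSpace (𝓡 n) q ≃L[ℝ] EuclideanSpace ℝ (Fin n) :=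
  (trivializationAt (EuclideanSpace ℝ (Fin n)) (TangentSpace (𝓡 n)) p).continuousLinearEquivAt ℝ q
    (by rwa [TangentBundle.trivializationAt_baseSet, ← extChartAt_source (𝓡 n)])

theorem mem_baseSet {p q : M} (hq : q ∈ (extChartAt (𝓡 n) p).source) :
    q ∈ (trivializationAt (EuclideanSpace ℝ (Fin n)) (TangentSpace (𝓡 n)) p).baseSet := by
  rwa [TangentBundle.trivializationAt_baseSet, ← extChartAt_source (𝓡 n)]

theorem vecCoord_eq (p q : M) (hq : q ∈ (extChartAt (𝓡 n) p).source) (u : TangentSpace (𝓡 n) q) :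
    vecCoord p ⟨q, u⟩ = coordEquiv p q hq u := rfl

theorem vecCoord_eq_mfderiv (p q : M) (hq : q ∈ (extChartAt (𝓡 n) p).source)
    (u : TangentSpace (𝓡 n) q) :
    vecCoord p ⟨q, u⟩ = mfderiv (𝓡 n) 𝓘(ℝ, EuclideanSpace ℝ (Fin n)) (extChartAt (𝓡 n) p) q u := by
  have h1 := congrArg (fun A => A u) (TangentBundle.continuousLinearMapAt_trivializationAt
    (I := 𝓡 n) (x₀ := p) (x := q) (by rwa [← extChartAt_source (𝓡 n)]))
  have h2 : vecCoord p ⟨q, u⟩ = (trivializationAt (EuclideanSpace ℝ (Fin n)) (TangentSpace (𝓡 n))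
      p).continuousLinearMapAt ℝ q u := by
    rw [Trivialization.continuousLinearMapAt_apply,
      Trivialization.coe_linearMapAt_of_mem _ (mem_baseSet hq)]
    rfl
  exact h2.trans h1

theorem vecCoord_velocity {γ : ℝ → M} {t : ℝ} {p : M} (hp : γ t ∈ (extChartAt (𝓡 n) p).source)
    (hγ : MDifferentiableAt 𝓘(ℝ, ℝ) (𝓡 n) γ t) :
    vecCoord p (velocity γ t : TangentBundle (𝓡 n) M) =
      deriv (fun s => extChartAt (𝓡 n) p (γ s)) t := by
  unfold velocity
  rw [vecCoord_eq_mfderiv p _ hp]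
  have h1 : MDifferentiableAt (𝓡 n) 𝓘(ℝ, EuclideanSpace ℝ (Fin n)) (extChartAt (𝓡 n) p) (γ t) :=
    mdifferentiableAt_extChartAt (by rwa [← extChartAt_source (𝓡 n)])
  have h2 := mfderiv_comp t h1 hγ
  rw [mfderiv_eq_fderiv] at h2
  have h3 := congrArg (fun A => A (1 : ℝ)) h2
  exact h3.symm

theorem vecCoord_derivOn {γ : ℝ → M} {T t : ℝ} {p : M} (hp : γ t ∈ (extChartAt (𝓡 n) p).source)
    (hT : 0 < T) (ht : t ∈ Icc 0 T)
    (hγ : MDifferentiableWithinAt 𝓘(ℝ, ℝ) (𝓡 n) γ (Icc 0 T) t) :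
    vecCoord p (⟨γ t, derivOn γ T t⟩ : TangentBundle (𝓡 n) M) =
      derivWithin (fun s => extChartAt (𝓡 n) p (γ s)) (Icc 0 T) t := by
  rw [vecCoord_eq_mfderiv p _ hp]
  have h1 : MDifferentiableAt (𝓡 n) 𝓘(ℝ, EuclideanSpace ℝ (Fin n)) (extChartAt (𝓡 n) p) (γ t) :=
    mdifferentiableAt_extChartAt (by rwa [← extChartAt_source (𝓡 n)])
  have h2 := mfderiv_comp_mfderivWithin t h1 hγ
    ((uniqueDiffOn_Icc hT).uniqueMDiffOn t ht)
  rw [mfderivWithin_eq_fderivWithin] at h2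
  have h3 := congrArg (fun A => A (1 : ℝ)) h2
  exact h3.symm

theorem mfderiv_eq_fderiv_chart {f : M → ℝ} {p q : M} (hq : q ∈ (extChartAt (𝓡 n) p).source)
    (hf : MDifferentiableAt (𝓡 n) 𝓘(ℝ, ℝ) f q) (u : TangentSpace (𝓡 n) q) :
    (mfderiv (𝓡 n) 𝓘(ℝ, ℝ) f q u : ℝ) =
      fderiv ℝ (fun x => f ((extChartAt (𝓡 n) p).symm x)) (extChartAt (𝓡 n) p q)
        (vecCoord p ⟨q, u⟩) := by
  rw [vecCoord_eq_mfderiv p _ hq]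
  set φ := extChartAt (𝓡 n) p with hφ
  have h1 : MDifferentiableAt (𝓡 n) 𝓘(ℝ, EuclideanSpace ℝ (Fin n)) φ q :=
    mdifferentiableAt_extChartAt (by rwa [← extChartAt_source (𝓡 n)])
  have h2 : MDifferentiableAt 𝓘(ℝ, EuclideanSpace ℝ (Fin n)) (𝓡 n) φ.symm (φ q) := by
    have := mdifferentiableWithinAt_extChartAt_symm (I := 𝓡 n) (φ.map_source hq)
    rwa [ModelWithCorners.range_eq_univ, mdifferentiableWithinAt_univ] at this
  have h3 : MDifferentiableAt 𝓘(ℝ, EuclideanSpace ℝ (Fin n)) 𝓘(ℝ, ℝ) (f ∘ φ.symm) (φ q) :=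
    MDifferentiableAt.comp (φ q) (by rwa [φ.left_inv hq]) h2
  have h4 := mfderiv_comp q h3 h1
  have h5 : (f ∘ φ.symm) ∘ φ =ᶠ[𝓝 q] f := by
    filter_upwards [(isOpen_extChartAt_source (I := 𝓡 n) p).mem_nhds hq] with x hx
    simp [φ.left_inv hx]
  rw [h5.mfderiv_eq] at h4
  rw [mfderiv_eq_fderiv] at h4
  have h6 := congrArg (fun A => A u) h4
  exact h6

end Finsler

namespace FinslerStructure

open Finsler Bundle

variable {n : ℕ} {M : Type*} [TopologicalSpace M]
  [ChartedSpace (EuclideanSpace ℝ (Fin n)) M] [IsManifold (𝓡 n) ∞ M]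

/-- The Finsler structure in the coordinates of the chart at `p`. -/
def locNorm (F : FinslerStructure n M) (p : M) (x v : EuclideanSpace ℝ (Fin n)) : ℝ :=
  F.toFun ((trivializationAt (EuclideanSpace ℝ (Fin n)) (TangentSpace (𝓡 n)) p).toOpenPartialHomeomorph.symm
    ((extChartAt (𝓡 n) p).symm x, v))

variable (F : FinslerStructure n M)

theorem locNorm_eq_coordEquiv {p q : M} (hq : q ∈ (extChartAt (𝓡 n) p).source)
    (v : EuclideanSpace ℝ (Fin n)) :
    F.locNorm p (extChartAt (𝓡 n) p q) v = F.toFun ⟨q, (coordEquiv p q hq).symm v⟩ := by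
  unfold locNorm
  rw [(extChartAt (𝓡 n) p).left_inv hq]
  congr 1
  exact Trivialization.symm_apply_eq_mk_continuousLinearEquivAt_symm _ _ (mem_baseSet hq) _

theorem locNorm_vecCoord {p q : M} (hq : q ∈ (extChartAt (𝓡 n) p).source)
    (u : TangentSpace (𝓡 n) q) :
    F.locNorm p (extChartAt (𝓡 n) p q) (vecCoord p ⟨q, u⟩) = F.toFun ⟨q, u⟩ := by
  rw [F.locNorm_eq_coordEquiv hq, vecCoord_eq p q hq, ContinuousLinearEquiv.symm_apply_apply]

/-- The inverse of the trivialization is smooth and injective on fibres, so it keeps nonzero vectors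
off the zero section, where F may fail to be smooth. -/
theorem contDiffOn_locNorm (p : M) :
    ContDiffOn ℝ ∞ (fun z : EuclideanSpace ℝ (Fin n) × EuclideanSpace ℝ (Fin n) =>
      F.locNorm p z.1 z.2) ((extChartAt (𝓡 n) p).target ×ˢ {0}ᶜ) := by
  rw [← contMDiffOn_iff_contDiffOn]
  set e := trivializationAt (EuclideanSpace ℝ (Fin n)) (TangentSpace (𝓡 n)) p with he
  have h1 : ContMDiffOn ((𝓡 n).prod 𝓘(ℝ, EuclideanSpace ℝ (Fin n))) (𝓡 n).tangent ∞
      e.toOpenPartialHomeomorph.symm e.target := e.contMDiffOn_symm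
  have h2 : ContMDiffOn (𝓘(ℝ, EuclideanSpace ℝ (Fin n)).prod 𝓘(ℝ, EuclideanSpace ℝ (Fin n)))
      ((𝓡 n).prod 𝓘(ℝ, EuclideanSpace ℝ (Fin n))) ∞
      (Prod.map (extChartAt (𝓡 n) p).symm
        (id : EuclideanSpace ℝ (Fin n) → EuclideanSpace ℝ (Fin n)))
      ((extChartAt (𝓡 n) p).target ×ˢ {0}ᶜ) :=
    (contMDiffOn_extChartAt_symm p).prodMap contMDiffOn_id
  rw [← modelWithCornersSelf_prod] at h2
  have hm : ∀ z ∈ (extChartAt (𝓡 n) p).target ×ˢ ({0}ᶜ : Set (EuclideanSpace ℝ (Fin n))),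
      (Prod.map (extChartAt (𝓡 n) p).symm
        (id : EuclideanSpace ℝ (Fin n) → EuclideanSpace ℝ (Fin n))) z ∈ e.target := by
    intro z hz
    rw [e.mem_target]
    exact mem_baseSet ((extChartAt (𝓡 n) p).map_target hz.1)
  have h3 := h1.comp h2 hm
  have h4 := F.smooth.comp h3 (by
    intro z hz
    have h5 := mem_baseSet ((extChartAt (𝓡 n) p).map_target hz.1)
    have h6 : ∀ (w : TangentBundle (𝓡 n) M) (b : M) (u : TangentSpace (𝓡 n) b), w = ⟨b, u⟩ →
        u ≠ 0 → w ∈ {v : TangentBundle (𝓡 n) M | v.2 ≠ 0} := by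
      rintro _ b u rfl hu
      exact hu
    refine h6 _ _ _ (Trivialization.symm_apply_eq_mk_continuousLinearEquivAt_symm (R := ℝ) e _ h5 _) ?_
    exact fun h => hz.2 ((ContinuousLinearEquiv.map_eq_zero_iff _).1 h))
  rw [chartedSpaceSelf_prod] at h4
  exact h4

theorem legendre_eq {p q : M} (hq : q ∈ (extChartAt (𝓡 n) p).source)
    (y v : TangentSpace (𝓡 n) q) :
    F.legendre q y v = minkowskiLegendre (F.locNorm p (extChartAt (𝓡 n) p q))
      (vecCoord p ⟨q, y⟩) (vecCoord p ⟨q, v⟩) := by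
  unfold legendre minkowskiLegendre
  congr 2
  ext s
  rw [← F.locNorm_vecCoord hq]
  simp only [vecCoord_eq p q hq, map_add, map_smul]

theorem isMinkowskiNorm_locNorm {p : M} {x : EuclideanSpace ℝ (Fin n)}
    (hx : x ∈ (extChartAt (𝓡 n) p).target) : IsMinkowskiNorm (F.locNorm p x) := by
  set q := (extChartAt (𝓡 n) p).symm x with hq'
  have hq : q ∈ (extChartAt (𝓡 n) p).source := (extChartAt (𝓡 n) p).map_target hx
  have hx' : x = extChartAt (𝓡 n) p q := ((extChartAt (𝓡 n) p).right_inv hx).symm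
  refine ⟨fun y => F.nonneg _, ?_, fun y r hr => ?_, fun y u hy hu => ?_⟩
  · exact (F.contDiffOn_locNorm p).comp (g := fun z : EuclideanSpace ℝ (Fin n) × EuclideanSpace ℝ (Fin n) =>
      F.locNorm p z.1 z.2) (f := fun v => (x, v)) (by fun_prop) fun v hv => ⟨hx, hv⟩
  · rw [hx', F.locNorm_eq_coordEquiv hq, F.locNorm_eq_coordEquiv hq, map_smul,
      F.homogeneous _ _ _ hr]
  · have h := F.posDef q ((coordEquiv p q hq).symm y) ((coordEquiv p q hq).symm u)
      (by simpa using hy) (by simpa using hu)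
    rw [hx']
    simp only [F.locNorm_eq_coordEquiv hq, map_add, map_smul]
    exact h

end FinslerStructure

/-! ### Piecewise smooth curves, length and distance -/

namespace Finsler

variable {n : ℕ} {M : Type*} [TopologicalSpace M]
  [ChartedSpace (EuclideanSpace ℝ (Fin n)) M]

namespace PiecewiseSmooth

variable {γ γ' : ℝ → M} {s t : ℝ}

theorem le (h : PiecewiseSmooth n γ s t) : s ≤ t := by
  induction h with
  | smooth hst _ => exact hst
  | concat _ _ h₁ h₂ => exact h₁.trans h₂

theorem continuousOn (h : PiecewiseSmooth n γ s t) : ContinuousOn γ (Icc s t) := by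
  induction h with
  | smooth _ h => exact h.continuousOn
  | concat h₁ h₂ i₁ i₂ =>
    rw [← Icc_union_Icc_eq_Icc h₁.le h₂.le]
    exact i₁.union_of_isClosed i₂ isClosed_Icc isClosed_Icc

theorem restrict (h : PiecewiseSmooth n γ s t) {s' t' : ℝ} (hs : s ≤ s') (hst : s' ≤ t')
    (ht : t' ≤ t) : PiecewiseSmooth n γ s' t' := by
  induction h generalizing s' t' with
  | smooth _ h => exact smooth hst (h.mono (Icc_subset_Icc hs ht))
  | @concat s m u h₁ h₂ i₁ i₂ =>
    rcases le_total t' m with h3 | h3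
    · exact i₁ hs hst h3
    rcases le_total m s' with h4 | h4
    · exact i₂ h4 hst ht
    exact concat (i₁ hs h4 le_rfl) (i₂ le_rfl h3 ht)

theorem congr (h : PiecewiseSmooth n γ s t) (he : EqOn γ' γ (Icc s t)) :
    PiecewiseSmooth n γ' s t := by
  induction h with
  | smooth hst h => exact smooth hst (h.congr he)
  | concat h₁ h₂ i₁ i₂ =>
    exact concat (i₁ (he.mono (Icc_subset_Icc le_rfl h₂.le)))
      (i₂ (he.mono (Icc_subset_Icc h₁.le le_rfl)))

theorem comp_add (h : PiecewiseSmooth n γ s t) (c : ℝ) :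
    PiecewiseSmooth n (fun u => γ (u + c)) (s - c) (t - c) := by
  induction h with
  | @smooth s t hst h =>
    refine smooth (by linarith) ?_
    have h1 : ContMDiffOn 𝓘(ℝ, ℝ) 𝓘(ℝ, ℝ) ∞ (fun u : ℝ => u + c) (Icc (s - c) (t - c)) := by
      rw [contMDiffOn_iff_contDiffOn]
      fun_prop
    exact h.comp h1 fun u hu => ⟨by linarith [hu.1], by linarith [hu.2]⟩
  | concat h₁ h₂ i₁ i₂ => exact concat i₁ i₂

/-- Corners form a null set, so the default value 0 of `mfderiv` at a corner does not affect
lengths. -/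
theorem ae_mdifferentiableAt (h : PiecewiseSmooth n γ s t) :
    ∀ᵐ u, u ∈ Icc s t → MDifferentiableAt 𝓘(ℝ, ℝ) (𝓡 n) γ u := by
  induction h with
  | @smooth s t hst h =>
    have h1 : ∀ᵐ u : ℝ, u ≠ s := by simp [ae_iff]
    have h2 : ∀ᵐ u : ℝ, u ≠ t := by simp [ae_iff]
    filter_upwards [h1, h2] with u hs ht hu
    exact (h.contMDiffAt (Icc_mem_nhds (lt_of_le_of_ne hu.1 hs.symm)
      (lt_of_le_of_ne hu.2 ht))).mdifferentiableAt (by simp)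
  | @concat s m u h₁ h₂ i₁ i₂ =>
    filter_upwards [i₁, i₂] with x h1 h2 hx
    rcases le_total x m with h | h
    · exact h1 ⟨hx.1, h⟩
    · exact h2 ⟨h, hx.2⟩

end PiecewiseSmooth

theorem velocity_congr {γ γ' : ℝ → M} {t : ℝ} (h : γ =ᶠ[𝓝 t] γ') :
    (velocity γ t : TangentBundle (𝓡 n) M) = velocity γ' t := by
  have h1 : γ t = γ' t := h.eq_of_nhds
  have h2 := h.mfderiv_eq (I := 𝓘(ℝ, ℝ)) (I' := 𝓡 n)
  unfold velocity
  refine Bundle.TotalSpace.ext h1 (heq_of_eq ?_)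
  exact congrArg (fun A => A (1 : ℝ)) h2

theorem velocity_comp_add {γ : ℝ → M} {t c : ℝ}
    (h : MDifferentiableAt 𝓘(ℝ, ℝ) (𝓡 n) γ (t + c)) :
    (velocity (fun u => γ (u + c)) t : TangentBundle (𝓡 n) M) = velocity γ (t + c) := by
  unfold velocity
  congr 1
  have h1 : HasMFDerivAt 𝓘(ℝ, ℝ) 𝓘(ℝ, ℝ) (fun u : ℝ => u + c) t (ContinuousLinearMap.id ℝ ℝ) :=
    ((hasFDerivAt_id t).add_const c).hasMFDerivAt
  have h2 := (HasMFDerivAt.comp t h.hasMFDerivAt h1).mfderiv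
  exact congrArg (fun A => A (1 : ℝ)) h2

end Finsler

namespace FinslerStructure

open Finsler

variable {n : ℕ} {M : Type*} [TopologicalSpace M]
  [ChartedSpace (EuclideanSpace ℝ (Fin n)) M] [IsManifold (𝓡 n) ∞ M]
  (F : FinslerStructure n M)

/-- The two-sided velocity at an end point depends on the curve outside the interval; dropping the
ends makes the length depend only on the curve inside. -/
theorem length_eq_Ioo (γ : ℝ → M) (s t : ℝ) :
    F.length γ s t = ∫⁻ u in Ioo s t, ENNReal.ofReal (F.toFun (velocity γ u)) :=
  setLIntegral_congr Ioo_ae_eq_Icc.symm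

theorem length_congr {γ γ' : ℝ → M} {s t : ℝ} (h : EqOn γ γ' (Icc s t)) :
    F.length γ s t = F.length γ' s t := by
  rw [length_eq_Ioo, length_eq_Ioo]
  refine setLIntegral_congr_fun measurableSet_Ioo fun u hu => ?_
  have : γ =ᶠ[𝓝 u] γ' := by
    filter_upwards [Icc_mem_nhds hu.1 hu.2] with x hx using h hx
  simp only [velocity_congr this]

theorem length_add (γ : ℝ → M) {s t u : ℝ} (h₁ : s ≤ t) (h₂ : t ≤ u) :
    F.length γ s t + F.length γ t u = F.length γ s u := by
  rw [length_eq_Ioo F γ s t]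
  unfold length
  rw [← Ico_union_Icc_eq_Icc h₁ h₂, lintegral_union measurableSet_Icc,
    setLIntegral_congr Ioo_ae_eq_Ico]
  rw [Set.disjoint_left]
  intro x hx hx'
  exact absurd hx.2 (not_lt.2 hx'.1)

theorem length_comp_add {γ : ℝ → M} {s t : ℝ} (h : PiecewiseSmooth n γ s t) (c : ℝ) :
    F.length (fun u => γ (u + c)) (s - c) (t - c) = F.length γ s t := by
  unfold length
  have h1 := (measurePreserving_add_right (volume : Measure ℝ) c).setLIntegral_comp_preimage_emb
    (MeasurableEquiv.addRight c).measurableEmbedding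
    (fun u => ENNReal.ofReal (F.toFun (velocity γ u : TangentBundle (𝓡 n) M))) (Icc s t)
  rw [← h1, preimage_add_const_Icc]
  refine setLIntegral_congr_fun_ae measurableSet_Icc ?_
  have h2 := (measurePreserving_add_right (volume : Measure ℝ) c).quasiMeasurePreserving.ae
    h.ae_mdifferentiableAt
  filter_upwards [h2] with u hu hu'
  rw [velocity_comp_add (hu ⟨by linarith [hu'.1], by linarith [hu'.2]⟩)]

theorem length_eq_of_unitSpeed {γ : ℝ → M} {T s t : ℝ} (h : PiecewiseSmooth n γ 0 T)
    (hF : ∀ t ∈ Ioo 0 T, MDifferentiableAt 𝓘(ℝ, ℝ) (𝓡 n) γ t → F.toFun (velocity γ t) = 1)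
    (hs : 0 ≤ s) (ht : t ≤ T) : F.length γ s t = ENNReal.ofReal (t - s) := by
  rw [length_eq_Ioo]
  have : ∫⁻ u in Ioo s t, ENNReal.ofReal (F.toFun (velocity γ u : TangentBundle (𝓡 n) M)) =
      ∫⁻ u in Ioo s t, 1 := by
    refine setLIntegral_congr_fun_ae measurableSet_Ioo ?_
    filter_upwards [h.ae_mdifferentiableAt] with u hu hu'
    have h0 : 0 < u := hs.trans_lt hu'.1
    have h1 : u < T := hu'.2.trans_le ht
    rw [hF u ⟨h0, h1⟩ (hu ⟨h0.le, h1.le⟩), ENNReal.ofReal_one]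
  rw [this]
  simp

theorem dist_le_length {γ : ℝ → M} {s t : ℝ} (h : PiecewiseSmooth n γ s t) :
    F.dist (γ s) (γ t) ≤ F.length γ s t := by
  unfold dist
  exact iInf_le_of_le γ (iInf_le_of_le s (iInf_le_of_le t (iInf_le_of_le h
    (iInf_le_of_le rfl (iInf_le_of_le rfl le_rfl)))))

theorem exists_length_lt {p q : M} {r : ℝ≥0∞} (h : F.dist p q < r) :
    ∃ (γ : ℝ → M) (s t : ℝ), PiecewiseSmooth n γ s t ∧ γ s = p ∧ γ t = q ∧
      F.length γ s t < r := by
  unfold dist at h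
  simp only [iInf_lt_iff] at h
  obtain ⟨γ, s, t, h1, h2, h3, h4⟩ := h
  exact ⟨γ, s, t, h1, h2, h3, h4⟩

theorem le_dist {p q : M} {r : ℝ≥0∞} (h : ∀ (γ : ℝ → M) (s t : ℝ), PiecewiseSmooth n γ s t →
    γ s = p → γ t = q → r ≤ F.length γ s t) : r ≤ F.dist p q := by
  unfold dist
  simp only [le_iInf_iff]
  exact h

theorem dist_self (p : M) : F.dist p p = 0 := by
  have h : PiecewiseSmooth n (fun _ : ℝ => p) 0 0 := .smooth le_rfl contMDiffOn_const
  have h1 := F.dist_le_length h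
  have h2 : F.length (fun _ : ℝ => p) 0 0 = 0 := by
    rw [length_eq_Ioo]; simp
  rw [h2] at h1
  exact le_antisymm h1 bot_le

/-- Nearly shortest curves are concatenated, after a shift of the parameter of the second one. -/
theorem dist_triangle (p q r : M) : F.dist p r ≤ F.dist p q + F.dist q r := by
  refine le_of_forall_gt_imp_ge_of_dense fun x hx => ?_
  obtain ⟨a, b, ha, hb, hab⟩ : ∃ a b, F.dist p q < a ∧ F.dist q r < b ∧ a + b ≤ x := by
    have hfin : F.dist p q + F.dist q r ≠ ⊤ := hx.ne_top
    rw [ENNReal.add_ne_top] at hfin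
    have key : ∀ x y z : ℝ≥0∞, x ≠ ⊤ → x + y < z → ∃ a, x < a ∧ a + y < z := by
      intro x y z hx h
      have hc : ContinuousAt (fun a => a + y) x := by fun_prop
      have h1 := (hc.eventually_lt_const h).filter_mono (nhdsWithin_le_nhds (s := Ioi x))
      have : (𝓝[>] x).NeBot := nhdsGT_neBot_of_exists_gt ⟨⊤, lt_top_iff_ne_top.2 hx⟩
      obtain ⟨a, ha, h⟩ := (h1.and self_mem_nhdsWithin).exists
      exact ⟨a, h, ha⟩
    obtain ⟨a, ha, hax⟩ := key _ _ _ hfin.1 hx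
    obtain ⟨b, hb, hbx⟩ := key _ _ _ hfin.2 (add_comm a _ ▸ hax)
    rw [add_comm] at hbx
    exact ⟨a, b, ha, hb, hbx.le⟩
  obtain ⟨γ₁, s₁, t₁, h₁, e₁, e₁', l₁⟩ := F.exists_length_lt ha
  obtain ⟨γ₂, s₂, t₂, h₂, e₂, e₂', l₂⟩ := F.exists_length_lt hb
  set c := s₂ - t₁ with hc
  have h₃ := h₂.comp_add c
  have l₃ := F.length_comp_add h₂ c
  have hs : s₂ - c = t₁ := by rw [hc]; ring
  rw [hs] at h₃ l₃
  set γ : ℝ → M := fun u => if u ≤ t₁ then γ₁ u else γ₂ (u + c) with hγ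
  have g1 : EqOn γ γ₁ (Icc s₁ t₁) := fun u hu => by simp [hγ, hu.2]
  have g2 : EqOn γ (fun u => γ₂ (u + c)) (Icc t₁ (t₂ - c)) := fun u hu => by
    simp only [hγ]
    split_ifs with h
    · have : u = t₁ := le_antisymm h hu.1
      rw [this, e₁', ← e₂, ← hs]
      simp
    · rfl
  have h₄ := F.dist_le_length (.concat (h₁.congr g1) (h₃.congr g2))
  rw [← F.length_add γ h₁.le h₃.le, F.length_congr g1, F.length_congr g2, l₃] at h₄
  have e3 : γ s₁ = p := by rw [g1 ⟨le_rfl, h₁.le⟩, e₁]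
  have e4 : γ (t₂ - c) = r := by
    rw [g2 ⟨h₃.le, le_rfl⟩]
    simp [e₂']
  rw [e3, e4] at h₄
  exact h₄.trans ((add_le_add l₁.le l₂.le).trans hab)

end FinslerStructure

/-! ### Comparison of the distance with Minkowski norms in charts -/

/-- A path that starts in the open set `O` and leaves it stays up to its exit in any closed set
containing `O`. -/
theorem exists_exit_time {X : Type*} [TopologicalSpace X] {γ : ℝ → X} {s t : ℝ}
    (hγ : ContinuousOn γ (Icc s t)) {O K : Set X} (hO : IsOpen O) (hK : IsClosed K) (hOK : O ⊆ K)
    (hs : γ s ∈ O) (hu : ∃ u ∈ Icc s t, γ u ∉ O) :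
    ∃ t' ∈ Icc s t, γ t' ∉ O ∧ MapsTo γ (Icc s t') K := by
  set B : Set ℝ := Icc s t ∩ γ ⁻¹' Oᶜ with hB
  have hBc : IsCompact B :=
    isCompact_Icc.of_isClosed_subset (hγ.preimage_isClosed_of_isClosed isClosed_Icc hO.isClosed_compl)
      inter_subset_left
  obtain ⟨t', ht', hmin⟩ := hBc.exists_isLeast (by obtain ⟨u, hu, hu'⟩ := hu; exact ⟨u, hu, hu'⟩)
  refine ⟨t', ht'.1, ht'.2, ?_⟩
  have hst' : s < t' := lt_of_le_of_ne ht'.1.1 (by rintro rfl; exact ht'.2 hs)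
  have hbefore : ∀ u ∈ Ico s t', γ u ∈ K := by
    intro u hu
    by_contra h
    exact absurd (hmin ⟨⟨hu.1, hu.2.le.trans ht'.1.2⟩, fun h' => h (hOK h')⟩) (not_le.2 hu.2)
  intro u hu
  rcases hu.2.eq_or_lt with rfl | h
  · have h1 : ContinuousWithinAt γ (Ico s u) u :=
      (hγ u ht'.1).mono (Ico_subset_Icc_self.trans (Icc_subset_Icc le_rfl ht'.1.2))
    have h2 := h1.mem_closure_image (by rw [closure_Ico hst'.ne]; exact ⟨hst'.le, le_rfl⟩)
    rw [← hK.closure_eq]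
    exact closure_mono (by rintro _ ⟨v, hv, rfl⟩; exact hbefore v hv) h2
  · exact hbefore u ⟨hu.1, h⟩

/-- This is the exit time of the reversed path. -/
theorem exists_entrance_time {X : Type*} [TopologicalSpace X] {γ : ℝ → X} {s t : ℝ}
    (hγ : ContinuousOn γ (Icc s t)) {O K : Set X} (hO : IsOpen O) (hK : IsClosed K) (hOK : O ⊆ K)
    (hs : γ t ∈ O) (hu : ∃ u ∈ Icc s t, γ u ∉ O) :
    ∃ s' ∈ Icc s t, γ s' ∉ O ∧ MapsTo γ (Icc s' t) K := by
  have h1 : ContinuousOn (fun u => γ (-u)) (Icc (-t) (-s)) :=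
    hγ.comp continuous_neg.continuousOn fun u hu => ⟨by linarith [hu.2], by linarith [hu.1]⟩
  obtain ⟨u, hu, hu'⟩ := hu
  obtain ⟨t', ht', h2, h3⟩ := exists_exit_time h1 hO hK hOK (by simpa using hs)
    ⟨-u, ⟨by linarith [hu.2], by linarith [hu.1]⟩, by simpa using hu'⟩
  refine ⟨-t', ⟨by linarith [ht'.2], by linarith [ht'.1]⟩, h2, fun x hx => ?_⟩
  have := h3 (x := -x) ⟨by linarith [hx.2], by linarith [hx.1]⟩
  simpa using this

section local_bounds

variable {E : Type*} [NormedAddCommGroup E] [NormedSpace ℝ E] [FiniteDimensional ℝ E]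

/-- A Minkowski norm that depends continuously on a parameter varies little compared to the
norm. -/
theorem exists_ball_norm_sub_le {N : E → E → ℝ} {V : Set E} (hV : IsOpen V)
    (hN : ∀ x ∈ V, IsMinkowskiNorm (N x))
    (hc : ContinuousOn (fun z : E × E => N z.1 z.2) (V ×ˢ {0}ᶜ)) {x₀ : E} (hx₀ : x₀ ∈ V) {η : ℝ}
    (hη : 0 < η) :
    ∃ r > 0, Metric.closedBall x₀ r ⊆ V ∧
      ∀ x ∈ Metric.closedBall x₀ r, ∀ v, |N x v - N x₀ v| ≤ η * ‖v‖ := by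
  obtain ⟨r₀, hr₀, hr₀V⟩ := Metric.nhds_basis_closedBall.mem_iff.1 (hV.mem_nhds hx₀)
  -- Uniform continuity on ball × unit sphere gives the estimate for unit vectors; homogeneity
  -- extends it to all v.
  have hK : IsCompact (Metric.closedBall x₀ r₀ ×ˢ Metric.sphere (0 : E) 1) :=
    (isCompact_closedBall x₀ r₀).prod (isCompact_sphere 0 1)
  have hu := hK.uniformContinuousOn_of_continuous (hc.mono (prod_mono hr₀V fun v hv => by
    rintro rfl; simp at hv))
  rw [Metric.uniformContinuousOn_iff] at hu
  obtain ⟨δ, hδ, hu⟩ := hu η hη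
  refine ⟨min r₀ (δ / 2), by positivity, (Metric.closedBall_subset_closedBall (min_le_left _ _)).trans
    hr₀V, fun x hx v => ?_⟩
  have hxr : x ∈ Metric.closedBall x₀ r₀ := Metric.closedBall_subset_closedBall (min_le_left _ _) hx
  by_cases hv : v = 0
  · subst hv
    rw [(hN x (hr₀V hxr)).map_zero, (hN x₀ hx₀).map_zero]
    simp
  have hv' : 0 < ‖v‖ := norm_pos_iff.2 hv
  have hw : ‖v‖⁻¹ • v ∈ Metric.sphere (0 : E) 1 := by
    simp [norm_smul, hv'.ne']
  have := hu (x, ‖v‖⁻¹ • v) ⟨hxr, hw⟩ (x₀, ‖v‖⁻¹ • v) ⟨by simp [hr₀.le], hw⟩ (by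
    rw [Prod.dist_eq]
    simp only [dist_self, max_lt_iff, hδ, and_true]
    have : dist x x₀ ≤ δ / 2 := (Metric.mem_closedBall.1 hx).trans (min_le_right _ _)
    linarith)
  simp only [] at this
  rw [(hN x (hr₀V hxr)).homogeneous _ _ (inv_pos.2 hv'), (hN x₀ hx₀).homogeneous _ _ (inv_pos.2 hv'),
    Real.dist_eq, ← mul_sub, abs_mul, abs_of_pos (inv_pos.2 hv'), inv_mul_lt_iff₀ hv'] at this
  linarith

theorem IsMinkowskiNorm.exists_bounds {N : E → ℝ} (hN : IsMinkowskiNorm N) :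
    ∃ m > 0, ∃ C > 0, ∀ v, m * ‖v‖ ≤ N v ∧ N v ≤ C * ‖v‖ := by
  have hc : ContinuousOn N (Metric.sphere (0 : E) 1) :=
    hN.smooth.continuousOn.mono fun v hv => by rintro rfl; simp at hv
  obtain ⟨m, hm, hm'⟩ : ∃ m > 0, ∀ v ∈ Metric.sphere (0 : E) 1, m ≤ N v := by
    -- The unit sphere is empty if E is trivial.
    rcases (Metric.sphere (0 : E) 1).eq_empty_or_nonempty with h | h
    · exact ⟨1, one_pos, fun v hv => by simp [h] at hv⟩
    · obtain ⟨v, hv, hmin⟩ := (isCompact_sphere (0 : E) 1).exists_isMinOn h hc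
      exact ⟨N v, hN.pos (by rintro rfl; simp at hv), fun w hw => hmin hw⟩
  obtain ⟨C, hC⟩ := (isCompact_sphere (0 : E) 1).exists_bound_of_continuousOn hc
  refine ⟨m, hm, max C 1, by positivity, fun v => ?_⟩
  by_cases hv : v = 0
  · subst hv; simp [hN.map_zero]
  have hv' : 0 < ‖v‖ := norm_pos_iff.2 hv
  have hw : ‖v‖⁻¹ • v ∈ Metric.sphere (0 : E) 1 := by
    simp [norm_smul, hv'.ne']
  have h1 := hm' _ hw
  have h2 := (le_abs_self _).trans (hC _ hw)
  rw [hN.homogeneous _ _ (inv_pos.2 hv'), inv_mul_eq_div] at h1 h2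
  rw [le_div_iff₀ hv'] at h1
  rw [div_le_iff₀ hv'] at h2
  exact ⟨h1, h2.trans (by gcongr; exact le_max_left _ _)⟩

end local_bounds

namespace FinslerStructure

open Finsler

variable {n : ℕ} {M : Type*} [TopologicalSpace M]
  [ChartedSpace (EuclideanSpace ℝ (Fin n)) M] [IsManifold (𝓡 n) ∞ M]
  (F : FinslerStructure n M)

/-- The differential of a real function, as a real number. -/
def _root_.Finsler.differential (f : M → ℝ) (x : M) (v : TangentSpace (𝓡 n) x) : ℝ :=
  mfderiv (𝓡 n) 𝓘(ℝ, ℝ) f x v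

/-- A function with differential bounded by `F` bounds the length of curves from below. -/
theorem sub_le_length {h : M → ℝ} {U S : Set M} (hU : IsOpen U)
    (hh : ContMDiffOn (𝓡 n) 𝓘(ℝ, ℝ) 1 h U) (hSU : S ⊆ U)
    (hle : ∀ x ∈ S, ∀ v : TangentSpace (𝓡 n) x, differential h x v ≤ F.toFun ⟨x, v⟩)
    {γ : ℝ → M} {s t : ℝ} (hγ : PiecewiseSmooth n γ s t) (hS : MapsTo γ (Icc s t) S) :
    ENNReal.ofReal (h (γ t) - h (γ s)) ≤ F.length γ s t := by
  induction hγ with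
  | @smooth s t hst hγ =>
    have hu : ContDiffOn ℝ 1 (h ∘ γ) (Icc s t) := by
      rw [← contMDiffOn_iff_contDiffOn]
      exact hh.comp (hγ.of_le (by norm_cast)) fun x hx => hSU (hS hx)
    rcases hst.eq_or_lt with rfl | hlt
    · simp
    have h1 := intervalIntegral.integral_derivWithin_Icc_of_contDiffOn_Icc hu hst
    have hcont : ContinuousOn (derivWithin (h ∘ γ) (Icc s t)) (Icc s t) :=
      hu.continuousOn_derivWithin (uniqueDiffOn_Icc hlt) le_rfl
    have h2 : ENNReal.ofReal (∫ x in s..t, derivWithin (h ∘ γ) (Icc s t) x) ≤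
        ∫⁻ x in Ioo s t, ENNReal.ofReal (derivWithin (h ∘ γ) (Icc s t) x) := by
      rw [intervalIntegral.integral_of_le hst, setIntegral_congr_set Ioo_ae_eq_Ioc.symm]
      set g := derivWithin (h ∘ γ) (Icc s t)
      have hint : IntegrableOn g (Ioo s t) :=
        (hcont.integrableOn_Icc).mono_set Ioo_subset_Icc_self
      -- The derivative may be negative; `ENNReal.ofReal` sees only its positive part, whose
      -- integral is at least as large.
      calc ENNReal.ofReal (∫ x in Ioo s t, g x) ≤ ENNReal.ofReal (∫ x in Ioo s t, max (g x) 0) := by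
            apply ENNReal.ofReal_le_ofReal
            exact integral_mono hint hint.pos_part fun x => le_max_left _ _
        _ = ∫⁻ x in Ioo s t, ENNReal.ofReal (max (g x) 0) :=
            ofReal_integral_eq_lintegral_ofReal hint.pos_part
              (Eventually.of_forall fun x => le_max_right _ _)
        _ = _ := by simp
    have e1 : h (γ t) - h (γ s) = ∫ x in s..t, derivWithin (h ∘ γ) (Icc s t) x := h1.symm
    rw [e1, length_eq_Ioo]
    refine h2.trans (setLIntegral_mono' measurableSet_Ioo fun u hu' => ?_)
    apply ENNReal.ofReal_le_ofReal
    have hn : Icc s t ∈ 𝓝 u := Icc_mem_nhds hu'.1 hu'.2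
    rw [derivWithin_of_mem_nhds hn]
    have hus := hS (Ioo_subset_Icc_self hu')
    have hγd : MDifferentiableAt 𝓘(ℝ, ℝ) (𝓡 n) γ u :=
      (hγ.contMDiffAt hn).mdifferentiableAt (by simp)
    have hhd : MDifferentiableAt (𝓡 n) 𝓘(ℝ, ℝ) h (γ u) :=
      (hh.contMDiffAt (hU.mem_nhds (hSU hus))).mdifferentiableAt (by simp)
    have h3 := mfderiv_comp u hhd hγd
    rw [mfderiv_eq_fderiv] at h3
    have h4 := congrArg (fun A => A (1 : ℝ)) h3
    have h5 := hle (γ u) hus (mfderiv 𝓘(ℝ, ℝ) (𝓡 n) γ u (1 : ℝ))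
    have h6 : deriv (h ∘ γ) u = differential h (γ u) (mfderiv 𝓘(ℝ, ℝ) (𝓡 n) γ u (1 : ℝ)) := h4
    exact h6.le.trans h5
  | @concat s m t h₁ h₂ i₁ i₂ =>
    rw [← F.length_add γ h₁.le h₂.le]
    refine le_trans ?_ (add_le_add (i₁ (hS.mono_left (Icc_subset_Icc le_rfl h₂.le)))
      (i₂ (hS.mono_left (Icc_subset_Icc h₁.le le_rfl))))
    refine le_trans (le_of_eq ?_) ENNReal.ofReal_add_le
    congr 1
    ring

/-- The Finsler distance of close points is at most the Minkowski norm of the difference in a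
chart, up to a small relative error. -/
theorem exists_dist_le_locNorm {p q : M} (hq : q ∈ (extChartAt (𝓡 n) p).source) {η : ℝ}
    (hη : 0 < η) :
    ∃ r > 0, Metric.closedBall (extChartAt (𝓡 n) p q) r ⊆ (extChartAt (𝓡 n) p).target ∧
      ∀ x ∈ Metric.closedBall (extChartAt (𝓡 n) p q) r,
      ∀ y ∈ Metric.closedBall (extChartAt (𝓡 n) p q) r,
      F.dist ((extChartAt (𝓡 n) p).symm x) ((extChartAt (𝓡 n) p).symm y) ≤
        ENNReal.ofReal (F.locNorm p (extChartAt (𝓡 n) p q) (y - x) + η * ‖y - x‖) := by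
  set φ := extChartAt (𝓡 n) p with hφ
  obtain ⟨r, hr, hrV, hN⟩ := exists_ball_norm_sub_le (N := F.locNorm p)
    (isOpen_extChartAt_target p) (fun x hx => F.isMinkowskiNorm_locNorm hx)
    (F.contDiffOn_locNorm p).continuousOn (φ.map_source hq) hη
  refine ⟨r, hr, hrV, fun x hx y hy => ?_⟩
  -- The comparison curve is the coordinate segment from x to y, which stays in the ball by
  -- convexity.
  have hmem : ∀ u ∈ Icc (0 : ℝ) 1, x + u • (y - x) ∈ Metric.closedBall (φ q) r := fun u hu =>
    (convex_closedBall (φ q) r).add_smul_sub_mem hx hy hu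
  have hline : ContDiff ℝ ∞ (fun u : ℝ => x + u • (y - x)) := by fun_prop
  have hsm : ContMDiffOn 𝓘(ℝ, ℝ) (𝓡 n) ∞ (fun u : ℝ => φ.symm (x + u • (y - x))) (Icc 0 1) :=
    (contMDiffOn_extChartAt_symm p).comp hline.contMDiff.contMDiffOn fun u hu => hrV (hmem u hu)
  have h1 := F.dist_le_length (PiecewiseSmooth.smooth zero_le_one hsm)
  simp only [zero_smul, add_zero, one_smul, add_sub_cancel] at h1
  refine h1.trans ?_
  rw [length_eq_Ioo]
  refine (setLIntegral_mono' (g := fun _ => ENNReal.ofReal (F.locNorm p (φ q) (y - x) + η * ‖y - x‖))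
    measurableSet_Ioo fun u hu => ?_).trans (by simp)
  apply ENNReal.ofReal_le_ofReal
  have hu' := hmem u (Ioo_subset_Icc_self hu)
  have hs : φ.symm (x + u • (y - x)) ∈ φ.source := φ.map_target (hrV hu')
  have hd : MDifferentiableAt 𝓘(ℝ, ℝ) (𝓡 n) (fun u : ℝ => φ.symm (x + u • (y - x))) u :=
    (hsm.contMDiffAt (Icc_mem_nhds hu.1 hu.2)).mdifferentiableAt (by simp)
  have h2 := vecCoord_velocity (γ := fun u : ℝ => φ.symm (x + u • (y - x))) (p := p) hs hd
  have h3 : deriv (fun s => extChartAt (𝓡 n) p (φ.symm (x + s • (y - x)))) u = y - x := by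
    have : (fun s => extChartAt (𝓡 n) p (φ.symm (x + s • (y - x)))) =ᶠ[𝓝 u]
        fun s => x + s • (y - x) := by
      filter_upwards [Icc_mem_nhds hu.1 hu.2] with s hs
      exact φ.right_inv (hrV (hmem s hs))
    rw [this.deriv_eq]
    exact HasDerivAt.deriv (by simpa using ((hasDerivAt_id u).smul_const (y - x)).const_add x)
  rw [h3] at h2
  have h4 := F.locNorm_vecCoord hs (mfderiv 𝓘(ℝ, ℝ) (𝓡 n) (fun u : ℝ => φ.symm (x + u • (y - x))) u (1 : ℝ))
  have h5 : F.toFun (velocity (fun u : ℝ => φ.symm (x + u • (y - x))) u) =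
      F.locNorm p (x + u • (y - x)) (y - x) := by
    refine Eq.trans h4.symm ?_
    rw [← hφ, φ.right_inv (hrV hu')]
    exact congrArg _ h2
  rw [h5]
  have := (abs_le.1 (hN _ hu' (y - x))).2
  linarith

end FinslerStructure

namespace FinslerStructure

open Finsler

variable {n : ℕ} {M : Type*} [TopologicalSpace M]
  [ChartedSpace (EuclideanSpace ℝ (Fin n)) M] [IsManifold (𝓡 n) ∞ M]
  (F : FinslerStructure n M)

/-- The length of a curve inside a region of a chart where `F` is bounded below by a multiple of a
fixed Minkowski norm. -/
theorem mul_le_length_of_mapsTo {p : M} {N : EuclideanSpace ℝ (Fin n) → ℝ} (hN : IsMinkowskiNorm N)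
    {k : ℝ} (hk : 0 ≤ k) {S : Set M} (hS : S ⊆ (extChartAt (𝓡 n) p).source)
    (hle : ∀ x ∈ S, ∀ v, k * N v ≤ F.locNorm p (extChartAt (𝓡 n) p x) v) {γ : ℝ → M} {s t : ℝ}
    (hγ : PiecewiseSmooth n γ s t) (hγS : MapsTo γ (Icc s t) S) :
    ENNReal.ofReal (k * N (extChartAt (𝓡 n) p (γ t) - extChartAt (𝓡 n) p (γ s))) ≤
      F.length γ s t := by
  set φ := extChartAt (𝓡 n) p with hφ
  set w := φ (γ t) - φ (γ s) with hw
  by_cases hw0 : w = 0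
  · rw [hw0, hN.map_zero]; simp
  have hpos := hN.pos hw0
  -- The supporting functional of kN at the displacement w: ℓ ≤ kN everywhere, with equality at w.
  -- So ℓ ∘ φ grows at most by the length, and by kN(w) from end to end.
  let ℓ : EuclideanSpace ℝ (Fin n) →L[ℝ] ℝ :=
    (k * (N w)⁻¹) • ((1 / 2 : ℝ) • fderiv ℝ (fun y => N y ^ 2) w)
  have hℓ : ∀ v, ℓ v = k * (N w)⁻¹ * minkowskiLegendre N w v := fun v => by
    rw [hN.legendre_eq_fderiv hw0]; rfl
  have hℓle : ∀ v, ℓ v ≤ k * N v := fun v => by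
    rw [hℓ, mul_assoc]
    refine mul_le_mul_of_nonneg_left ?_ hk
    rw [inv_mul_le_iff₀ hpos]
    exact hN.legendre_le w v
  have hh : ContMDiffOn (𝓡 n) 𝓘(ℝ, ℝ) 1 (fun x => ℓ (φ x)) φ.source := by
    have h1 : ContMDiffOn (𝓡 n) 𝓘(ℝ, EuclideanSpace ℝ (Fin n)) 1 φ φ.source := by
      rw [hφ, extChartAt_source]
      exact contMDiffOn_extChartAt
    exact ℓ.contMDiff.comp_contMDiffOn h1
  have h1 := F.sub_le_length (isOpen_extChartAt_source p) hh hS (fun x hx v => ?_) hγ hγS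
  · refine le_trans (ENNReal.ofReal_le_ofReal ?_) h1
    rw [← map_sub, ← hw, hℓ, hN.legendre_self]
    apply le_of_eq
    field_simp
  · have hx' := hS hx
    have h2 : differential (fun x => ℓ (φ x)) x v = ℓ (vecCoord p ⟨x, v⟩) := by
      have h3 := mfderiv_eq_fderiv_chart (f := fun x => ℓ (φ x)) hx'
        ((hh.contMDiffAt ((isOpen_extChartAt_source p).mem_nhds hx')).mdifferentiableAt (by simp)) v
      refine Eq.trans h3 ?_
      have h4 : (fun x => ℓ (φ (φ.symm x))) =ᶠ[𝓝 (φ x)] ℓ := by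
        filter_upwards [(isOpen_extChartAt_target p).mem_nhds (φ.map_source hx')] with y hy
        rw [φ.right_inv hy]
      rw [h4.fderiv_eq, ContinuousLinearMap.fderiv]
    rw [h2, ← F.locNorm_vecCoord hx']
    exact (hℓle _).trans (hle x hx _)

variable [T2Space M]

/-- The Finsler distance is bounded below by the Minkowski norm of the difference in a
chart, up to a small relative error, and points that are close for the distance are close. -/
theorem exists_locNorm_le_dist {p q : M} (hq : q ∈ (extChartAt (𝓡 n) p).source) {η : ℝ}
    (hη : 0 < η) (hη1 : η < 1) {U : Set M} (hU : U ∈ 𝓝 q) :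
    ∃ W ∈ 𝓝 q, ∃ δ > 0, ∀ x y, (x ∈ W ∨ y ∈ W) → F.dist x y < ENNReal.ofReal δ →
      x ∈ U ∧ y ∈ U ∧ x ∈ (extChartAt (𝓡 n) p).source ∧ y ∈ (extChartAt (𝓡 n) p).source ∧
      ENNReal.ofReal ((1 - η) * F.locNorm p (extChartAt (𝓡 n) p q)
        (extChartAt (𝓡 n) p y - extChartAt (𝓡 n) p x)) ≤ F.dist x y := by
  set φ := extChartAt (𝓡 n) p with hφ
  have hN := F.isMinkowskiNorm_locNorm (φ.map_source hq)
  obtain ⟨m, hm, C, hC, hmC⟩ := hN.exists_bounds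
  obtain ⟨r₁, hr₁, hr₁V, hr₁N⟩ := exists_ball_norm_sub_le (N := F.locNorm p)
    (isOpen_extChartAt_target p) (fun x hx => F.isMinkowskiNorm_locNorm hx)
    (F.contDiffOn_locNorm p).continuousOn (φ.map_source hq) (mul_pos hη hm)
  have hsymm : ContinuousAt φ.symm (φ q) := continuousAt_extChartAt_symm' hq
  obtain ⟨r₂, hr₂, hr₂U⟩ := Metric.nhds_basis_closedBall.mem_iff.1
    (hsymm (by rwa [φ.left_inv hq] : U ∈ 𝓝 (φ.symm (φ q))))
  set r := min r₁ r₂ with hr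
  have hr0 : 0 < r := lt_min hr₁ hr₂
  have hrV : Metric.closedBall (φ q) r ⊆ φ.target :=
    (Metric.closedBall_subset_closedBall (min_le_left _ _)).trans hr₁V
  set K : Set M := φ.symm '' Metric.closedBall (φ q) r with hK
  have hKc : IsClosed K := ((isCompact_closedBall (φ q) r).image_of_continuousOn
    ((continuousOn_extChartAt_symm p).mono hrV)).isClosed
  have hKs : K ⊆ φ.source := by
    rintro _ ⟨x, hx, rfl⟩
    exact φ.map_target (hrV hx)
  have hKb : ∀ x ∈ K, φ x ∈ Metric.closedBall (φ q) r := by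
    rintro _ ⟨x, hx, rfl⟩
    rwa [φ.right_inv (hrV hx)]
  have hKU : K ⊆ U := by
    rintro _ ⟨x, hx, rfl⟩
    exact hr₂U (Metric.closedBall_subset_closedBall (min_le_right _ _) hx)
  have hKle : ∀ x ∈ K, ∀ v, (1 - η) * F.locNorm p (φ q) v ≤ F.locNorm p (φ x) v := by
    intro x hx v
    have h1 := (abs_le.1 (hr₁N _ (Metric.closedBall_subset_closedBall (min_le_left _ _)
      (hKb x hx)) v)).1
    have h2 := mul_le_mul_of_nonneg_left (hmC v).1 hη.le
    nlinarith
  have hpath : ∀ (γ : ℝ → M) (s t : ℝ), PiecewiseSmooth n γ s t → MapsTo γ (Icc s t) K →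
      ENNReal.ofReal ((1 - η) * F.locNorm p (φ q) (φ (γ t) - φ (γ s))) ≤ F.length γ s t :=
    fun γ s t hγ hγK => F.mul_le_length_of_mapsTo hN (by linarith) hKs hKle hγ hγK
  set O : ℝ → Set M := fun ε => φ.source ∩ φ ⁻¹' Metric.ball (φ q) ε with hO
  have hOo : ∀ ε, IsOpen (O ε) := fun ε =>
    (continuousOn_extChartAt p).isOpen_inter_preimage (isOpen_extChartAt_source p) Metric.isOpen_ball
  have hOK : O r ⊆ K := fun x hx => ⟨φ x, Metric.ball_subset_closedBall hx.2, φ.left_inv hx.1⟩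
  have hOO : O (r / 2) ⊆ O r := fun x hx =>
    ⟨hx.1, Metric.ball_subset_ball (by linarith) hx.2⟩
  -- A curve between O (r / 2) and the complement of O r has length at least δ, so shorter curves
  -- with an end in O (r / 2) never leave K.
  set δ := (1 - η) * (m * (r / 2)) with hδ
  have hδ0 : 0 < δ := mul_pos (by linarith) (by positivity)
  have hfar : ∀ x y, ((x ∈ O (r / 2) ∧ y ∈ K \ O r) ∨ (y ∈ O (r / 2) ∧ x ∈ K \ O r)) →
      δ ≤ (1 - η) * F.locNorm p (φ q) (φ y - φ x) := by
    have key : ∀ x y, x ∈ O (r / 2) → y ∈ K \ O r → r / 2 ≤ ‖φ y - φ x‖ := by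
      intro x y hx hy
      have h1 : r ≤ Dist.dist (φ y) (φ q) := by
        by_contra h
        exact hy.2 ⟨hKs hy.1, not_le.1 h⟩
      have h2 : Dist.dist (φ x) (φ q) < r / 2 := hx.2
      have h3 := _root_.dist_triangle (φ y) (φ x) (φ q)
      rw [← dist_eq_norm]
      linarith
    intro x y hxy
    have h1 : r / 2 ≤ ‖φ y - φ x‖ := by
      rcases hxy with h | h
      · exact key x y h.1 h.2
      · rw [norm_sub_rev]; exact key y x h.1 h.2
    refine mul_le_mul_of_nonneg_left ?_ (by linarith)
    exact (mul_le_mul_of_nonneg_left h1 hm.le).trans (hmC _).1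
  have hstay : ∀ (γ : ℝ → M) (s t : ℝ), PiecewiseSmooth n γ s t →
      (γ s ∈ O (r / 2) ∨ γ t ∈ O (r / 2)) → F.length γ s t < ENNReal.ofReal δ →
      MapsTo γ (Icc s t) K := by
    intro γ s t hγ hst hlen
    by_contra hnot
    have hnot' : ∃ u ∈ Icc s t, γ u ∉ O r := by
      by_contra! h
      exact hnot fun u hu => hOK (h u hu)
    apply absurd hlen
    rw [not_lt]
    rcases hst with h | h
    · obtain ⟨t', ht', h1, h2⟩ := exists_exit_time hγ.continuousOn (hOo r) hKc hOK (hOO h) hnot'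
      have h3 := hpath γ s t' (hγ.restrict le_rfl ht'.1 ht'.2) h2
      rw [← F.length_add γ ht'.1 ht'.2]
      refine le_add_right (le_trans (ENNReal.ofReal_le_ofReal ?_) h3)
      exact hfar _ _ (Or.inl ⟨h, h2 ⟨ht'.1, le_rfl⟩, h1⟩)
    · obtain ⟨s', hs', h1, h2⟩ := exists_entrance_time hγ.continuousOn (hOo r) hKc hOK (hOO h) hnot'
      have h3 := hpath γ s' t (hγ.restrict hs'.1 hs'.2 le_rfl) h2
      rw [← F.length_add γ hs'.1 hs'.2]
      refine le_add_left (le_trans (ENNReal.ofReal_le_ofReal ?_) h3)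
      exact hfar _ _ (Or.inr ⟨h, h2 ⟨le_rfl, hs'.2⟩, h1⟩)
  refine ⟨O (r / 2), (hOo _).mem_nhds ⟨hq, Metric.mem_ball_self (by positivity)⟩, δ, hδ0,
    fun x y hxy hd => ?_⟩
  obtain ⟨γ, s, t, hγ, rfl, rfl, hlen⟩ := F.exists_length_lt hd
  have hmaps := hstay γ s t hγ hxy hlen
  have hxK := hmaps ⟨le_rfl, hγ.le⟩
  have hyK := hmaps ⟨hγ.le, le_rfl⟩
  refine ⟨hKU hxK, hKU hyK, hKs hxK, hKs hyK, ?_⟩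
  -- Curves that nearly realize the distance are shorter than δ, hence stay in K, where the length
  -- estimate applies.
  by_contra hlt
  rw [not_le] at hlt
  obtain ⟨γ', s', t', hγ', e1, e2, hlen'⟩ := F.exists_length_lt (lt_min hd hlt)
  have := hpath γ' s' t' hγ' (hstay γ' s' t' hγ' (by rwa [e1, e2])
    (hlen'.trans_le (min_le_left _ _)))
  rw [e1, e2] at this
  exact absurd (hlen'.trans_le (min_le_right _ _)) (not_lt.2 this)

theorem exists_nhds_of_dist_lt {q : M} {U : Set M} (hU : U ∈ 𝓝 q) :
    ∃ W ∈ 𝓝 q, ∃ δ > 0, ∀ x y, (x ∈ W ∨ y ∈ W) → F.dist x y < ENNReal.ofReal δ →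
      x ∈ U ∧ y ∈ U := by
  obtain ⟨W, hW, δ, hδ, h⟩ := F.exists_locNorm_le_dist (mem_extChartAt_source q)
    (η := 1 / 2) (by norm_num) (by norm_num) hU
  exact ⟨W, hW, δ, hδ, fun x y hxy hd => ⟨(h x y hxy hd).1, (h x y hxy hd).2.1⟩⟩

theorem eq_of_dist_eq_zero {x y : M} (h : F.dist x y = 0) : x = y := by
  by_contra hne
  obtain ⟨W, hW, δ, hδ, h1⟩ := F.exists_nhds_of_dist_lt (isOpen_compl_singleton.mem_nhds hne)
  exact (h1 x y (Or.inl (mem_of_mem_nhds hW)) (by rw [h]; simpa using hδ)).2 rfl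

omit [T2Space M] in
theorem eventually_dist_lt (q : M) {ε : ℝ≥0∞} (hε : 0 < ε) :
    ∀ᶠ z : M × M in 𝓝 (q, q), F.dist z.1 z.2 < ε := by
  set φ := extChartAt (𝓡 n) q with hφ
  have hq : q ∈ φ.source := mem_extChartAt_source q
  obtain ⟨r, hr, hrV, h⟩ := F.exists_dist_le_locNorm hq one_pos
  have hN := F.isMinkowskiNorm_locNorm (φ.map_source hq)
  obtain ⟨m, hm, C, hC, hmC⟩ := hN.exists_bounds
  have hc : ContinuousAt φ q := continuousAt_extChartAt q
  have hc2 : ContinuousAt (fun z : M × M => ENNReal.ofReal ((C + 1) * ‖φ z.2 - φ z.1‖)) (q, q) := by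
    refine ENNReal.continuous_ofReal.continuousAt.comp (continuousAt_const.mul (ContinuousAt.norm ?_))
    exact (ContinuousAt.comp (f := Prod.snd) hc continuousAt_snd).sub
      (ContinuousAt.comp (f := Prod.fst) hc continuousAt_fst)
  have h2 := hc2.tendsto.eventually_lt_const (u := ε) (by simpa using hε)
  have hO : ∀ᶠ x in 𝓝 q, x ∈ φ.source ∧ φ x ∈ Metric.closedBall (φ q) r :=
    (eventually_mem_set.2 (extChartAt_source_mem_nhds q)).and
      (hc.eventually (Metric.closedBall_mem_nhds _ hr))
  have h3 : ∀ᶠ z : M × M in 𝓝 (q, q), (z.1 ∈ φ.source ∧ φ z.1 ∈ Metric.closedBall (φ q) r) ∧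
      (z.2 ∈ φ.source ∧ φ z.2 ∈ Metric.closedBall (φ q) r) :=
    (hO.prodMk_nhds hO)
  filter_upwards [h2, h3] with z hz1 hz2
  have h4 := h _ hz2.1.2 _ hz2.2.2
  rw [← hφ, φ.left_inv hz2.1.1, φ.left_inv hz2.2.1] at h4
  refine h4.trans_lt (lt_of_le_of_lt (ENNReal.ofReal_le_ofReal ?_) hz1)
  have := (hmC (φ z.2 - φ z.1)).2
  linarith

-- The points at finite distance from p form a clopen set, because near any point all mutual
-- distances are finite.
omit [T2Space M] in
theorem dist_ne_top [ConnectedSpace M] (p q : M) : F.dist p q ≠ ⊤ := by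
  have key : ∀ q : M, ∃ W ∈ 𝓝 q, ∀ x ∈ W, ∀ y ∈ W, F.dist x y ≠ ⊤ := by
    intro q
    have := F.eventually_dist_lt q (ε := 1) one_pos
    rw [nhds_prod_eq] at this
    obtain ⟨W, hW, h⟩ := mem_prod_same_iff.1 this
    refine ⟨W, hW, fun x hx y hy => ?_⟩
    have h1 := h (mk_mem_prod hx hy)
    rw [mem_ofPred_eq] at h1
    exact h1.ne_top
  have hclopen : IsClopen {q | F.dist p q ≠ ⊤} := by
    constructor
    · rw [← isOpen_compl_iff, isOpen_iff_mem_nhds]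
      intro q hq
      obtain ⟨W, hW, h⟩ := key q
      filter_upwards [hW] with x hx hx'
      refine hq (ne_top_of_le_ne_top ?_ (F.dist_triangle p x q))
      exact ENNReal.add_ne_top.2 ⟨hx', h x hx q (mem_of_mem_nhds hW)⟩
    · rw [isOpen_iff_mem_nhds]
      intro q hq
      obtain ⟨W, hW, h⟩ := key q
      filter_upwards [hW] with x hx
      refine ne_top_of_le_ne_top ?_ (F.dist_triangle p q x)
      exact ENNReal.add_ne_top.2 ⟨hq, h q (mem_of_mem_nhds hW) x hx⟩
  have h1 := hclopen.eq_univ ⟨p, by simp [F.dist_self]⟩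
  have h2 := mem_univ q
  rw [← h1, mem_ofPred_eq] at h2
  exact h2

end FinslerStructure

/-! ### The arrival time and its growth along curves -/

namespace FinslerStructure

open Finsler

variable {n : ℕ} {M : Type*} [TopologicalSpace M]
  [ChartedSpace (EuclideanSpace ℝ (Fin n)) M] [IsManifold (𝓡 n) ∞ M]

/-- A transnormal function with values in `[a, b]`, `a < b`, without critical values in `(a, b)`. -/
structure IsRegularTransnormal (F : FinslerStructure n M) (f : M → ℝ) (𝔟 : ℝ → ℝ) (a b : ℝ) :
    Prop where
  transnormal : F.IsTransnormal f 𝔟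
  range_eq : range f = Icc a b
  pos : ∀ s ∈ Ioo a b, 0 < 𝔟 s
  lt : a < b

namespace IsRegularTransnormal

variable {F : FinslerStructure n M} {f : M → ℝ} {𝔟 : ℝ → ℝ} {a b : ℝ}
  (h : F.IsRegularTransnormal f 𝔟 a b)

include h

theorem mem_Icc (x : M) : f x ∈ Icc a b := h.range_eq ▸ mem_range_self x

theorem exists_eq {c : ℝ} (hc : c ∈ Icc a b) : ∃ x, f x = c := by
  rwa [← h.range_eq] at hc

theorem speed_nonneg {c : ℝ} (hc : c ∈ Icc a b) : 0 ≤ 𝔟 c := by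
  obtain ⟨x, rfl⟩ := h.exists_eq hc
  obtain ⟨y, -, hy⟩ := h.transnormal.gradient x
  rw [← hy]
  positivity

theorem continuousOn_speed : ContinuousOn 𝔟 (Icc a b) := h.range_eq ▸ h.transnormal.continuousOn

theorem continuous : Continuous f := h.transnormal.smooth.continuous

theorem mdifferentiableAt (x : M) : MDifferentiableAt (𝓡 n) 𝓘(ℝ, ℝ) f x :=
  (h.transnormal.smooth x).mdifferentiableAt (by simp)

/-- This is the fundamental inequality for y = ∇f, whose norm is √𝔟(f). -/
theorem differential_le (x : M) (v : TangentSpace (𝓡 n) x) :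
    differential f x v ≤ √(𝔟 (f x)) * F.toFun ⟨x, v⟩ := by
  obtain ⟨y, hy, hy2⟩ := h.transnormal.gradient x
  have hx := mem_extChartAt_source (I := 𝓡 n) x
  have h1 : differential f x v = F.legendre x y v := hy v
  rw [h1, ← hy2, Real.sqrt_sq (F.nonneg _), F.legendre_eq hx, ← F.locNorm_vecCoord hx,
    ← F.locNorm_vecCoord hx]
  exact (F.isMinkowskiNorm_locNorm ((extChartAt (𝓡 n) x).map_source hx)).legendre_le _ _

/-- The regularized travel time from one level to another is at most the distance. -/
theorem regularized_le_dist {ε : ℝ} (hε : 0 < ε) (x y : M) :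
    ENNReal.ofReal (∫ s in f x..f y, 1 / √(IccExtend h.lt.le (𝔟 ∘ Subtype.val) s + ε)) ≤
      F.dist x y := by
  -- The constant extension of 𝔟 beyond [a, b] is continuous and nonnegative on ℝ; adding ε makes
  -- the primitive G of class C¹ also at critical levels.
  set β : ℝ → ℝ := IccExtend h.lt.le (𝔟 ∘ Subtype.val) with hβ
  have hβc : Continuous β := Continuous.Icc_extend' (continuousOn_iff_continuous_domRestrict.1 h.continuousOn_speed)
  have hβ0 : ∀ s, 0 ≤ β s := fun s => h.speed_nonneg (projIcc a b h.lt.le s).2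
  have hβe : ∀ s ∈ Icc a b, β s = 𝔟 s := fun s hs => by rw [hβ, IccExtend_of_mem _ _ hs]; rfl
  set g : ℝ → ℝ := fun s => 1 / √(β s + ε) with hg
  have hpos : ∀ s, 0 < √(β s + ε) := fun s => Real.sqrt_pos.2 (by linarith [hβ0 s])
  have hgc : Continuous g := by
    refine continuous_const.div (by fun_prop) fun s => (hpos s).ne'
  set G : ℝ → ℝ := fun z => ∫ s in a..z, g s with hG
  have hGd : ∀ z, HasDerivAt G (g z) z := fun z =>
    intervalIntegral.integral_hasDerivAt_right (hgc.intervalIntegrable _ _)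
      hgc.stronglyMeasurable.stronglyMeasurableAtFilter hgc.continuousAt
  have hG1 : ContDiff ℝ 1 G := by
    rw [contDiff_one_iff_deriv]
    refine ⟨fun z => (hGd z).differentiableAt, ?_⟩
    have : deriv G = g := funext fun z => (hGd z).deriv
    rwa [this]
  have hh : ContMDiff (𝓡 n) 𝓘(ℝ, ℝ) 1 (G ∘ f) :=
    hG1.contMDiff.comp (h.transnormal.smooth.of_le (by norm_cast))
  refine F.le_dist fun γ s t hγ hs ht => ?_
  have h1 := F.sub_le_length isOpen_univ hh.contMDiffOn subset_rfl (fun x _ v => ?_) hγ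
    (mapsTo_univ _ _)
  · rw [hs, ht] at h1
    have h2 : (G ∘ f) y - (G ∘ f) x = ∫ s in f x..f y, g s :=
      intervalIntegral.integral_interval_sub_left (hgc.intervalIntegrable _ _)
        (hgc.intervalIntegrable _ _)
    rwa [h2] at h1
  · have h3 : differential (G ∘ f) x v = differential f x v * g (f x) := by
      have h4 := ((hGd (f x)).hasFDerivAt.hasMFDerivAt.comp x
        (h.mdifferentiableAt x).hasMFDerivAt).mfderiv
      have h5 := congrArg (fun A => A v) h4
      exact h5
    rw [h3, hg]
    simp only [hβe _ (h.mem_Icc x)]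
    have h6 := h.differential_le x v
    have h7 := hpos (f x)
    rw [hβe _ (h.mem_Icc x)] at h7
    have h8 : √(𝔟 (f x)) ≤ √(𝔟 (f x) + ε) := Real.sqrt_le_sqrt (by linarith)
    rw [mul_one_div, div_le_iff₀ h7]
    refine h6.trans ?_
    rw [mul_comm]
    exact mul_le_mul_of_nonneg_left h8 (F.nonneg _)

/-- The regularized bounds pass to the limit ε → 0 by Fatou's lemma. Integrability of 1/√𝔟 is not
yet known, hence the lower integral. -/
theorem lintegral_le_dist (x y : M) :
    ∫⁻ s in Ioo (f x) (f y), ENNReal.ofReal (1 / √(𝔟 s)) ≤ F.dist x y := by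
  rcases le_or_gt (f y) (f x) with hle | hlt
  · rw [Ioo_eq_empty (not_lt.2 hle)]; simp
  set β : ℝ → ℝ := IccExtend h.lt.le (𝔟 ∘ Subtype.val) with hβ
  have hβc : Continuous β := Continuous.Icc_extend' (continuousOn_iff_continuous_domRestrict.1 h.continuousOn_speed)
  have hβ0 : ∀ s, 0 ≤ β s := fun s => h.speed_nonneg (projIcc a b h.lt.le s).2
  have hβe : ∀ s ∈ Icc a b, β s = 𝔟 s := fun s hs => by rw [hβ, IccExtend_of_mem _ _ hs]; rfl
  set g : ℕ → ℝ → ℝ := fun k s => 1 / √(β s + 1 / ((k : ℝ) + 1)) with hg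
  have hk : ∀ k : ℕ, 0 < 1 / ((k : ℝ) + 1) := fun k => by positivity
  have hgc : ∀ k, Continuous (g k) := fun k =>
    continuous_const.div (by fun_prop) fun s =>
      (Real.sqrt_pos.2 (by linarith [hβ0 s, hk k])).ne'
  have h1 : ∀ k, ∫⁻ s in Ioo (f x) (f y), ENNReal.ofReal (g k s) ≤ F.dist x y := fun k => by
    refine le_trans (le_of_eq ?_) (h.regularized_le_dist (hk k) x y)
    rw [intervalIntegral.integral_of_le hlt.le, ← setIntegral_congr_set Ioo_ae_eq_Ioc,
      ofReal_integral_eq_lintegral_ofReal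
      (((hgc k).integrableOn_Icc (a := f x) (b := f y)).mono_set Ioo_subset_Icc_self)]
    exact Eventually.of_forall fun s => by positivity
  have h2 : ∀ s ∈ Ioo (f x) (f y), ENNReal.ofReal (1 / √(𝔟 s)) ≤
      liminf (fun k => ENNReal.ofReal (g k s)) atTop := by
    intro s hs
    have hs' : s ∈ Ioo a b := ⟨(h.mem_Icc x).1.trans_lt hs.1, hs.2.trans_le (h.mem_Icc y).2⟩
    have h3 : Tendsto (fun k : ℕ => 𝔟 s + 1 / ((k : ℝ) + 1)) atTop (𝓝 (𝔟 s + 0)) :=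
      tendsto_const_nhds.add tendsto_one_div_add_atTop_nhds_zero_nat
    rw [add_zero] at h3
    have h4 : Tendsto (fun k : ℕ => g k s) atTop (𝓝 (1 / √(𝔟 s))) := by
      simp only [hg, hβe s (Ioo_subset_Icc_self hs')]
      exact tendsto_const_nhds.div ((Real.continuous_sqrt.tendsto _).comp h3)
        (Real.sqrt_pos.2 (h.pos s hs')).ne'
    exact ((ENNReal.continuous_ofReal.tendsto _).comp h4).liminf_eq.ge
  calc ∫⁻ s in Ioo (f x) (f y), ENNReal.ofReal (1 / √(𝔟 s))
      ≤ ∫⁻ s in Ioo (f x) (f y), liminf (fun k => ENNReal.ofReal (g k s)) atTop :=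
        setLIntegral_mono' measurableSet_Ioo h2
    _ ≤ liminf (fun k => ∫⁻ s in Ioo (f x) (f y), ENNReal.ofReal (g k s)) atTop :=
        lintegral_liminf_le fun k => (hgc k).measurable.ennreal_ofReal
    _ ≤ F.dist x y := by
        refine (liminf_le_liminf (Eventually.of_forall h1)).trans ?_
        simp

theorem continuousOn_slowness : ContinuousOn (fun s => 1 / √(𝔟 s)) (Ioo a b) :=
  continuousOn_const.div (h.continuousOn_speed.mono Ioo_subset_Icc_self).sqrt
    fun s hs => (Real.sqrt_pos.2 (h.pos s hs)).ne'

/-- The integral is bounded by the distance from a point of the first level to a point of the last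
one, and this is finite. -/
theorem integrableOn [ConnectedSpace M] : IntegrableOn (fun s => 1 / √(𝔟 s)) (Ioo a b) := by
  obtain ⟨x, hx⟩ := h.exists_eq (left_mem_Icc.2 h.lt.le)
  obtain ⟨y, hy⟩ := h.exists_eq (right_mem_Icc.2 h.lt.le)
  have h1 := h.lintegral_le_dist x y
  rw [hx, hy] at h1
  refine ⟨h.continuousOn_slowness.aestronglyMeasurable measurableSet_Ioo, ?_⟩
  rw [hasFiniteIntegral_iff_ofReal (Eventually.of_forall fun s => by positivity)]
  exact h1.trans_lt (lt_top_iff_ne_top.2 (F.dist_ne_top x y))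

theorem intervalIntegrable [ConnectedSpace M] {c d : ℝ} (hc : c ∈ Icc a b) (hd : d ∈ Icc a b) :
    IntervalIntegrable (fun s => 1 / √(𝔟 s)) volume c d := by
  have h1 : IntervalIntegrable (fun s => 1 / √(𝔟 s)) volume a b := by
    rw [intervalIntegrable_iff_integrableOn_Ioo_of_le h.lt.le]
    exact h.integrableOn
  refine h1.mono_set ?_
  rw [uIcc_of_le h.lt.le]
  exact uIcc_subset_Icc hc hd

theorem travelTime_add [ConnectedSpace M] {c d : ℝ} (hc : c ∈ Icc a b) (hd : d ∈ Icc a b) :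
    travelTime 𝔟 a c + travelTime 𝔟 c d = travelTime 𝔟 a d :=
  intervalIntegral.integral_add_adjacent_intervals
    (h.intervalIntegrable (left_mem_Icc.2 h.lt.le) hc) (h.intervalIntegrable hc hd)

omit h in
theorem travelTime_self (c : ℝ) : travelTime 𝔟 c c = 0 := intervalIntegral.integral_same

theorem travelTime_pos [ConnectedSpace M] {c d : ℝ} (hc : c ∈ Icc a b) (hd : d ∈ Icc a b)
    (hcd : c < d) : 0 < travelTime 𝔟 c d := by
  unfold travelTime
  refine intervalIntegral.intervalIntegral_pos_of_pos_on (h.intervalIntegrable hc hd)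
    (fun s hs => ?_) hcd
  have := Real.sqrt_pos.2 (h.pos s ⟨hc.1.trans_lt hs.1, hs.2.trans_le hd.2⟩)
  positivity

theorem strictMonoOn_travelTime [ConnectedSpace M] :
    StrictMonoOn (travelTime 𝔟 a) (Icc a b) := fun c hc d hd hcd => by
  rw [← h.travelTime_add hc hd]
  linarith [h.travelTime_pos hc hd hcd]

theorem continuousOn_travelTime [ConnectedSpace M] :
    ContinuousOn (travelTime 𝔟 a) (Icc a b) := by
  have := intervalIntegral.continuousOn_primitive_interval (μ := volume) (f := fun s => 1 / √(𝔟 s))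
    (a := a) (b := b) (by
      rw [uIcc_of_le h.lt.le, integrableOn_Icc_iff_integrableOn_Ioo]
      exact h.integrableOn)
  rwa [uIcc_of_le h.lt.le] at this

theorem hasDerivAt_travelTime [ConnectedSpace M] {c : ℝ} (hc : c ∈ Ioo a b) :
    HasDerivAt (travelTime 𝔟 a) (1 / √(𝔟 c)) c := by
  have hn := Ioo_mem_nhds hc.1 hc.2
  exact intervalIntegral.integral_hasDerivAt_right
    (h.intervalIntegrable (left_mem_Icc.2 h.lt.le) (Ioo_subset_Icc_self hc))
    (h.continuousOn_slowness.stronglyMeasurableAtFilter isOpen_Ioo c hc)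
    (h.continuousOn_slowness.continuousAt hn)

omit h in
/-- The arrival time of the wave. -/
def _root_.Finsler.arrival (𝔟 : ℝ → ℝ) (a : ℝ) (f : M → ℝ) (x : M) : ℝ := travelTime 𝔟 a (f x)

theorem continuous_arrival [ConnectedSpace M] : Continuous (arrival 𝔟 a f) :=
  h.continuousOn_travelTime.comp_continuous h.continuous h.mem_Icc

theorem arrival_nonneg [ConnectedSpace M] (x : M) : 0 ≤ arrival 𝔟 a f x := by
  have := h.strictMonoOn_travelTime.monotoneOn (left_mem_Icc.2 h.lt.le) (h.mem_Icc x) (h.mem_Icc x).1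
  rwa [travelTime_self] at this

theorem arrival_le [ConnectedSpace M] (x : M) : arrival 𝔟 a f x ≤ travelTime 𝔟 a b :=
  h.strictMonoOn_travelTime.monotoneOn (h.mem_Icc x) (right_mem_Icc.2 h.lt.le) (h.mem_Icc x).2

theorem arrival_eq_iff [ConnectedSpace M] {x : M} {c : ℝ} (hc : c ∈ Icc a b) :
    arrival 𝔟 a f x = travelTime 𝔟 a c ↔ f x = c :=
  h.strictMonoOn_travelTime.injOn.eq_iff (h.mem_Icc x) hc

theorem mem_Ioo_iff [ConnectedSpace M] {x : M} :
    f x ∈ Ioo a b ↔ arrival 𝔟 a f x ∈ Ioo 0 (travelTime 𝔟 a b) := by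
  have ha := left_mem_Icc.2 h.lt.le
  have hb := right_mem_Icc.2 h.lt.le
  unfold arrival
  rw [mem_Ioo, mem_Ioo, h.strictMonoOn_travelTime.lt_iff_lt (h.mem_Icc x) hb,
    ← h.strictMonoOn_travelTime.lt_iff_lt ha (h.mem_Icc x), travelTime_self]

/-- The arrival time increases at most by the distance. -/
theorem ofReal_arrival_sub_le_dist [ConnectedSpace M] (x y : M) :
    ENNReal.ofReal (arrival 𝔟 a f y - arrival 𝔟 a f x) ≤ F.dist x y := by
  have h1 : arrival 𝔟 a f y - arrival 𝔟 a f x = travelTime 𝔟 (f x) (f y) := by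
    rw [sub_eq_iff_eq_add', arrival, arrival, h.travelTime_add (h.mem_Icc x) (h.mem_Icc y)]
  rcases le_or_gt (f y) (f x) with hle | hlt
  · rw [ENNReal.ofReal_of_nonpos]
    · exact bot_le
    · rw [sub_nonpos]
      exact h.strictMonoOn_travelTime.monotoneOn (h.mem_Icc y) (h.mem_Icc x) hle
  · refine le_trans (le_of_eq ?_) (h.lintegral_le_dist x y)
    have h2 : IntegrableOn (fun s => 1 / √(𝔟 s)) (Ioo (f x) (f y)) :=
      h.integrableOn.mono_set (Ioo_subset_Ioo (h.mem_Icc x).1 (h.mem_Icc y).2)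
    rw [h1, travelTime, intervalIntegral.integral_of_le hlt.le,
      ← setIntegral_congr_set Ioo_ae_eq_Ioc, ofReal_integral_eq_lintegral_ofReal h2]
    exact Eventually.of_forall fun s => by positivity

theorem arrival_sub_le [ConnectedSpace M] {x y : M} {r : ℝ} (hr : 0 ≤ r)
    (hd : F.dist x y ≤ ENNReal.ofReal r) : arrival 𝔟 a f y - arrival 𝔟 a f x ≤ r := by
  have := (h.ofReal_arrival_sub_le_dist x y).trans hd
  rwa [ENNReal.ofReal_le_ofReal_iff hr] at this

end IsRegularTransnormal

end FinslerStructure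

/-! ### The Legendre transform and the eikonal equation -/

section LegendreTransform

variable {E : Type*} [NormedAddCommGroup E] [NormedSpace ℝ E]

/-- A family of Minkowski norms on `E` that depends smoothly on a parameter in the open set `V`. -/
structure IsMinkowskiFamily (N : E → E → ℝ) (V : Set E) : Prop where
  isOpen : IsOpen V
  norm : ∀ x ∈ V, IsMinkowskiNorm (N x)
  smooth : ContDiffOn ℝ ∞ (fun z : E × E => N z.1 z.2) (V ×ˢ {0}ᶜ)

/-- The energy `N² / 2`. -/
def finslerEnergy (N : E → E → ℝ) (z : E × E) : ℝ := (1 / 2) * N z.1 z.2 ^ 2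

/-- The partial derivative of the energy with respect to the vector. -/
def fibreDeriv (N : E → E → ℝ) (z : E × E) : E →L[ℝ] ℝ :=
  (fderiv ℝ (finslerEnergy N) z).comp (ContinuousLinearMap.inr ℝ E E)

/-- The partial derivative of the energy with respect to the base point. -/
def baseDeriv (N : E → E → ℝ) (z : E × E) : E →L[ℝ] ℝ :=
  (fderiv ℝ (finslerEnergy N) z).comp (ContinuousLinearMap.inl ℝ E E)

namespace IsMinkowskiFamily

variable {N : E → E → ℝ} {V : Set E} (h : IsMinkowskiFamily N V)

include h

theorem isOpen_phase : IsOpen (V ×ˢ ({0}ᶜ : Set E)) := h.isOpen.prod isOpen_compl_singleton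

theorem contDiffOn_energy : ContDiffOn ℝ ∞ (finslerEnergy N) (V ×ˢ {0}ᶜ) :=
  contDiffOn_const.mul (h.smooth.pow 2)

theorem contDiffOn_fderiv_energy :
    ContDiffOn ℝ ∞ (fderiv ℝ (finslerEnergy N)) (V ×ˢ {0}ᶜ) :=
  ((contDiffOn_infty_iff_fderiv_of_isOpen h.isOpen_phase).1 h.contDiffOn_energy).2

theorem contDiffOn_fibreDeriv : ContDiffOn ℝ ∞ (fibreDeriv N) (V ×ˢ {0}ᶜ) :=
  h.contDiffOn_fderiv_energy.clm_comp contDiffOn_const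

theorem contDiffOn_baseDeriv : ContDiffOn ℝ ∞ (baseDeriv N) (V ×ˢ {0}ᶜ) :=
  h.contDiffOn_fderiv_energy.clm_comp contDiffOn_const

theorem hasFDerivAt_energy {z : E × E} (hz : z ∈ V ×ˢ ({0}ᶜ : Set E)) :
    HasFDerivAt (finslerEnergy N) (fderiv ℝ (finslerEnergy N) z) z :=
  ((h.contDiffOn_energy.contDiffAt (h.isOpen_phase.mem_nhds hz)).differentiableAt
    (by simp)).hasFDerivAt

theorem fibreDeriv_apply {z : E × E} (hz : z ∈ V ×ˢ ({0}ᶜ : Set E)) (v : E) :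
    fibreDeriv N z v = minkowskiLegendre (N z.1) z.2 v := by
  have h1 : HasDerivAt (fun s : ℝ => (z.1, z.2 + s • v)) ((0, v) : E × E) 0 := by
    refine (hasDerivAt_const _ _).prodMk ?_
    simpa using ((hasDerivAt_id (0 : ℝ)).smul_const v).const_add z.2
  have h2 : HasFDerivAt (finslerEnergy N) (fderiv ℝ (finslerEnergy N) z) (z.1, z.2 + (0 : ℝ) • v) := by
    simpa using h.hasFDerivAt_energy hz
  have h3 := (h2.comp_hasDerivAt (0 : ℝ) h1).deriv
  unfold minkowskiLegendre
  rw [← deriv_const_mul_field]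
  exact h3.symm

theorem ne_zero_of_norm_eq_one {x y : E} (hx : x ∈ V) (hy : N x y = 1) : y ≠ 0 := by
  rintro rfl
  rw [(h.norm x hx).map_zero] at hy
  norm_num at hy

/-- The Legendre map `(x, y) ↦ (x, g_y(y, ·))` has injective derivative. -/
theorem fderiv_fibreDeriv_ne_zero {z : E × E} (hz : z ∈ V ×ˢ ({0}ᶜ : Set E)) {w : E} (hw : w ≠ 0) :
    fderiv ℝ (fibreDeriv N) z (0, w) ≠ 0 := by
  intro h0
  have hd : HasFDerivAt (fibreDeriv N) (fderiv ℝ (fibreDeriv N) z) z :=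
    ((h.contDiffOn_fibreDeriv.contDiffAt (h.isOpen_phase.mem_nhds hz)).differentiableAt
      (by simp)).hasFDerivAt
  set c : ℝ → E × E := fun s => (z.1, z.2 + s • w) with hc
  have hc0 : c 0 = z := by simp [hc]
  have h1 : HasDerivAt c (0, w) 0 := by
    refine (hasDerivAt_const _ _).prodMk ?_
    simpa using ((hasDerivAt_id (0 : ℝ)).smul_const w).const_add z.2
  have h2 : HasDerivAt (fun t => fibreDeriv N (c t)) (fderiv ℝ (fibreDeriv N) z (0, w)) 0 :=
    hd.comp_hasDerivAt_of_eq 0 h1 hc0.symm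
  rw [h0] at h2
  -- Pairing the vanishing derivative with w gives 0, but the same quantity is the fundamental
  -- tensor g_y(w, w) > 0.
  have h5 : HasDerivAt (fun t => fibreDeriv N (c t) w) 0 0 :=
    (ContinuousLinearMap.apply ℝ ℝ w).hasFDerivAt.comp_hasDerivAt 0 h2
  have h3 := (h.norm z.1 hz.1).posDef z.2 w hz.2 hw
  rw [← deriv_const_mul_field] at h3
  have h4 : (fun t : ℝ => 1 / 2 * deriv (fun s : ℝ => N z.1 (z.2 + t • w + s • w) ^ 2) 0) =ᶠ[𝓝 0]
      fun t => fibreDeriv N (c t) w := by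
    have := h1.continuousAt (h.isOpen_phase.mem_nhds (hc0.symm ▸ hz))
    filter_upwards [this] with t ht
    exact (h.fibreDeriv_apply ht w).symm
  rw [h4.deriv_eq, h5.deriv] at h3
  exact lt_irrefl _ h3

variable [FiniteDimensional ℝ E]

/-- The Legendre map has a smooth local inverse. -/
theorem exists_smooth_legendre_inverse {x₀ y₀ : E} (hx₀ : x₀ ∈ V) (hy₀ : y₀ ≠ 0) :
    ∃ (Y : E × (E →L[ℝ] ℝ) → E) (G : Set (E × (E →L[ℝ] ℝ))), IsOpen G ∧
      (x₀, fibreDeriv N (x₀, y₀)) ∈ G ∧ ContDiffOn ℝ ∞ Y G ∧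
      ∀ z ∈ G, z.1 ∈ V ∧ Y z ≠ 0 ∧
        ∀ y, (∀ v, minkowskiLegendre (N z.1) y v = z.2 v) → y = Y z := by
  have : CompleteSpace E := FiniteDimensional.complete ℝ E
  set D : Set (E × E) := V ×ˢ {0}ᶜ with hD
  have hDo : IsOpen D := h.isOpen_phase
  set Φ : E × E → E × (E →L[ℝ] ℝ) := fun z => (z.1, fibreDeriv N z) with hΦ
  have hΦs : ContDiffOn ℝ ∞ Φ D := contDiffOn_fst.prodMk h.contDiffOn_fibreDeriv
  -- The derivative is the identity in the base direction and injective in the fibre direction;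
  -- source and target have the same dimension, so it is invertible.
  have hequiv : ∀ z ∈ D, ∃ A : (E × E) ≃L[ℝ] (E × (E →L[ℝ] ℝ)),
      HasFDerivAt Φ (A : (E × E) →L[ℝ] (E × (E →L[ℝ] ℝ))) z := by
    intro z hz
    have hd : HasFDerivAt (fibreDeriv N) (fderiv ℝ (fibreDeriv N) z) z :=
      ((h.contDiffOn_fibreDeriv.contDiffAt (hDo.mem_nhds hz)).differentiableAt (by simp)).hasFDerivAt
    set B : (E × E) →L[ℝ] (E × (E →L[ℝ] ℝ)) :=
      (ContinuousLinearMap.fst ℝ E E).prod (fderiv ℝ (fibreDeriv N) z) with hB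
    have hBd : HasFDerivAt Φ B z := hasFDerivAt_fst.prodMk hd
    have hinj : Function.Injective (B : (E × E) →ₗ[ℝ] (E × (E →L[ℝ] ℝ))) := by
      rw [← LinearMap.ker_eq_bot, LinearMap.ker_eq_bot']
      rintro ⟨u, w⟩ huw
      have h1 : u = 0 := congrArg Prod.fst huw
      subst h1
      have h2 : fderiv ℝ (fibreDeriv N) z (0, w) = 0 := congrArg Prod.snd huw
      by_contra hne
      exact h.fderiv_fibreDeriv_ne_zero hz (w := w) (by rintro rfl; exact hne rfl) h2
    have hdim : Module.finrank ℝ (E × E) = Module.finrank ℝ (E × (E →L[ℝ] ℝ)) := by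
      rw [Module.finrank_prod, Module.finrank_prod,
        ← (LinearMap.toContinuousLinearMap : (E →ₗ[ℝ] ℝ) ≃ₗ[ℝ] E →L[ℝ] ℝ).finrank_eq]
      congr 1
      exact (Subspace.dual_finrank_eq (K := ℝ) (V := E)).symm
    refine ⟨(LinearMap.linearEquivOfInjective _ hinj hdim).toContinuousLinearEquiv, ?_⟩
    convert hBd using 1
    exact ContinuousLinearMap.ext fun _ => rfl
  have hz₀ : (x₀, y₀) ∈ D := ⟨hx₀, hy₀⟩
  obtain ⟨A, hA⟩ := hequiv _ hz₀
  have hΦ₀ : ContDiffAt ℝ ∞ Φ (x₀, y₀) := hΦs.contDiffAt (hDo.mem_nhds hz₀)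
  set e := hΦ₀.toOpenPartialHomeomorph Φ hA (by simp) with he
  have hsrc : (x₀, y₀) ∈ e.source := hΦ₀.mem_toOpenPartialHomeomorph_source hA (by simp)
  have heΦ : ∀ z, e z = Φ z := fun z => rfl
  refine ⟨fun z => (e.symm z).2, e.target ∩ e.symm ⁻¹' D, e.isOpen_inter_preimage_symm hDo,
    ⟨e.map_source hsrc, ?_⟩, ?_, ?_⟩
  · change e.symm (e (x₀, y₀)) ∈ D
    rwa [e.left_inv hsrc]
  · intro z hz
    obtain ⟨A, hA⟩ := hequiv _ hz.2
    exact (contDiffAt_snd.comp z (e.contDiffAt_symm hz.1 hA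
      (hΦs.contDiffAt (hDo.mem_nhds hz.2)))).contDiffWithinAt
  · intro z hz
    have h1 : Φ (e.symm z) = z := e.right_inv hz.1
    have h2 : (e.symm z).1 = z.1 := congrArg Prod.fst h1
    have h3 : fibreDeriv N (e.symm z) = z.2 := congrArg Prod.snd h1
    have h4 : (e.symm z).1 ∈ V := hz.2.1
    refine ⟨h2 ▸ h4, hz.2.2, fun y hy => ?_⟩
    -- Injectivity on the whole fibre makes the local inverse valid for every y, not only for those
    -- near y₀.
    refine (h.norm z.1 (h2 ▸ h4)).legendre_injective fun v => ?_
    rw [hy, ← h3, h.fibreDeriv_apply hz.2, h2]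

end IsMinkowskiFamily

/-- A function with Finsler gradient of norm one on `V`. -/
structure IsFinslerEikonal (N : E → E → ℝ) (V : Set E) (ρ : E → ℝ) (X : E → E) : Prop extends
    IsMinkowskiFamily N V where
  smooth_fun : ContDiffOn ℝ ∞ ρ V
  norm_gradient : ∀ x ∈ V, N x (X x) = 1
  legendre_gradient : ∀ x ∈ V, ∀ v, minkowskiLegendre (N x) (X x) v = fderiv ℝ ρ x v

/-- Vector fields with smooth Legendre transform are smooth. -/
theorem IsMinkowskiFamily.contDiffOn_of_legendre [FiniteDimensional ℝ E] {N : E → E → ℝ} {V : Set E}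
    (h : IsMinkowskiFamily N V) {α : E → E →L[ℝ] ℝ} (hα : ContDiffOn ℝ ∞ α V) {X : E → E}
    (hX0 : ∀ x ∈ V, X x ≠ 0) (hX : ∀ x ∈ V, ∀ v, minkowskiLegendre (N x) (X x) v = α x v) :
    ContDiffOn ℝ ∞ X V := by
  intro x₀ hx₀
  obtain ⟨Y, G, hG, h0, hY, hYG⟩ := h.exists_smooth_legendre_inverse hx₀ (hX0 x₀ hx₀)
  have e0 : fibreDeriv N (x₀, X x₀) = α x₀ := by
    ext v
    rw [h.fibreDeriv_apply (show (x₀, X x₀) ∈ V ×ˢ ({0}ᶜ : Set E) from ⟨hx₀, hX0 x₀ hx₀⟩)]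
    exact hX x₀ hx₀ v
  rw [e0] at h0
  have hpair : ContDiffAt ℝ ∞ (fun x => (x, α x)) x₀ :=
    contDiffAt_id.prodMk (hα.contDiffAt (h.isOpen.mem_nhds hx₀))
  have h1 : ContDiffAt ℝ ∞ (fun x => Y (x, α x)) x₀ :=
    (hY.contDiffAt (hG.mem_nhds h0)).comp x₀ hpair
  refine (h1.congr_of_eventuallyEq ?_).contDiffWithinAt
  filter_upwards [hpair.continuousAt (hG.mem_nhds h0), h.isOpen.mem_nhds hx₀] with x hx hxV
  exact (hYG _ hx).2.2 _ (hX x hxV)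

namespace IsFinslerEikonal

variable [FiniteDimensional ℝ E] {N : E → E → ℝ} {V : Set E} {ρ : E → ℝ} {X : E → E}
  (h : IsFinslerEikonal N V ρ X)

include h

omit [FiniteDimensional ℝ E] in
theorem gradient_ne_zero {x : E} (hx : x ∈ V) : X x ≠ 0 :=
  h.ne_zero_of_norm_eq_one hx (h.norm_gradient x hx)

omit [FiniteDimensional ℝ E] in
theorem contDiffOn_fderiv : ContDiffOn ℝ ∞ (fderiv ℝ ρ) V :=
  ((contDiffOn_infty_iff_fderiv_of_isOpen h.isOpen).1 h.smooth_fun).2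

theorem contDiffOn_gradient : ContDiffOn ℝ ∞ X V :=
  h.contDiffOn_of_legendre h.contDiffOn_fderiv (fun _ => h.gradient_ne_zero) h.legendre_gradient

omit [FiniteDimensional ℝ E] in
theorem fderiv_gradient {x : E} (hx : x ∈ V) : fderiv ℝ ρ x (X x) = 1 := by
  rw [← h.legendre_gradient x hx, (h.norm x hx).legendre_self, h.norm_gradient x hx, one_pow]

/-- The Euler-Lagrange equation for the integral curves of the gradient. -/
theorem fderiv_fderiv_gradient {x : E} (hx : x ∈ V) :
    fderiv ℝ (fderiv ℝ ρ) x (X x) = baseDeriv N (x, X x) := by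
  ext v
  have hn := h.isOpen.mem_nhds hx
  have hρ2 : ContDiffAt ℝ ∞ (fderiv ℝ ρ) x := h.contDiffOn_fderiv.contDiffAt hn
  have hsymm : IsSymmSndFDerivAt ℝ ρ x :=
    (h.smooth_fun.contDiffAt hn).isSymmSndFDerivAt (by
      simp only [minSmoothness_of_isRCLikeNormedField]
      exact WithTop.coe_le_coe.2 le_top)
  rw [hsymm.eq]
  have hXd : HasFDerivAt X (fderiv ℝ X x) x :=
    ((h.contDiffOn_gradient.contDiffAt hn).differentiableAt (by simp)).hasFDerivAt
  -- Both dρ(X) = 1 and the energy of X, which is 1/2, are constant. On differentiating them in the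
  -- direction v, the terms with the derivative of X agree, since the fibre derivative of the energy
  -- at X is dρ; they cancel.
  have h1 : HasFDerivAt (fun x => fderiv ℝ ρ x (X x)) _ x :=
    (hρ2.differentiableAt (by simp)).hasFDerivAt.clm_apply hXd
  have h1' : (fun x => fderiv ℝ ρ x (X x)) =ᶠ[𝓝 x] fun _ => 1 := by
    filter_upwards [hn] with y hy using h.fderiv_gradient hy
  have h2 := h1.unique (h1'.symm.hasFDerivAt_iff.1 (hasFDerivAt_const (1 : ℝ) x))
  have h3 := congrArg (fun A => A v) h2
  have hz : (x, X x) ∈ V ×ˢ ({0}ᶜ : Set E) := ⟨hx, h.gradient_ne_zero hx⟩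
  have h4 : HasFDerivAt (fun x => finslerEnergy N (x, X x)) _ x :=
    HasFDerivAt.comp (g := finslerEnergy N) (f := fun x => (x, X x)) x (h.hasFDerivAt_energy hz)
      ((hasFDerivAt_id x).prodMk hXd)
  have h4' : (fun x => finslerEnergy N (x, X x)) =ᶠ[𝓝 x] fun _ => 1 / 2 := by
    filter_upwards [hn] with y hy
    simp [finslerEnergy, h.norm_gradient y hy]
  have h5 := h4.unique (h4'.symm.hasFDerivAt_iff.1 (hasFDerivAt_const (1 / 2 : ℝ) x))
  have h6 := congrArg (fun A => A v) h5
  have h7 : fderiv ℝ (finslerEnergy N) (x, X x) (v, fderiv ℝ X x v) =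
      baseDeriv N (x, X x) v + fibreDeriv N (x, X x) (fderiv ℝ X x v) := by
    unfold baseDeriv fibreDeriv
    simp only [ContinuousLinearMap.comp_apply, ContinuousLinearMap.inl_apply,
      ContinuousLinearMap.inr_apply]
    rw [← map_add]
    simp
  have h8 : fderiv ℝ (finslerEnergy N) (x, X x) (v, fderiv ℝ X x v) = 0 := h6
  rw [h7, h.fibreDeriv_apply hz, h.legendre_gradient x hx] at h8
  simp at h3
  linarith

end IsFinslerEikonal

end LegendreTransform

theorem IsMinkowskiNorm.legendre_smul_left {E : Type*} [NormedAddCommGroup E] [NormedSpace ℝ E]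
    {N : E → ℝ} (hN : IsMinkowskiNorm N) {r : ℝ} (hr : 0 < r) (y v : E) :
    minkowskiLegendre N (r • y) v = r * minkowskiLegendre N y v := by
  unfold minkowskiLegendre
  have h1 : (fun s : ℝ => N (r • y + s • v) ^ 2) =
      fun s => r ^ 2 * (fun s : ℝ => N (y + s • v) ^ 2) (r⁻¹ * s) := by
    ext s
    have : r • y + s • v = r • (y + (r⁻¹ * s) • v) := by
      rw [smul_add, smul_smul]
      congr 2
      field_simp
    rw [this, hN.homogeneous _ _ hr]
    ring
  have h2 := deriv_comp_mul_left r⁻¹ (fun s : ℝ => N (y + s • v) ^ 2) 0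
  rw [h1, deriv_const_mul_field, h2, mul_zero, smul_eq_mul]
  field_simp

theorem IsMinkowskiFamily.mono {E : Type*} [NormedAddCommGroup E] [NormedSpace ℝ E]
    {N : E → E → ℝ} {V V' : Set E} (h : IsMinkowskiFamily N V) (hV : V' ⊆ V) (ho : IsOpen V') :
    IsMinkowskiFamily N V' :=
  ⟨ho, fun x hx => h.norm x (hV hx), h.smooth.mono (prod_mono hV subset_rfl)⟩

/-! ### Smoothness of the arrival time at regular points -/

namespace FinslerStructure

open Finsler

variable {n : ℕ} {M : Type*} [TopologicalSpace M]
  [ChartedSpace (EuclideanSpace ℝ (Fin n)) M] [IsManifold (𝓡 n) ∞ M]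

theorem isMinkowskiFamily_locNorm (F : FinslerStructure n M) (p : M) :
    IsMinkowskiFamily (F.locNorm p) (extChartAt (𝓡 n) p).target :=
  ⟨isOpen_extChartAt_target p, fun _ hx => F.isMinkowskiNorm_locNorm hx, F.contDiffOn_locNorm p⟩

/-- The part of the chart domain at `p` with values of `f` in `(a, b)`, in coordinates. -/
def regularRegion (n : ℕ) {M : Type*} [TopologicalSpace M]
    [ChartedSpace (EuclideanSpace ℝ (Fin n)) M] (f : M → ℝ) (a b : ℝ) (p : M) :
    Set (EuclideanSpace ℝ (Fin n)) :=
  (extChartAt (𝓡 n) p).target ∩ (fun x => f ((extChartAt (𝓡 n) p).symm x)) ⁻¹' Ioo a b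

namespace IsRegularTransnormal

variable {F : FinslerStructure n M} {f : M → ℝ} {𝔟 : ℝ → ℝ} {a b : ℝ}
  (h : F.IsRegularTransnormal f 𝔟 a b)

include h

theorem contDiffOn_chart (p : M) :
    ContDiffOn ℝ ∞ (fun x => f ((extChartAt (𝓡 n) p).symm x)) (extChartAt (𝓡 n) p).target := by
  rw [← contMDiffOn_iff_contDiffOn]
  exact h.transnormal.smooth.comp_contMDiffOn (contMDiffOn_extChartAt_symm p)

theorem isOpen_regularRegion (p : M) : IsOpen (regularRegion n f a b p) :=
  (h.contDiffOn_chart p).continuousOn.isOpen_inter_preimage (isOpen_extChartAt_target p) isOpen_Ioo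

theorem exists_gradient_chart (p : M) : ∃ Y : EuclideanSpace ℝ (Fin n) → EuclideanSpace ℝ (Fin n),
    ∀ x ∈ (extChartAt (𝓡 n) p).target,
      (∀ v, minkowskiLegendre (F.locNorm p x) (Y x) v =
        fderiv ℝ (fun x => f ((extChartAt (𝓡 n) p).symm x)) x v) ∧
      F.locNorm p x (Y x) ^ 2 = 𝔟 (f ((extChartAt (𝓡 n) p).symm x)) := by
  set φ := extChartAt (𝓡 n) p with hφ
  choose y hy hy2 using h.transnormal.gradient
  refine ⟨fun x => vecCoord p ⟨φ.symm x, y (φ.symm x)⟩, fun x hx => ?_⟩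
  have hq : φ.symm x ∈ φ.source := φ.map_target hx
  have hx' : φ (φ.symm x) = x := φ.right_inv hx
  constructor
  · intro v
    have h1 := hy (φ.symm x) ((coordEquiv p _ hq).symm v)
    rw [F.legendre_eq hq] at h1
    have h2 := mfderiv_eq_fderiv_chart hq (h.mdifferentiableAt (φ.symm x))
      ((coordEquiv p _ hq).symm v)
    rw [vecCoord_eq p _ hq (u := (coordEquiv p _ hq).symm v),
      ContinuousLinearEquiv.apply_symm_apply] at h1 h2
    rw [← hφ, hx'] at h1 h2
    exact h1.symm.trans h2
  · rw [← hy2 (φ.symm x), ← F.locNorm_vecCoord hq, ← hφ, hx']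

/-- 𝔟 is only assumed continuous. Along a coordinate line in the direction of ∇f, however, f has
derivative 𝔟 > 0 at the base point and so a smooth local inverse; composing the smooth function
F²(∇f) with it recovers 𝔟. -/
theorem contDiffAt_speed {c : ℝ} (hc : c ∈ Ioo a b) : ContDiffAt ℝ ∞ 𝔟 c := by
  obtain ⟨p, rfl⟩ := h.exists_eq (Ioo_subset_Icc_self hc)
  obtain ⟨Y, hY⟩ := h.exists_gradient_chart p
  set φ := extChartAt (𝓡 n) p with hφ
  set V := regularRegion n f a b p with hV
  set fc : EuclideanSpace ℝ (Fin n) → ℝ := fun x => f (φ.symm x) with hfc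
  have hVo : IsOpen V := h.isOpen_regularRegion p
  have hfam := (F.isMinkowskiFamily_locNorm p).mono (V' := V) inter_subset_left hVo
  have hfs : ContDiffOn ℝ ∞ fc V := (h.contDiffOn_chart p).mono inter_subset_left
  have hY0 : ∀ x ∈ V, Y x ≠ 0 := by
    intro x hx h0
    have h1 := (hY x hx.1).2
    rw [h0, (hfam.norm x hx).map_zero] at h1
    have h2 := h.pos _ hx.2
    simp only [← hφ] at h1 h2
    rw [← h1] at h2
    norm_num at h2
  have hYs : ContDiffOn ℝ ∞ Y V :=
    hfam.contDiffOn_of_legendre ((contDiffOn_infty_iff_fderiv_of_isOpen hVo).1 hfs).2 hY0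
      fun x hx => (hY x hx.1).1
  have hp : φ.symm (φ p) = p := φ.left_inv (mem_extChartAt_source p)
  set x₀ := φ p with hx₀
  have hx₀V : x₀ ∈ V := ⟨φ.map_source (mem_extChartAt_source p), by
    change f (φ.symm x₀) ∈ Ioo a b
    rwa [hp]⟩
  set η : ℝ → EuclideanSpace ℝ (Fin n) := fun s => x₀ + s • Y x₀ with hη
  have hη0 : η 0 = x₀ := by simp [hη]
  have hηs : ContDiff ℝ ∞ η := by fun_prop
  have hηd : HasDerivAt η (Y x₀) 0 := by
    have h1 := ((hasDerivAt_id (0 : ℝ)).smul_const (Y x₀)).const_add x₀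
    rw [one_smul] at h1
    exact h1
  have hu : ContDiffAt ℝ ∞ (fc ∘ η) 0 :=
    ContDiffAt.comp 0 (by rw [hη0]; exact hfs.contDiffAt (hVo.mem_nhds hx₀V)) hηs.contDiffAt
  have hfd : HasFDerivAt fc (fderiv ℝ fc x₀) x₀ :=
    ((hfs.contDiffAt (hVo.mem_nhds hx₀V)).differentiableAt (by simp)).hasFDerivAt
  have hud : HasDerivAt (fc ∘ η) (𝔟 (f p)) 0 := by
    have h1 := hfd.comp_hasDerivAt_of_eq 0 hηd hη0.symm
    have h2 := (hY x₀ hx₀V.1).1 (Y x₀)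
    rw [(hfam.norm x₀ hx₀V).legendre_self, (hY x₀ hx₀V.1).2, hp] at h2
    rwa [h2]
  have hne : 𝔟 (f p) ≠ 0 := (h.pos _ hc).ne'
  have hequiv := hud.hasFDerivAt_equiv hne
  set e := hu.toOpenPartialHomeomorph (fc ∘ η) hequiv (by simp) with he
  have h0s : (0 : ℝ) ∈ e.source := hu.mem_toOpenPartialHomeomorph_source hequiv (by simp)
  have he0 : e 0 = f p := by
    change f (φ.symm (η 0)) = f p
    rw [hη0, hp]
  have hes : e.symm (f p) = 0 := by rw [← he0, e.left_inv h0s]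
  have htgt : f p ∈ e.target := he0 ▸ e.map_source h0s
  have hψ : ContDiffAt ℝ ∞ e.symm (f p) :=
    e.contDiffAt_symm htgt (by rw [hes]; exact hequiv) (by rw [hes]; exact hu)
  have hx₀Y : (x₀, Y x₀) ∈ V ×ˢ ({0}ᶜ : Set (EuclideanSpace ℝ (Fin n))) := ⟨hx₀V, hY0 x₀ hx₀V⟩
  have hNY : ContDiffAt ℝ ∞ (fun x => F.locNorm p x (Y x) ^ 2) x₀ := by
    have h3 : ContDiffAt ℝ ∞ (fun x => (x, Y x)) x₀ :=
      contDiffAt_id.prodMk (hYs.contDiffAt (hVo.mem_nhds hx₀V))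
    exact ((hfam.smooth.contDiffAt (hfam.isOpen_phase.mem_nhds hx₀Y)).comp x₀ h3).pow 2
  have hcomp : ContDiffAt ℝ ∞ (fun s => η (e.symm s)) (f p) :=
    hηs.contDiffAt.comp (f p) hψ
  have hηf : η (e.symm (f p)) = x₀ := by rw [hes, hη0]
  have h4 : ContDiffAt ℝ ∞ (fun s => F.locNorm p (η (e.symm s)) (Y (η (e.symm s))) ^ 2) (f p) :=
    ContDiffAt.comp (f p) (g := fun x => F.locNorm p x (Y x) ^ 2) (by rwa [hηf]) hcomp
  refine h4.congr_of_eventuallyEq ?_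
  have h5 : ∀ᶠ s in 𝓝 (f p), η (e.symm s) ∈ V :=
    hcomp.continuousAt.eventually_mem (by rw [hηf]; exact hVo.mem_nhds hx₀V)
  filter_upwards [h5, e.open_target.mem_nhds htgt] with s hs hst
  rw [(hY _ hs.1).2]
  congr 1
  exact (e.right_inv hst).symm

theorem contDiffOn_travelTime [ConnectedSpace M] : ContDiffOn ℝ ∞ (travelTime 𝔟 a) (Ioo a b) := by
  rw [contDiffOn_infty_iff_deriv_of_isOpen isOpen_Ioo]
  refine ⟨fun c hc => (h.hasDerivAt_travelTime hc).differentiableAt.differentiableWithinAt, ?_⟩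
  have h1 : ContDiffOn ℝ ∞ (fun s => 1 / √(𝔟 s)) (Ioo a b) := by
    refine contDiffOn_const.div (ContDiffOn.sqrt (fun c hc => (h.contDiffAt_speed hc).contDiffWithinAt)
      fun c hc => (h.pos c hc).ne') fun c hc => (Real.sqrt_pos.2 (h.pos c hc)).ne'
  exact h1.congr fun c hc => (h.hasDerivAt_travelTime hc).deriv

/-- In every chart, the arrival time solves the eikonal equation on the regular region. -/
theorem exists_isFinslerEikonal [ConnectedSpace M] (p : M) :
    ∃ X, IsFinslerEikonal (F.locNorm p) (regularRegion n f a b p)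
      (fun x => arrival 𝔟 a f ((extChartAt (𝓡 n) p).symm x)) X := by
  obtain ⟨Y, hY⟩ := h.exists_gradient_chart p
  set φ := extChartAt (𝓡 n) p with hφ
  set V := regularRegion n f a b p with hV
  set fc : EuclideanSpace ℝ (Fin n) → ℝ := fun x => f (φ.symm x) with hfc
  have hVo : IsOpen V := h.isOpen_regularRegion p
  have hfam := (F.isMinkowskiFamily_locNorm p).mono (V' := V) inter_subset_left hVo
  have hfs : ContDiffOn ℝ ∞ fc V := (h.contDiffOn_chart p).mono inter_subset_left
  -- dρ = df/√𝔟(f), and the Legendre transform is positively homogeneous, so ∇ρ is ∇f divided by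
  -- √𝔟(f).
  refine ⟨fun x => (√(𝔟 (fc x)))⁻¹ • Y x, hfam, ?_, fun x hx => ?_, fun x hx v => ?_⟩
  · exact h.contDiffOn_travelTime.comp hfs fun x hx => hx.2
  · have hpos : 0 < √(𝔟 (fc x)) := Real.sqrt_pos.2 (h.pos _ hx.2)
    rw [(hfam.norm x hx).homogeneous _ _ (inv_pos.2 hpos)]
    have h1 := (hY x hx.1).2
    have h2 : √(𝔟 (fc x)) = F.locNorm p x (Y x) := by
      rw [show 𝔟 (fc x) = F.locNorm p x (Y x) ^ 2 from h1.symm,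
        Real.sqrt_sq ((hfam.norm x hx).nonneg _)]
    rw [← h2, inv_mul_cancel₀ hpos.ne']
  · have hpos : 0 < √(𝔟 (fc x)) := Real.sqrt_pos.2 (h.pos _ hx.2)
    rw [(hfam.norm x hx).legendre_smul_left (inv_pos.2 hpos), (hY x hx.1).1]
    have hfd : HasFDerivAt fc (fderiv ℝ fc x) x :=
      ((hfs.contDiffAt (hVo.mem_nhds hx)).differentiableAt (by simp)).hasFDerivAt
    have h3 := ((h.hasDerivAt_travelTime hx.2).comp_hasFDerivAt x hfd).fderiv
    have h4 := congrArg (fun A => A v) h3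
    refine Eq.trans ?_ h4.symm
    change _ = (1 / √(𝔟 (fc x))) * _
    rw [one_div]
    rfl

end IsRegularTransnormal

end FinslerStructure

/-! ### Short integral curves of the gradient of the arrival time -/

namespace FinslerStructure

open Finsler

variable {n : ℕ} {M : Type*} [TopologicalSpace M]
  [ChartedSpace (EuclideanSpace ℝ (Fin n)) M] [IsManifold (𝓡 n) ∞ M]

theorem toFun_velocity (F : FinslerStructure n M) {γ : ℝ → M} {t : ℝ} {p : M}
    (hp : γ t ∈ (extChartAt (𝓡 n) p).source) (hγ : MDifferentiableAt 𝓘(ℝ, ℝ) (𝓡 n) γ t) :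
    F.toFun (velocity γ t) = F.locNorm p (extChartAt (𝓡 n) p (γ t))
      (deriv (fun s => extChartAt (𝓡 n) p (γ s)) t) := by
  rw [← vecCoord_velocity hp hγ]
  exact (F.locNorm_vecCoord hp _).symm

namespace IsRegularTransnormal

variable {F : FinslerStructure n M} {f : M → ℝ} {𝔟 : ℝ → ℝ} {a b : ℝ}
  (h : F.IsRegularTransnormal f 𝔟 a b)

include h

/-- Through each regular point there is a short curve along which the arrival time increases at
unit rate. -/
theorem exists_local_curve [ConnectedSpace M] {q : M} (hq : f q ∈ Ioo a b) :
    ∃ ε > 0, ∃ c : ℝ → M, c 0 = q ∧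
      (∀ t ∈ Ioo (-ε) ε, arrival 𝔟 a f (c t) = arrival 𝔟 a f q + t) ∧
      ∀ s ∈ Ioo (-ε) ε, ∀ t ∈ Ioo (-ε) ε, s ≤ t → F.dist (c s) (c t) ≤ ENNReal.ofReal (t - s) := by
  obtain ⟨X, hX⟩ := h.exists_isFinslerEikonal q
  set φ := extChartAt (𝓡 n) q with hφ
  set V := regularRegion n f a b q with hV
  have hφq : φ.symm (φ q) = q := φ.left_inv (mem_extChartAt_source q)
  have hx₀V : φ q ∈ V := ⟨φ.map_source (mem_extChartAt_source q), by
    change f (φ.symm (φ q)) ∈ Ioo a b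
    rwa [hφq]⟩
  have hXs : ContDiffAt ℝ 1 X (φ q) :=
    (hX.contDiffOn_gradient.contDiffAt (hX.isOpen.mem_nhds hx₀V)).of_le (by norm_cast)
  obtain ⟨α, hα0, ε₁, hε₁, hα⟩ :=
    hXs.exists_forall_mem_closedBall_exists_eq_forall_mem_Ioo_hasDerivAt₀ 0
  simp only [zero_sub, zero_add] at hα
  have hαc : ContinuousAt α 0 := (hα 0 ⟨by linarith, hε₁⟩).continuousAt
  obtain ⟨ε₂, hε₂, hαV⟩ := Metric.mem_nhds_iff.1
    (hαc.preimage_mem_nhds (by rw [hα0]; exact hX.isOpen.mem_nhds hx₀V))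
  have hsub : ∀ t ∈ Ioo (-(min ε₁ ε₂)) (min ε₁ ε₂), HasDerivAt α (X (α t)) t ∧ α t ∈ V := by
    intro t ht
    have ht' : |t| < min ε₁ ε₂ := abs_lt.2 ht
    refine ⟨hα t (abs_lt.1 (ht'.trans_le (min_le_left _ _))), hαV ?_⟩
    rw [mem_ball_zero_iff, Real.norm_eq_abs]
    exact ht'.trans_le (min_le_right _ _)
  refine ⟨min ε₁ ε₂, lt_min hε₁ hε₂, fun t => φ.symm (α t), by simp only [hα0, hφq], ?_, ?_⟩
  -- Since dρ(∇ρ) = 1, the difference of ρ and the parameter is constant along the integral curve.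
  · set g : ℝ → ℝ := fun t => arrival 𝔟 a f (φ.symm (α t)) - t with hg
    have hgd : ∀ t ∈ Ioo (-(min ε₁ ε₂)) (min ε₁ ε₂), HasDerivAt g 0 t := by
      intro t ht
      obtain ⟨h1, h2⟩ := hsub t ht
      have h3 := ((hX.smooth_fun.contDiffAt (hX.isOpen.mem_nhds h2)).differentiableAt
        (by simp)).hasFDerivAt.comp_hasDerivAt t h1
      rw [hX.fderiv_gradient h2] at h3
      have h4 := h3.sub (hasDerivAt_id t)
      rw [sub_self] at h4
      exact h4
    intro t ht
    have h0 : (0 : ℝ) ∈ Ioo (-(min ε₁ ε₂)) (min ε₁ ε₂) :=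
      ⟨neg_neg_iff_pos.2 (lt_min hε₁ hε₂), lt_min hε₁ hε₂⟩
    have h5 := isOpen_Ioo.is_const_of_deriv_eq_zero (𝕜 := ℝ) isPreconnected_Ioo
      (fun s hs => (hgd s hs).differentiableAt.differentiableWithinAt)
      (fun s hs => (hgd s hs).deriv) ht h0
    simp only [hg, hα0, hφq] at h5
    linarith
  · intro s hs t ht hst
    have hmem : ∀ u ∈ Icc s t, u ∈ Ioo (-(min ε₁ ε₂)) (min ε₁ ε₂) := fun u hu =>
      ⟨hs.1.trans_le hu.1, hu.2.trans_lt ht.2⟩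
    have hαs : ContDiffOn ℝ ∞ α (Icc s t) := by
      refine ODE.contDiffOn_enat_Icc_of_hasDerivWithinAt (n := ⊤) (f := fun _ => X) (u := V) ?_
        (fun u hu => (hsub u (hmem u hu)).1.hasDerivWithinAt) fun u hu => (hsub u (hmem u hu)).2
      exact hX.contDiffOn_gradient.comp contDiffOn_snd fun z hz => hz.2
    have hcs : ContMDiffOn 𝓘(ℝ, ℝ) (𝓡 n) ∞ (fun u => φ.symm (α u)) (Icc s t) :=
      (contMDiffOn_extChartAt_symm q).comp hαs.contMDiffOn fun u hu => (hsub u (hmem u hu)).2.1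
    refine (F.dist_le_length (.smooth hst hcs)).trans ?_
    rw [length_eq_Ioo]
    refine (setLIntegral_mono' (g := fun _ => 1) measurableSet_Ioo fun u hu => ?_).trans (by simp)
    have hu' := hmem u (Ioo_subset_Icc_self hu)
    obtain ⟨h1, h2⟩ := hsub u hu'
    rw [F.toFun_velocity (p := q) (φ.map_target h2.1)
      ((hcs.contMDiffAt (Icc_mem_nhds hu.1 hu.2)).mdifferentiableAt (by simp))]
    have h3 : (fun s => extChartAt (𝓡 n) q (φ.symm (α s))) =ᶠ[𝓝 u] α := by
      filter_upwards [isOpen_Ioo.mem_nhds hu'] with v hv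
      exact φ.right_inv (hsub v hv).2.1
    rw [h3.deriv_eq, h1.deriv, ← hφ, φ.right_inv h2.1, hX.norm_gradient _ h2, ENNReal.ofReal_one]

end IsRegularTransnormal

end FinslerStructure

/-! ### Calibrated sets and their maximal extension -/

section Calibrated

/-- A set on which the distance between any two points is at most the increase of `ρ`, and on which
`ρ` takes all values between any two of its values. -/
structure IsCalibrated {X : Type*} (D : X → X → ℝ≥0∞) (ρ : X → ℝ) (C : Set X) : Prop where
  dist_le : ∀ x ∈ C, ∀ y ∈ C, ρ x ≤ ρ y → D x y ≤ ENNReal.ofReal (ρ y - ρ x)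
  exists_eq : ∀ x ∈ C, ∀ y ∈ C, ∀ r, ρ x ≤ r → r ≤ ρ y → ∃ z ∈ C, ρ z = r

variable {X : Type*} {D : X → X → ℝ≥0∞} {ρ : X → ℝ} {C : Set X}

/-- Reversing the distance and the sign of ρ exchanges the roles of forward and backward
completeness, so one extension argument serves both ends. -/
theorem IsCalibrated.reverse (h : IsCalibrated D ρ C) :
    IsCalibrated (fun x y => D y x) (fun x => -ρ x) C := by
  constructor
  · intro x hx y hy hxy
    have := h.dist_le y hy x hx (by linarith)
    rwa [show -ρ y - -ρ x = ρ x - ρ y by ring]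
  · intro x hx y hy r h1 h2
    obtain ⟨z, hz, hzr⟩ := h.exists_eq y hy x hx (-r) (by linarith) (by linarith)
    exact ⟨z, hz, by rw [hzr, neg_neg]⟩

theorem isCalibrated_reverse_iff :
    IsCalibrated (fun x y => D y x) (fun x => -ρ x) C ↔ IsCalibrated D ρ C := by
  refine ⟨fun h => ?_, fun h => h.reverse⟩
  have := h.reverse
  simpa using this

/-- Zorn's lemma applies because the conditions concern only two points at a time, and any two
points in the union of a chain lie in a common member. -/
theorem IsCalibrated.exists_maximal (h : IsCalibrated D ρ C) :
    ∃ C', C ⊆ C' ∧ Maximal (IsCalibrated D ρ) C' := by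
  refine zorn_subset_nonempty {C | IsCalibrated D ρ C} (fun c hc hchain hne => ?_) C h
  refine ⟨⋃₀ c, ?_, fun s hs => subset_sUnion_of_mem hs⟩
  have key : ∀ x ∈ ⋃₀ c, ∀ y ∈ ⋃₀ c, ∃ s ∈ c, x ∈ s ∧ y ∈ s := by
    rintro x ⟨s, hs, hxs⟩ y ⟨t, ht, hyt⟩
    rcases hchain.total hs ht with h | h
    · exact ⟨t, ht, h hxs, hyt⟩
    · exact ⟨s, hs, hxs, h hyt⟩
  constructor
  · intro x hx y hy
    obtain ⟨s, hs, hxs, hys⟩ := key x hx y hy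
    exact (hc hs).dist_le x hxs y hys
  · intro x hx y hy r h1 h2
    obtain ⟨s, hs, hxs, hys⟩ := key x hx y hy
    obtain ⟨z, hz, hzr⟩ := (hc hs).exists_eq x hxs y hys r h1 h2
    exact ⟨z, ⟨s, hs, hz⟩, hzr⟩

/-- A maximal calibrated set reaches the maximal value of `ρ`. -/
theorem exists_eq_of_maximal [TopologicalSpace X] (hself : ∀ x, D x x = 0)
    (htri : ∀ x y z, D x z ≤ D x y + D y z)
    (hnear : ∀ z, ∀ ε > 0, ∀ᶠ x in 𝓝 z, D x z < ε) (hρ : Continuous ρ)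
    (hcomplete : ∀ x : ℕ → X, (∀ ε : ℝ≥0∞, 0 < ε → ∃ N, ∀ i j, N ≤ i → i ≤ j → D (x i) (x j) < ε) →
      ∃ p, Tendsto x atTop (𝓝 p))
    {R : ℝ} (hR : ∀ x, ρ x ≤ R) (hmax : Maximal (IsCalibrated D ρ) C) {x₁ : X} (hx₁ : x₁ ∈ C)
    (hext : ∀ z, ρ x₁ ≤ ρ z → ρ z < R → ∃ ε > 0, ∃ c : ℝ → X, c 0 = z ∧
      (∀ t, 0 ≤ t → t < ε → ρ (c t) = ρ z + t) ∧
      ∀ s t, 0 ≤ s → s ≤ t → t < ε → D (c s) (c t) ≤ ENNReal.ofReal (t - s)) :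
    ∃ z ∈ C, ρ z = R := by
  have hC := hmax.prop
  have hbdd : BddAbove (ρ '' C) := ⟨R, by rintro _ ⟨x, -, rfl⟩; exact hR x⟩
  have hne : (ρ '' C).Nonempty := ⟨_, x₁, hx₁, rfl⟩
  set β := sSup (ρ '' C) with hβ
  have hle : ∀ x ∈ C, ρ x ≤ β := fun x hx => le_csSup hbdd ⟨x, hx, rfl⟩
  -- If the supremum β is not attained, points of C with ρ increasing to β form a forward Cauchy
  -- sequence. Its limit can be added to C, against maximality.
  have hatt : ∃ z ∈ C, ρ z = β := by
    by_contra! hnot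
    have hlt : ∀ x ∈ C, ρ x < β := fun x hx => lt_of_le_of_ne (hle x hx) (hnot x hx)
    obtain ⟨u, humono, hulim, hu⟩ := exists_seq_tendsto_sSup hne hbdd
    change Tendsto u atTop (𝓝 β) at hulim
    choose x hxC hxu using hu
    have hxx : ∀ i j, i ≤ j → D (x i) (x j) ≤ ENNReal.ofReal (u j - u i) := fun i j hij => by
      have := hC.dist_le _ (hxC i) _ (hxC j) (by rw [hxu, hxu]; exact humono hij)
      rwa [hxu, hxu] at this
    obtain ⟨z, hz⟩ := hcomplete x (by
      intro ε hε
      have h1 : Tendsto (fun i => ENNReal.ofReal (β - u i)) atTop (𝓝 0) := by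
        have := (ENNReal.continuous_ofReal.tendsto _).comp ((tendsto_const_nhds (x := β)).sub hulim)
        rwa [sub_self, ENNReal.ofReal_zero] at this
      obtain ⟨k, hk⟩ := (h1.eventually_lt_const hε).exists
      refine ⟨k, fun i j hi hij => ((hxx i j hij).trans ?_).trans_lt hk⟩
      apply ENNReal.ofReal_le_ofReal
      have h2 : u j ≤ β := by rw [← hxu j]; exact hle _ (hxC j)
      have h3 := humono hi
      linarith)
    have hρz : ρ z = β := by
      have h1 : Tendsto (fun i => ρ (x i)) atTop (𝓝 (ρ z)) := (hρ.tendsto z).comp hz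
      simp only [hxu] at h1
      exact tendsto_nhds_unique h1 hulim
    have hdz : ∀ y ∈ C, D y z ≤ ENNReal.ofReal (β - ρ y) := by
      intro y hy
      refine le_of_forall_pos_le_add fun ε hε => ?_
      have h1 := hz.eventually (hnear z ε hε)
      have h2 := hulim.eventually_const_lt (hlt y hy)
      obtain ⟨i, hi1, hi2⟩ := (h1.and h2).exists
      refine (htri y (x i) z).trans (add_le_add ?_ hi1.le)
      refine (hC.dist_le y hy _ (hxC i) (by rw [hxu]; exact hi2.le)).trans ?_
      apply ENNReal.ofReal_le_ofReal
      linarith [hle _ (hxC i)]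
    have hnew : IsCalibrated D ρ (insert z C) := by
      constructor
      · rintro y (rfl | hy) y' (rfl | hy') hyy'
        · rw [hself]; exact bot_le
        · exact absurd (hlt y' hy') (not_lt.2 (hρz ▸ hyy'))
        · rw [hρz]; exact hdz y hy
        · exact hC.dist_le y hy y' hy' hyy'
      · have key : ∀ y ∈ C, ∀ r, ρ y ≤ r → r ≤ β → ∃ w ∈ insert z C, ρ w = r := by
          intro y hy r h1 h2
          rcases h2.eq_or_lt with rfl | h2
          · exact ⟨z, mem_insert _ _, hρz⟩
          · obtain ⟨i, hi⟩ := (hulim.eventually_const_lt h2).exists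
            obtain ⟨w, hw, hwr⟩ := hC.exists_eq y hy _ (hxC i) r h1 (by rw [hxu]; exact hi.le)
            exact ⟨w, mem_insert_of_mem _ hw, hwr⟩
        rintro y (rfl | hy) y' hy' r h1 h2
        · refine ⟨y, mem_insert _ _, le_antisymm h1 ?_⟩
          rcases hy' with rfl | hy'
          · exact h2
          · rw [hρz]; exact h2.trans (hle _ hy')
        · refine key y hy r h1 ?_
          rcases hy' with rfl | hy'
          · rwa [← hρz]
          · exact h2.trans (hle _ hy')
    exact hnot z (hmax.le_of_ge hnew (subset_insert z C) (mem_insert z C)) hρz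
  obtain ⟨z, hzC, hzβ⟩ := hatt
  rcases (hR z).eq_or_lt with h | hlt
  · exact ⟨z, hzC, h⟩
  exfalso
  obtain ⟨ε, hε, c, hc0, hcρ, hcd⟩ := hext z (by rw [hzβ]; exact hle _ hx₁) hlt
  -- If β < R, a short curve issuing from the top point z enlarges C beyond β, again against
  -- maximality.
  have hnew : IsCalibrated D ρ (C ∪ c '' Ico 0 ε) := by
    constructor
    · rintro x (hx | ⟨s, hs, rfl⟩) y (hy | ⟨t, ht, rfl⟩) hxy
      · exact hC.dist_le x hx y hy hxy
      · have h1 := hC.dist_le x hx z hzC (by rw [hzβ]; exact hle x hx)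
        have h2 := hcd 0 t le_rfl ht.1 ht.2
        rw [hc0, sub_zero] at h2
        refine (htri x z (c t)).trans ((add_le_add h1 h2).trans (le_of_eq ?_))
        rw [← ENNReal.ofReal_add (by rw [hzβ]; linarith [hle x hx]) ht.1, hcρ t ht.1 ht.2]
        congr 1
        ring
      · have h1 := hle y hy
        rw [hcρ s hs.1 hs.2, hzβ] at hxy
        -- The point c s lies at level β + s and y at most at level β, so c s is z itself.
        have : s = 0 := le_antisymm (by linarith) hs.1
        subst this
        rw [hc0]
        exact hC.dist_le z hzC y hy (by linarith)
      · rw [hcρ s hs.1 hs.2, hcρ t ht.1 ht.2] at hxy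
        rw [hcρ s hs.1 hs.2, hcρ t ht.1 ht.2, add_sub_add_left_eq_sub]
        exact hcd s t hs.1 (by linarith) ht.2
    · intro x hx y hy r h1 h2
      rcases le_or_gt r β with hr | hr
      · rcases hx with hx | ⟨s, hs, rfl⟩
        · obtain ⟨w, hw, hwr⟩ := hC.exists_eq x hx z hzC r h1 (by rwa [hzβ])
          exact ⟨w, Or.inl hw, hwr⟩
        · rw [hcρ s hs.1 hs.2, hzβ] at h1
          exact ⟨z, Or.inl hzC, by rw [hzβ]; linarith [hs.1]⟩
      · rcases hy with hy | ⟨t, ht, rfl⟩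
        · exact absurd (h2.trans (hle y hy)) (not_le.2 hr)
        · rw [hcρ t ht.1 ht.2, hzβ] at h2
          have h3 : 0 ≤ r - β := by linarith
          have h4 : r - β < ε := by linarith [ht.2]
          exact ⟨c (r - β), Or.inr ⟨r - β, ⟨h3, h4⟩, rfl⟩, by rw [hcρ _ h3 h4, hzβ]; ring⟩
  have hmem : c (ε / 2) ∈ C := hmax.le_of_ge hnew subset_union_left
    (Or.inr ⟨ε / 2, ⟨by positivity, by linarith⟩, rfl⟩)
  have h1 := hle _ hmem
  rw [hcρ _ (by positivity) (by linarith), hzβ] at h1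
  linarith

end Calibrated

/-! ### Calibrated curves between the first and the last level -/

namespace FinslerStructure

open Finsler

variable {n : ℕ} {M : Type*} [TopologicalSpace M]
  [ChartedSpace (EuclideanSpace ℝ (Fin n)) M] [IsManifold (𝓡 n) ∞ M]

/-- A curve along which `ρ` is the parameter and the distance is at most the elapsed time. -/
structure IsCalibratedCurve (F : FinslerStructure n M) (ρ : M → ℝ) (γ : ℝ → M) (α β : ℝ) : Prop where
  apply_eq : ∀ t ∈ Icc α β, ρ (γ t) = t
  dist_le : ∀ s t, α ≤ s → s ≤ t → t ≤ β → F.dist (γ s) (γ t) ≤ ENNReal.ofReal (t - s)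

theorem IsCalibratedCurve.isCalibrated_image {F : FinslerStructure n M} {ρ : M → ℝ} {γ : ℝ → M}
    {α β : ℝ} (hγ : F.IsCalibratedCurve ρ γ α β) : IsCalibrated F.dist ρ (γ '' Icc α β) := by
  constructor
  · rintro _ ⟨s, hs, rfl⟩ _ ⟨t, ht, rfl⟩ hst
    rw [hγ.apply_eq s hs, hγ.apply_eq t ht] at hst ⊢
    exact hγ.dist_le s t hs.1 hst ht.2
  · rintro _ ⟨s, hs, rfl⟩ _ ⟨t, ht, rfl⟩ r h1 h2
    rw [hγ.apply_eq s hs] at h1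
    rw [hγ.apply_eq t ht] at h2
    have hr : r ∈ Icc α β := ⟨hs.1.trans h1, h2.trans ht.2⟩
    exact ⟨γ r, ⟨r, hr, rfl⟩, hγ.apply_eq r hr⟩

theorem eventually_dist_lt_right (F : FinslerStructure n M) (q : M) {ε : ℝ≥0∞} (hε : 0 < ε) :
    ∀ᶠ x in 𝓝 q, F.dist q x < ε :=
  (Continuous.prodMk_right (Y := M) q).continuousAt.eventually (F.eventually_dist_lt q hε)

theorem eventually_dist_lt_left (F : FinslerStructure n M) (q : M) {ε : ℝ≥0∞} (hε : 0 < ε) :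
    ∀ᶠ x in 𝓝 q, F.dist x q < ε :=
  (Continuous.prodMk_left (X := M) q).continuousAt.eventually (F.eventually_dist_lt q hε)

/-- Calibration passes to limits. -/
theorem dist_le_of_tendsto {F : FinslerStructure n M} {ι : Type*} {l : Filter ι} [l.NeBot]
    {u v : ι → M} {x y : M} (hu : Tendsto u l (𝓝 x)) (hv : Tendsto v l (𝓝 y)) {r : ℝ≥0∞}
    (huv : ∀ᶠ i in l, F.dist (u i) (v i) ≤ r) : F.dist x y ≤ r := by
  refine le_of_forall_pos_le_add fun ε hε => ?_
  have hε2 : 0 < ε / 2 := ENNReal.half_pos hε.ne'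
  obtain ⟨i, ⟨h1, h2⟩, h3⟩ := (((hu.eventually (F.eventually_dist_lt_right x hε2)).and
    (hv.eventually (F.eventually_dist_lt_left y hε2))).and huv).exists
  calc F.dist x y ≤ F.dist x (u i) + F.dist (u i) y := F.dist_triangle _ _ _
    _ ≤ F.dist x (u i) + (F.dist (u i) (v i) + F.dist (v i) y) := by
        gcongr; exact F.dist_triangle _ _ _
    _ ≤ ε / 2 + (r + ε / 2) := by gcongr
    _ = r + ε := by rw [add_left_comm, ENNReal.add_halves]

namespace IsRegularTransnormal

variable {F : FinslerStructure n M} {f : M → ℝ} {𝔟 : ℝ → ℝ} {a b : ℝ}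
  (h : F.IsRegularTransnormal f 𝔟 a b) [ConnectedSpace M] [T2Space M]

include h

/-- A calibrated set with a regular point lies on a calibrated curve that joins the first level
set to the last one. -/
theorem exists_calibratedCurve (hforward : F.ForwardComplete) (hbackward : F.BackwardComplete)
    {C : Set M} (hC : IsCalibrated F.dist (arrival 𝔟 a f) C) {x₁ : M} (hx₁ : x₁ ∈ C)
    (hreg : f x₁ ∈ Ioo a b) :
    ∃ γ : ℝ → M, F.IsCalibratedCurve (arrival 𝔟 a f) γ 0 (travelTime 𝔟 a b) ∧
      ∀ x ∈ C, γ (arrival 𝔟 a f x) = x := by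
  set ρ := arrival 𝔟 a f with hρ
  set R := travelTime 𝔟 a b with hR
  obtain ⟨C', hCC', hmax⟩ := hC.exists_maximal
  have hx₁' : x₁ ∈ C' := hCC' hx₁
  have hreg' := h.mem_Ioo_iff.1 hreg
  obtain ⟨z₁, hz₁, hz₁R⟩ : ∃ z ∈ C', ρ z = R := by
    refine exists_eq_of_maximal F.dist_self F.dist_triangle
      (fun z ε hε => F.eventually_dist_lt_left z hε) h.continuous_arrival hforward h.arrival_le hmax
      hx₁' fun z hz1 hz2 => ?_
    obtain ⟨ε, hε, c, hc0, hcρ, hcd⟩ := h.exists_local_curve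
      (h.mem_Ioo_iff.2 ⟨hreg'.1.trans_le hz1, hz2⟩)
    exact ⟨ε, hε, c, hc0, fun t h1 h2 => hcρ t ⟨by linarith, h2⟩, fun s t h1 h2 h3 =>
      hcd s ⟨by linarith, by linarith⟩ t ⟨by linarith, h3⟩ h2⟩
  -- The same extension for the reversed distance, where -ρ ≤ 0 replaces ρ ≤ R and the short curves
  -- are run backward.
  obtain ⟨z₀, hz₀, hz₀R⟩ : ∃ z ∈ C', -ρ z = 0 := by
    have hmax' : Maximal (IsCalibrated (fun x y => F.dist y x) (fun x => -ρ x)) C' := by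
      refine ⟨hmax.prop.reverse, fun s hs hle => hmax.2 (isCalibrated_reverse_iff.1 hs) hle⟩
    refine exists_eq_of_maximal (D := fun x y => F.dist y x) (ρ := fun x => -ρ x) F.dist_self
      (fun x y z => by rw [add_comm]; exact F.dist_triangle _ _ _)
      (fun z ε hε => F.eventually_dist_lt_right z hε) h.continuous_arrival.neg hbackward
      (fun x => by linarith [h.arrival_nonneg x]) hmax' hx₁' fun z hz1 hz2 => ?_
    obtain ⟨ε, hε, c, hc0, hcρ, hcd⟩ := h.exists_local_curve (q := z)
      (h.mem_Ioo_iff.2 ⟨neg_lt_zero.1 hz2, (neg_le_neg_iff.1 hz1).trans_lt hreg'.2⟩)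
    refine ⟨ε, hε, fun t => c (-t), by simpa using hc0, fun t h1 h2 => ?_, fun s t h1 h2 h3 => ?_⟩
    · change -(arrival 𝔟 a f (c (-t))) = -(arrival 𝔟 a f z) + t
      rw [hcρ (-t) ⟨by linarith, by linarith⟩]; ring
    · have := hcd (-t) ⟨by linarith, by linarith⟩ (-s) ⟨by linarith, by linarith⟩ (by linarith)
      rwa [show -s - -t = t - s by ring] at this
  rw [neg_eq_zero] at hz₀R
  have hall : ∀ t, ∃ z, t ∈ Icc 0 R → z ∈ C' ∧ ρ z = t := by
    intro t
    by_cases ht : t ∈ Icc 0 R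
    · obtain ⟨z, hz, hzt⟩ := hmax.prop.exists_eq z₀ hz₀ z₁ hz₁ t (by rw [hz₀R]; exact ht.1)
        (by rw [hz₁R]; exact ht.2)
      exact ⟨z, fun _ => ⟨hz, hzt⟩⟩
    · exact ⟨x₁, fun h => absurd h ht⟩
  choose γ hγ using hall
  refine ⟨γ, ⟨fun t ht => (hγ t ht).2, fun s t h1 h2 h3 => ?_⟩, fun x hx => ?_⟩
  · have hs := hγ s ⟨h1, h2.trans h3⟩
    have ht := hγ t ⟨h1.trans h2, h3⟩
    have := hmax.prop.dist_le _ hs.1 _ ht.1 (by rw [hs.2, ht.2]; exact h2)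
    rwa [hs.2, ht.2] at this
  -- Two points of a calibrated set with the same ρ have distance 0 and coincide, so the chosen
  -- curve passes through every point of C.
  · have hx' := hγ (ρ x) ⟨h.arrival_nonneg x, h.arrival_le x⟩
    have := hmax.prop.dist_le _ hx'.1 _ (hCC' hx) hx'.2.le
    rw [hx'.2, sub_self, ENNReal.ofReal_zero] at this
    exact F.eq_of_dist_eq_zero (le_antisymm this bot_le)

/-- A single point is a calibrated set. -/
theorem exists_calibratedCurve_through (hforward : F.ForwardComplete)
    (hbackward : F.BackwardComplete) {q : M} (hq : f q ∈ Ioo a b) :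
    ∃ γ : ℝ → M, F.IsCalibratedCurve (arrival 𝔟 a f) γ 0 (travelTime 𝔟 a b) ∧
      γ (arrival 𝔟 a f q) = q := by
  have hC : IsCalibrated F.dist (arrival 𝔟 a f) {q} := by
    constructor
    · rintro x rfl y rfl -
      rw [F.dist_self]; exact bot_le
    · rintro x rfl y rfl r h1 h2
      exact ⟨y, rfl, le_antisymm h1 h2⟩
  obtain ⟨γ, hγ, hγC⟩ := h.exists_calibratedCurve hforward hbackward hC rfl hq
  exact ⟨γ, hγ, hγC q rfl⟩

/-- Through each point of the last level set there is a calibrated curve. -/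
theorem exists_calibratedCurve_last (hforward : F.ForwardComplete)
    (hbackward : F.BackwardComplete) (hb : interior (f ⁻¹' {b}) = ∅) {q : M} (hq : f q = b) :
    ∃ γ : ℝ → M, F.IsCalibratedCurve (arrival 𝔟 a f) γ 0 (travelTime 𝔟 a b) ∧
      γ (travelTime 𝔟 a b) = q := by
  set ρ := arrival 𝔟 a f with hρ
  set R := travelTime 𝔟 a b with hR
  have hR0 : 0 < R := h.travelTime_pos (left_mem_Icc.2 h.lt.le) (right_mem_Icc.2 h.lt.le) h.lt
  have hρq : ρ q = R := by rw [hρ, arrival, hq]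
  -- Otherwise f would equal b on a neighbourhood of q.
  have hcl : q ∈ closure (f ⁻¹' Ioo a b) := by
    rw [mem_closure_iff_nhds]
    intro U hU
    have h1 : f ⁻¹' Ioi a ∈ 𝓝 q := h.continuous.continuousAt (Ioi_mem_nhds (by rw [hq]; exact h.lt))
    by_contra hne
    have h2 : U ∩ f ⁻¹' Ioi a ⊆ f ⁻¹' {b} := by
      rintro x ⟨hxU, hxa⟩
      by_contra hxb
      exact hne ⟨x, hxU, hxa, lt_of_le_of_ne (h.mem_Icc x).2 hxb⟩
    have h3 : q ∈ interior (f ⁻¹' {b}) :=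
      mem_interior_iff_mem_nhds.2 (mem_of_superset (inter_mem hU h1) h2)
    rw [hb] at h3
    exact h3
  have hnb : (𝓝[f ⁻¹' Ioo a b] q).NeBot := mem_closure_iff_nhdsWithin_neBot.1 hcl
  -- As regular points x tend to q, the calibrated curves `G x` through them should converge; along
  -- an ultrafilter their limits exist for all relevant times at once, by compactness of K.
  set 𝒰 : Ultrafilter M := Ultrafilter.of (𝓝[f ⁻¹' Ioo a b] q) with h𝒰
  have h𝒰le : (𝒰 : Filter M) ≤ 𝓝[f ⁻¹' Ioo a b] q := Ultrafilter.of_le _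
  have h𝒰q : Tendsto (fun x => x) (𝒰 : Filter M) (𝓝 q) := h𝒰le.trans nhdsWithin_le_nhds
  have h𝒰reg : ∀ᶠ x in (𝒰 : Filter M), f x ∈ Ioo a b :=
    h𝒰le self_mem_nhdsWithin
  have hG : ∀ x : M, ∃ γ : ℝ → M, f x ∈ Ioo a b → F.IsCalibratedCurve ρ γ 0 R ∧ γ (ρ x) = x := by
    intro x
    by_cases hx : f x ∈ Ioo a b
    · obtain ⟨γ, hγ⟩ := h.exists_calibratedCurve_through hforward hbackward hx
      exact ⟨γ, fun _ => hγ⟩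
    · exact ⟨fun _ => q, fun h => absurd h hx⟩
  choose G hG using hG
  have : LocallyCompactSpace M := Manifold.locallyCompact_of_finiteDimensional (𝓡 n)
  obtain ⟨K, hK, hKq⟩ := exists_compact_mem_nhds q
  obtain ⟨W, hW, δ, hδ, hWδ⟩ := F.exists_nhds_of_dist_lt hKq
  -- The bound δ / 2 keeps the curves in K at times in [R - ε, R); the bound R / 2 keeps R - ε
  -- positive, so that the limit curve starts at a regular point.
  set ε := min (δ / 2) (R / 2) with hε
  have hε0 : 0 < ε := by positivity
  have hρlim : Tendsto ρ (𝒰 : Filter M) (𝓝 R) := by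
    have := (h.continuous_arrival.tendsto q).comp h𝒰q
    rwa [show arrival 𝔟 a f q = R from hρq] at this
  have hev : ∀ t, t ∈ Ico (R - ε) R → ∀ᶠ x in (𝒰 : Filter M), f x ∈ Ioo a b ∧ t ≤ ρ x ∧ 0 ≤ t ∧
      G x t ∈ K := by
    intro t ht
    have h1 : 0 ≤ t := by
      have : ε ≤ R / 2 := min_le_right _ _
      linarith [ht.1]
    filter_upwards [h𝒰reg, hρlim.eventually_const_lt ht.2, h𝒰q.eventually_mem hW] with x hx1 hx2 hx3
    refine ⟨hx1, hx2.le, h1, (hWδ (G x t) x (Or.inr hx3) ?_).1⟩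
    have h2 := (hG x hx1).1.dist_le t (ρ x) h1 hx2.le (h.arrival_le x)
    rw [(hG x hx1).2] at h2
    refine h2.trans_lt ((ENNReal.ofReal_lt_ofReal_iff hδ).2 ?_)
    have h3 : ε ≤ δ / 2 := min_le_left _ _
    have h4 := h.arrival_le x
    linarith [ht.1]
  have hlim : ∀ t, ∃ z, t ∈ Ico (R - ε) R → Tendsto (fun x => G x t) (𝒰 : Filter M) (𝓝 z) := by
    intro t
    by_cases ht : t ∈ Ico (R - ε) R
    · have h1 : ((𝒰.map fun x => G x t : Ultrafilter M) : Filter M) ≤ 𝓟 K := by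
        rw [le_principal_iff, Ultrafilter.coe_map, mem_map]
        filter_upwards [hev t ht] with x hx using hx.2.2.2
      obtain ⟨z, -, hz⟩ := hK.ultrafilter_le_nhds _ h1
      exact ⟨z, fun _ => hz⟩
    · exact ⟨q, fun h => absurd h ht⟩
  choose g hg using hlim
  set γ : ℝ → M := fun t => if t = R then q else g t with hγ
  have hγR : γ R = q := by simp [hγ]
  have hγlt : ∀ t, t < R → γ t = g t := fun t ht => by simp [hγ, ht.ne]
  have hcal : F.IsCalibratedCurve ρ γ (R - ε) R := by
    constructor
    · intro t ht
      rcases ht.2.eq_or_lt with rfl | htR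
      · rw [hγR, hρq]
      · have ht' : t ∈ Ico (R - ε) R := ⟨ht.1, htR⟩
        rw [hγlt t htR]
        have h1 : Tendsto (fun x => ρ (G x t)) (𝒰 : Filter M) (𝓝 (ρ (g t))) :=
          (h.continuous_arrival.tendsto _).comp (hg t ht')
        refine tendsto_nhds_unique h1 (tendsto_const_nhds.congr' ?_)
        filter_upwards [hev t ht'] with x hx
        exact ((hG x hx.1).1.apply_eq t ⟨hx.2.2.1, htR.le⟩).symm
    · intro s t hs hst ht
      rcases ht.eq_or_lt with rfl | htR
      · rcases hst.eq_or_lt with rfl | hsR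
        · rw [F.dist_self]; exact bot_le
        · have hs' : s ∈ Ico (R - ε) R := ⟨hs, hsR⟩
          rw [hγlt s hsR, hγR]
          refine dist_le_of_tendsto (hg s hs') h𝒰q ?_
          filter_upwards [hev s hs'] with x hx
          have h2 := (hG x hx.1).1.dist_le s (ρ x) hx.2.2.1 hx.2.1 (h.arrival_le x)
          rw [(hG x hx.1).2] at h2
          exact h2.trans (ENNReal.ofReal_le_ofReal (by linarith [h.arrival_le x]))
      · have hs' : s ∈ Ico (R - ε) R := ⟨hs, hst.trans_lt htR⟩
        have ht' : t ∈ Ico (R - ε) R := ⟨hs.trans hst, htR⟩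
        rw [hγlt s hs'.2, hγlt t htR]
        refine dist_le_of_tendsto (hg s hs') (hg t ht') ?_
        filter_upwards [hev s hs', hev t ht'] with x hx hx'
        exact (hG x hx.1).1.dist_le s t hx.2.2.1 hst htR.le
  have hmid : R - ε ∈ Icc (R - ε) R := ⟨le_rfl, by linarith⟩
  have hεR : ε ≤ R / 2 := min_le_right _ _
  -- The limit is calibrated only on [R - ε, R]; since it contains a regular point, it extends to
  -- all of [0, R].
  obtain ⟨γ', hγ', hγC⟩ := h.exists_calibratedCurve hforward hbackward hcal.isCalibrated_image
    ⟨R - ε, hmid, rfl⟩ (h.mem_Ioo_iff.2 (by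
      rw [show arrival 𝔟 a f (γ (R - ε)) = R - ε from hcal.apply_eq _ hmid]
      exact ⟨by linarith, by linarith⟩))
  refine ⟨γ', hγ', ?_⟩
  have := hγC q ⟨R, ⟨by linarith, le_rfl⟩, hγR⟩
  rwa [show arrival 𝔟 a f q = R from hρq] at this

end IsRegularTransnormal

end FinslerStructure

/-! ### Differentiability inside, smoothness up to the end points -/

section Regularity

variable {E : Type*} [NormedAddCommGroup E] [NormedSpace ℝ E] [FiniteDimensional ℝ E]

theorem IsMinkowskiNorm.continuous {N : E → ℝ} (hN : IsMinkowskiNorm N) : Continuous N := by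
  rw [continuous_iff_continuousAt]
  intro v
  by_cases hv : v = 0
  · subst hv
    obtain ⟨m, hm, C, hC, hmC⟩ := hN.exists_bounds
    rw [ContinuousAt, hN.map_zero]
    refine squeeze_zero hN.nonneg (fun v => (hmC v).2) ?_
    have : Continuous fun v : E => C * ‖v‖ := by fun_prop
    simpa using this.tendsto 0
  · exact (hN.contDiffAt hv).continuousAt

/-- On a compact set, the Minkowski norms of a family are uniformly equivalent to the norm. -/
theorem IsMinkowskiFamily.exists_bounds {N : E → E → ℝ} {V K : Set E} (h : IsMinkowskiFamily N V)
    (hK : IsCompact K) (hKV : K ⊆ V) :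
    ∃ m > 0, ∃ C > 0, ∀ x ∈ K, ∀ v, m * ‖v‖ ≤ N x v ∧ N x v ≤ C * ‖v‖ := by
  have hc : ContinuousOn (fun z : E × E => N z.1 z.2) (K ×ˢ Metric.sphere (0 : E) 1) :=
    h.smooth.continuousOn.mono (prod_mono hKV fun v hv => by rintro rfl; simp at hv)
  have hKS : IsCompact (K ×ˢ Metric.sphere (0 : E) 1) := hK.prod (isCompact_sphere 0 1)
  obtain ⟨m, hm, hm'⟩ : ∃ m > 0, ∀ z ∈ K ×ˢ Metric.sphere (0 : E) 1, m ≤ N z.1 z.2 := by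
    rcases (K ×ˢ Metric.sphere (0 : E) 1).eq_empty_or_nonempty with h0 | h0
    · exact ⟨1, one_pos, fun v hv => by rw [h0] at hv; exact absurd hv (notMem_empty _)⟩
    · obtain ⟨z, hz, hmin⟩ := hKS.exists_isMinOn h0 hc
      refine ⟨N z.1 z.2, (h.norm z.1 (hKV hz.1)).pos ?_, fun w hw => hmin hw⟩
      intro h1
      have := hz.2
      rw [h1] at this
      simp at this
  obtain ⟨C, hC⟩ := hKS.exists_bound_of_continuousOn hc
  refine ⟨m, hm, max C 1, by positivity, fun x hx v => ?_⟩
  have hN := h.norm x (hKV hx)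
  by_cases hv : v = 0
  · subst hv; simp [hN.map_zero]
  have hv' : 0 < ‖v‖ := norm_pos_iff.2 hv
  have hw : (x, ‖v‖⁻¹ • v) ∈ K ×ˢ Metric.sphere (0 : E) 1 := by
    refine ⟨hx, ?_⟩
    simp [norm_smul, hv'.ne']
  have h1 := hm' _ hw
  have h2 := (le_abs_self _).trans (hC _ hw)
  simp only [] at h1 h2
  rw [hN.homogeneous _ _ (inv_pos.2 hv'), inv_mul_eq_div] at h1 h2
  rw [le_div_iff₀ hv'] at h1
  rw [div_le_iff₀ hv'] at h2
  exact ⟨h1, h2.trans (by gcongr; exact le_max_left _ _)⟩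

/-- A curve along which an eikonal function `ρ` is the parameter and that is asymptotically
not longer than the elapsed time is an integral curve of the gradient of `ρ`. -/
theorem IsFinslerEikonal.hasDerivAt_of_calibrated {N : E → E → ℝ} {V : Set E} {ρ : E → ℝ}
    {X : E → E} (h : IsFinslerEikonal N V ρ X) {c : ℝ → E} {t₀ : ℝ} (hc0 : c t₀ ∈ V)
    (hc : ContinuousAt c t₀) (hρ : ∀ᶠ t in 𝓝 t₀, ρ (c t) = ρ (c t₀) + (t - t₀))
    (hslope : ∀ η, 0 < η → η < 1 → ∀ᶠ t in 𝓝[≠] t₀, (1 - η) * N (c t₀) (slope c t₀ t) ≤ 1) :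
    HasDerivAt c (X (c t₀)) t₀ := by
  have hN := h.norm _ hc0
  obtain ⟨m, hm, C, hC, hmC⟩ := hN.exists_bounds
  -- The choice η = 1/2 bounds the norm of the slopes by 2, so they stay in a compact ball.
  have hbdd : ∀ᶠ t in 𝓝[≠] t₀, slope c t₀ t ∈ Metric.closedBall (0 : E) (2 / m) := by
    filter_upwards [hslope (1 / 2) (by norm_num) (by norm_num)] with t ht
    rw [mem_closedBall_zero_iff, le_div_iff₀ hm]
    have := (hmC (slope c t₀ t)).1
    linarith
  have hdρ : HasFDerivAt ρ (fderiv ℝ ρ (c t₀)) (c t₀) :=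
    ((h.smooth_fun.contDiffAt (h.isOpen.mem_nhds hc0)).differentiableAt (by simp)).hasFDerivAt
  -- Because the slopes are bounded, the error in the linearization of ρ is o(t - t₀), while ρ(c(t))
  -- - ρ(c(t₀)) is exactly t - t₀.
  have hlin : Tendsto (fun t => fderiv ℝ ρ (c t₀) (slope c t₀ t)) (𝓝[≠] t₀) (𝓝 1) := by
    have hO : (fun t => c t - c t₀) =O[𝓝[≠] t₀] fun t => t - t₀ := by
      refine Asymptotics.IsBigO.of_bound (2 / m) ?_
      filter_upwards [hbdd, self_mem_nhdsWithin] with t ht htne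
      have h1 : t - t₀ ≠ 0 := sub_ne_zero.2 htne
      have h2 : c t - c t₀ = (t - t₀) • slope c t₀ t := by
        rw [slope, smul_inv_smul₀ h1, vsub_eq_sub]
      rw [h2, norm_smul, mul_comm]
      exact mul_le_mul_of_nonneg_right (mem_closedBall_zero_iff.1 ht) (norm_nonneg _)
    have ho : (fun t => ρ (c t) - ρ (c t₀) - fderiv ℝ ρ (c t₀) (c t - c t₀)) =o[𝓝[≠] t₀]
        fun t => t - t₀ :=
      (hdρ.isLittleO.comp_tendsto (hc.tendsto.mono_left nhdsWithin_le_nhds)).trans_isBigO hO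
    have h3 := ho.tendsto_div_nhds_zero
    have h4 : Tendsto (fun t => 1 - (ρ (c t) - ρ (c t₀) - fderiv ℝ ρ (c t₀) (c t - c t₀)) / (t - t₀))
        (𝓝[≠] t₀) (𝓝 (1 - 0)) := tendsto_const_nhds.sub h3
    rw [sub_zero] at h4
    refine h4.congr' ?_
    filter_upwards [self_mem_nhdsWithin, nhdsWithin_le_nhds hρ] with t htne ht
    have h1 : t - t₀ ≠ 0 := sub_ne_zero.2 htne
    rw [slope, map_smul, vsub_eq_sub, show ρ (c t) = ρ (c t₀) + (t - t₀) from ht, smul_eq_mul]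
    field_simp
    ring
  -- Every limit w of slopes along an ultrafilter has N(w) ≤ 1 and dρ(w) = 1. Equality in the
  -- fundamental inequality leaves only w = X.
  rw [hasDerivAt_iff_tendsto_slope, tendsto_iff_ultrafilter]
  intro g hg
  have h1 : ((g.map (slope c t₀) : Ultrafilter E) : Filter E) ≤ 𝓟 (Metric.closedBall (0 : E) (2 / m)) := by
    rw [le_principal_iff, Ultrafilter.coe_map, mem_map]
    exact hg hbdd
  obtain ⟨w, -, hw⟩ := (isCompact_closedBall (0 : E) (2 / m)).ultrafilter_le_nhds _ h1
  have hw' : Tendsto (slope c t₀) (g : Filter ℝ) (𝓝 w) := hw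
  have hNw : N (c t₀) w ≤ 1 := by
    by_contra! hlt
    -- For this η, (1 - η) N(w) = (N(w) + 1) / 2, which exceeds 1.
    set η := (N (c t₀) w - 1) / (2 * N (c t₀) w) with hη
    have hp : 0 < N (c t₀) w := by linarith
    have hη0 : 0 < η := div_pos (by linarith) (by linarith)
    have hη1 : η < 1 := by rw [hη, div_lt_one (by linarith)]; linarith
    have h2 : Tendsto (fun t => (1 - η) * N (c t₀) (slope c t₀ t)) (g : Filter ℝ)
        (𝓝 ((1 - η) * N (c t₀) w)) :=
      tendsto_const_nhds.mul ((hN.continuous.tendsto w).comp hw')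
    have h3 := le_of_tendsto h2 (hg (hslope η hη0 hη1))
    have h4 : η * N (c t₀) w = (N (c t₀) w - 1) / 2 := by rw [hη]; field_simp
    nlinarith
  have hdw : fderiv ℝ ρ (c t₀) w = 1 :=
    tendsto_nhds_unique (((fderiv ℝ ρ (c t₀)).continuous.tendsto w).comp hw') (hlin.mono_left hg)
  have : w = X (c t₀) := hN.eq_of_le_legendre (h.norm_gradient _ hc0) hNw
    (by rw [h.legendre_gradient _ hc0, hdw])
  rwa [this] at hw'

/-- An integral curve of the gradient of an eikonal function is smooth up to the end points, also
if these are outside of the domain of the eikonal function. -/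
theorem IsFinslerEikonal.contDiffWithinAt_Icc {N : E → E → ℝ} {V V₀ : Set E} {ρ : E → ℝ}
    {X : E → E} (h : IsFinslerEikonal N V ρ X) (h₀ : IsMinkowskiFamily N V₀)
    {c : ℝ → E} {α β : ℝ} (hαβ : α < β) (hc : ContinuousOn c (Icc α β))
    (hcV₀ : MapsTo c (Icc α β) V₀) (hcV : MapsTo c (Ioo α β) V)
    (hcd : ∀ t ∈ Ioo α β, HasDerivAt c (X (c t)) t) {t₀ : ℝ} (ht₀ : t₀ ∈ Icc α β) :
    ContDiffWithinAt ℝ ∞ c (Icc α β) t₀ := by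
  have hK : IsCompact (c '' Icc α β) := isCompact_Icc.image_of_continuousOn hc
  obtain ⟨m, hm, C, hC, hmC⟩ := h₀.exists_bounds hK hcV₀.image_subset
  -- A compact set of positions and velocities, away from the zero vector. It contains all (c t, X
  -- (c t)), since the velocities have norm 1 and the norms along c are uniformly comparable to ‖·‖.
  set Q : Set (E × E) :=
    (c '' Icc α β) ×ˢ (Metric.closedBall (0 : E) (1 / m) ∩ {y | 1 / C ≤ ‖y‖}) with hQ
  have hQc : IsCompact Q := hK.prod
    ((isCompact_closedBall _ _).inter_right (isClosed_le continuous_const continuous_norm))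
  have hQV : Q ⊆ V₀ ×ˢ {0}ᶜ := by
    rintro ⟨x, y⟩ ⟨hx, -, hy⟩
    refine ⟨hcV₀.image_subset hx, ?_⟩
    rintro rfl
    have h1 : 1 / C ≤ ‖(0 : E)‖ := hy
    rw [norm_zero] at h1
    exact absurd h1 (not_le.2 (by positivity))
  have hXQ : ∀ t ∈ Ioo α β, (c t, X (c t)) ∈ Q := by
    intro t ht
    have hx : c t ∈ c '' Icc α β := ⟨t, Ioo_subset_Icc_self ht, rfl⟩
    have h1 := hmC _ hx (X (c t))
    rw [h.norm_gradient _ (hcV ht)] at h1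
    refine ⟨hx, ?_, ?_⟩
    · rw [mem_closedBall_zero_iff, le_div_iff₀ hm, mul_comm]
      exact h1.1
    · change 1 / C ≤ ‖X (c t)‖
      rw [div_le_iff₀ hC, mul_comm]
      exact h1.2
  -- The momentum along c. By the Euler-Lagrange equation its derivative is the base derivative of
  -- the energy, which is bounded on Q; so P is Lipschitz and extends to the end points although ρ
  -- may not be differentiable there.
  set P : ℝ → E →L[ℝ] ℝ := fun t => fderiv ℝ ρ (c t) with hP
  have hPd : ∀ t ∈ Ioo α β, HasDerivAt P (baseDeriv N (c t, X (c t))) t := by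
    intro t ht
    have h1 : HasFDerivAt (fderiv ℝ ρ) (fderiv ℝ (fderiv ℝ ρ) (c t)) (c t) :=
      ((h.contDiffOn_fderiv.contDiffAt (h.isOpen.mem_nhds (hcV ht))).differentiableAt
        (by simp)).hasFDerivAt
    have h2 := h1.comp_hasDerivAt t (hcd t ht)
    rw [h.fderiv_fderiv_gradient (hcV ht)] at h2
    exact h2
  obtain ⟨B, hB⟩ := hQc.exists_bound_of_continuousOn (h₀.contDiffOn_baseDeriv.continuousOn.mono hQV)
  have hPlip : LipschitzOnWith (Real.toNNReal B) P (Ioo α β) := by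
    refine (convex_Ioo α β).lipschitzOnWith_of_nnnorm_hasDerivWithin_le
      (fun t ht => (hPd t ht).hasDerivWithinAt) fun t ht => ?_
    rw [← NNReal.coe_le_coe, coe_nnnorm]
    exact (hB _ (hXQ t ht)).trans (Real.le_coe_toNNReal B)
  obtain ⟨g, hg, hPg⟩ := hPlip.extend_finite_dimension
  set z : ℝ → E × (E →L[ℝ] ℝ) := fun t => (c t, g t) with hz
  have hzc : ContinuousOn z (Icc α β) := hc.prodMk hg.continuous.continuousOn
  have hcl : closure (Ioo α β) = Icc α β := closure_Ioo hαβ.ne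
  have hnb : (𝓝[Ioo α β] t₀).NeBot := mem_closure_iff_nhdsWithin_neBot.1 (by rwa [hcl])
  have hct₀ : Tendsto c (𝓝[Ioo α β] t₀) (𝓝 (c t₀)) := (hc t₀ ht₀).mono Ioo_subset_Icc_self
  -- the limit velocity
  obtain ⟨y₀, hy₀, hy₀g⟩ : ∃ y₀, y₀ ≠ 0 ∧ fibreDeriv N (c t₀, y₀) = g t₀ := by
    set 𝒰 := Ultrafilter.of (𝓝[Ioo α β] t₀)
    have h𝒰 : (𝒰 : Filter ℝ) ≤ 𝓝[Ioo α β] t₀ := Ultrafilter.of_le _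
    have hmem : ∀ᶠ t in (𝒰 : Filter ℝ), t ∈ Ioo α β := h𝒰 self_mem_nhdsWithin
    have h1 : ((𝒰.map fun t => (c t, X (c t)) : Ultrafilter (E × E)) : Filter (E × E)) ≤ 𝓟 Q := by
      rw [le_principal_iff, Ultrafilter.coe_map, mem_map]
      filter_upwards [hmem] with t ht using hXQ t ht
    obtain ⟨⟨x, y⟩, hxyQ, hxy⟩ := hQc.ultrafilter_le_nhds _ h1
    have hxy' : Tendsto (fun t => (c t, X (c t))) (𝒰 : Filter ℝ) (𝓝 (x, y)) := hxy
    have hx : x = c t₀ := tendsto_nhds_unique ((continuous_fst.tendsto _).comp hxy')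
      (hct₀.mono_left h𝒰)
    subst hx
    have hyQ := hQV hxyQ
    refine ⟨y, hyQ.2, ?_⟩
    have h2 : Tendsto (fun t => fibreDeriv N (c t, X (c t))) (𝒰 : Filter ℝ)
        (𝓝 (fibreDeriv N (c t₀, y))) :=
      ((h₀.contDiffOn_fibreDeriv.contDiffAt (h₀.isOpen_phase.mem_nhds hyQ)).continuousAt.tendsto).comp
        hxy'
    have h3 : Tendsto g (𝒰 : Filter ℝ) (𝓝 (g t₀)) :=
      (hg.continuous.tendsto t₀).mono_left (h𝒰.trans nhdsWithin_le_nhds)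
    refine tendsto_nhds_unique h2 (h3.congr' ?_)
    filter_upwards [hmem] with t ht
    rw [← hPg ht]
    ext v
    rw [h₀.fibreDeriv_apply (hQV (hXQ t ht)), h.legendre_gradient _ (hcV ht)]
  obtain ⟨Y, G, hG, h0G, hY, hYG⟩ := h₀.exists_smooth_legendre_inverse (hcV₀ ht₀) hy₀
  rw [hy₀g] at h0G
  -- the smooth Hamiltonian vector field
  set Z : E × (E →L[ℝ] ℝ) → E × (E →L[ℝ] ℝ) := fun w => (Y w, baseDeriv N (w.1, Y w)) with hZ
  have hZs : ContDiffOn ℝ ∞ Z G := by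
    refine hY.prodMk (h₀.contDiffOn_baseDeriv.comp (contDiffOn_fst.prodMk hY) fun w hw => ?_)
    exact ⟨(hYG w hw).1, (hYG w hw).2.1⟩
  obtain ⟨ε, hε, hεG⟩ := Metric.mem_nhdsWithin_iff.1
    ((hzc t₀ ht₀).preimage_mem_nhdsWithin (hG.mem_nhds h0G))
  set α' := max α (t₀ - ε / 2) with hα'
  set β' := min β (t₀ + ε / 2) with hβ'
  have hαβ' : α' < β' := by
    rw [hα', hβ', max_lt_iff, lt_min_iff, lt_min_iff]
    exact ⟨⟨hαβ, by linarith [ht₀.1]⟩, by linarith [ht₀.2], by linarith⟩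
  have hsub : Icc α' β' ⊆ Icc α β := Icc_subset_Icc (le_max_left _ _) (min_le_left _ _)
  have hsub' : Ioo α' β' ⊆ Ioo α β := Ioo_subset_Ioo (le_max_left _ _) (min_le_left _ _)
  have hzG : MapsTo z (Icc α' β') G := by
    intro t ht
    refine hεG ⟨?_, hsub ht⟩
    rw [Metric.mem_ball, Real.dist_eq, abs_lt]
    have h1 := (le_max_right _ _).trans ht.1
    have h2 := ht.2.trans (min_le_right _ _)
    constructor <;> linarith
  have hzd : ∀ t ∈ Ioo α' β', HasDerivAt z (Z (z t)) t := by
    intro t ht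
    have ht' := hsub' ht
    have hYX : X (c t) = Y (z t) := by
      refine (hYG _ (hzG (Ioo_subset_Icc_self ht))).2.2 _ fun v => ?_
      rw [show (z t).1 = c t from rfl, show (z t).2 = P t from (hPg ht').symm,
        h.legendre_gradient _ (hcV ht')]
    have h1 := hcd t ht'
    have h2 : HasDerivAt g (baseDeriv N (c t, X (c t))) t := by
      refine (hPd t ht').congr_of_eventuallyEq ?_
      filter_upwards [isOpen_Ioo.mem_nhds ht'] with s hs using (hPg hs).symm
    have h3 := h1.prodMk h2
    rw [hYX] at h3
    exact h3
  have hZz : ContinuousOn (fun t => Z (z t)) (Icc α' β') :=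
    hZs.continuousOn.comp (hzc.mono hsub) hzG
  have hcl' : closure (Ioo α' β') = Icc α' β' := closure_Ioo hαβ'.ne
  -- The one-sided derivative at an end point exists because the derivatives at interior times
  -- converge there.
  have hzd' : ∀ t ∈ Icc α' β', HasDerivWithinAt z (Z (z t)) (Icc α' β') t := by
    intro t ht
    have h1 := hasFDerivWithinAt_closure_of_tendsto_fderiv (f := z) (s := Ioo α' β') (x := t)
      (f' := ContinuousLinearMap.toSpanSingleton ℝ (Z (z t)))
      (fun s hs => (hzd s hs).differentiableAt.differentiableWithinAt) (convex_Ioo _ _) isOpen_Ioo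
      (fun s hs => by
        rw [hcl'] at hs
        exact (hzc s (hsub hs)).mono (Ioo_subset_Icc_self.trans hsub)) ?_
    · rw [hcl'] at h1
      have := h1.hasDerivWithinAt
      rwa [ContinuousLinearMap.toSpanSingleton_apply, one_smul] at this
    · have h2 : Tendsto (fun s => ContinuousLinearMap.toSpanSingleton ℝ (Z (z s)))
          (𝓝[Ioo α' β'] t) (𝓝 (ContinuousLinearMap.toSpanSingleton ℝ (Z (z t)))) := by
        have h3 := (hZz t ht).mono Ioo_subset_Icc_self
        have h4 : Continuous (fun w : E × (E →L[ℝ] ℝ) => ContinuousLinearMap.toSpanSingleton ℝ w) :=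
          (ContinuousLinearMap.toSpanSingletonCLE (𝕜 := ℝ) (E := E × (E →L[ℝ] ℝ))).continuous
        exact (h4.tendsto _).comp h3
      refine h2.congr' ?_
      filter_upwards [self_mem_nhdsWithin] with s hs
      exact (hzd s hs).hasFDerivAt.fderiv.symm
  have hzs : ContDiffOn ℝ ∞ z (Icc α' β') :=
    ODE.contDiffOn_enat_Icc_of_hasDerivWithinAt (n := ⊤) (f := fun _ => Z) (u := G)
      (hZs.comp contDiffOn_snd fun w hw => hw.2) hzd' hzG
  have ht₀' : t₀ ∈ Icc α' β' :=
    ⟨max_le ht₀.1 (by linarith), le_min ht₀.2 (by linarith)⟩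
  have h5 : ContDiffWithinAt ℝ ∞ c (Icc α' β') t₀ := contDiff_fst.comp_contDiffWithinAt (hzs t₀ ht₀')
  refine h5.mono_of_mem_nhdsWithin ?_
  have h6 : Icc (t₀ - ε / 2) (t₀ + ε / 2) ∈ 𝓝 t₀ := Icc_mem_nhds (by linarith) (by linarith)
  filter_upwards [nhdsWithin_le_nhds h6, self_mem_nhdsWithin] with t ht1 ht2
  exact ⟨max_le ht2.1 ht1.1, le_min ht2.2 ht1.2⟩

end Regularity

/-! ### Calibrated curves are smooth with unit speed -/

namespace FinslerStructure

open Finsler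

variable {n : ℕ} {M : Type*} [TopologicalSpace M]
  [ChartedSpace (EuclideanSpace ℝ (Fin n)) M] [IsManifold (𝓡 n) ∞ M]
  {F : FinslerStructure n M}

namespace IsCalibratedCurve

variable {ρ : M → ℝ} {γ : ℝ → M} {α β : ℝ}

theorem mono (hγ : F.IsCalibratedCurve ρ γ α β) {α' β' : ℝ} (hα : α ≤ α') (hβ : β' ≤ β) :
    F.IsCalibratedCurve ρ γ α' β' :=
  ⟨fun t ht => hγ.apply_eq t ⟨hα.trans ht.1, ht.2.trans hβ⟩,
    fun s t hs hst ht => hγ.dist_le s t (hα.trans hs) hst (ht.trans hβ)⟩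

theorem continuousOn [T2Space M] (hγ : F.IsCalibratedCurve ρ γ α β) :
    ContinuousOn γ (Icc α β) := by
  intro t₀ ht₀ U hU
  obtain ⟨W, hW, δ, hδ, h⟩ := F.exists_nhds_of_dist_lt hU
  have hδ' : ∀ᶠ t in 𝓝[Icc α β] t₀, |t - t₀| < δ := by
    refine mem_nhdsWithin_of_mem_nhds ?_
    filter_upwards [Metric.ball_mem_nhds t₀ hδ] with t ht
    rwa [← Real.dist_eq]
  rw [mem_map]
  filter_upwards [hδ', self_mem_nhdsWithin] with t ht htI
  rw [abs_lt] at ht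
  rcases le_total t₀ t with hle | hle
  · exact (h _ _ (Or.inl (mem_of_mem_nhds hW)) ((hγ.dist_le t₀ t ht₀.1 hle htI.2).trans_lt
      ((ENNReal.ofReal_lt_ofReal_iff hδ).2 ht.2))).2
  · exact (h _ _ (Or.inr (mem_of_mem_nhds hW)) ((hγ.dist_le t t₀ htI.1 hle ht₀.2).trans_lt
      ((ENNReal.ofReal_lt_ofReal_iff hδ).2 (by linarith)))).1

/-- In a chart, the difference quotients of a calibrated curve have asymptotically at most unit
length. -/
theorem eventually_locNorm_slope_le [T2Space M] (hγ : F.IsCalibratedCurve ρ γ α β) {t₀ : ℝ}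
    (ht₀ : t₀ ∈ Ioo α β) {p : M} (hp : γ t₀ ∈ (extChartAt (𝓡 n) p).source) {η : ℝ} (hη : 0 < η)
    (hη1 : η < 1) :
    ∀ᶠ t in 𝓝[≠] t₀, (1 - η) * F.locNorm p (extChartAt (𝓡 n) p (γ t₀))
      (slope (fun s => extChartAt (𝓡 n) p (γ s)) t₀ t) ≤ 1 := by
  set φ := extChartAt (𝓡 n) p with hφ
  have hN := F.isMinkowskiNorm_locNorm (φ.map_source hp)
  obtain ⟨W, hW, δ, hδ, h⟩ := F.exists_locNorm_le_dist hp hη hη1 univ_mem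
  have hδ' : ∀ᶠ t in 𝓝[≠] t₀, |t - t₀| < δ := by
    refine mem_nhdsWithin_of_mem_nhds ?_
    filter_upwards [Metric.ball_mem_nhds t₀ hδ] with t ht
    rwa [← Real.dist_eq]
  have hI : ∀ᶠ t in 𝓝[≠] t₀, t ∈ Icc α β := mem_nhdsWithin_of_mem_nhds (Icc_mem_nhds ht₀.1 ht₀.2)
  filter_upwards [hδ', hI, self_mem_nhdsWithin] with t ht htI hne
  rw [abs_lt] at ht
  have key : ∀ (v : EuclideanSpace ℝ (Fin n)) (r : ℝ), 0 < r → (1 - η) * F.locNorm p (φ (γ t₀)) v ≤ r →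
      (1 - η) * F.locNorm p (φ (γ t₀)) (r⁻¹ • v) ≤ 1 := by
    intro v r hr hv
    rw [hN.homogeneous _ _ (inv_pos.2 hr), mul_left_comm, inv_mul_le_iff₀ hr, mul_one]
    exact hv
  rw [slope_def_module]
  -- For t < t₀ the slope is a positive multiple of the displacement from γ(t) to γ(t₀), so both
  -- cases use the distance in the direction of travel and F need not be reversible.
  rcases lt_or_gt_of_ne hne with hlt | hlt
  · have h1 := hγ.dist_le t t₀ htI.1 hlt.le ht₀.2.le
    have h2 := (h _ _ (Or.inr (mem_of_mem_nhds hW)) (h1.trans_lt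
      ((ENNReal.ofReal_lt_ofReal_iff hδ).2 (by linarith)))).2.2.2.2.trans h1
    rw [ENNReal.ofReal_le_ofReal_iff (by linarith)] at h2
    have h3 := key _ _ (sub_pos.2 hlt) h2
    rwa [← neg_sub t t₀, ← neg_sub (φ (γ t)), inv_neg, neg_smul_neg] at h3
  · have h1 := hγ.dist_le t₀ t ht₀.1.le hlt.le htI.2
    have h2 := (h _ _ (Or.inl (mem_of_mem_nhds hW)) (h1.trans_lt
      ((ENNReal.ofReal_lt_ofReal_iff hδ).2 (by linarith)))).2.2.2.2.trans h1
    rw [ENNReal.ofReal_le_ofReal_iff (by linarith)] at h2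
    exact key _ _ (sub_pos.2 hlt) h2

end IsCalibratedCurve

namespace IsRegularTransnormal

variable {f : M → ℝ} {𝔟 : ℝ → ℝ} {a b : ℝ} (h : F.IsRegularTransnormal f 𝔟 a b)
  [ConnectedSpace M] {γ : ℝ → M} {α β : ℝ}

include h

/-- ρ cannot grow by more than the distance, so the upper bound in the definition is attained. -/
theorem dist_calibratedCurve (hγ : F.IsCalibratedCurve (arrival 𝔟 a f) γ α β) {s t : ℝ}
    (hs : α ≤ s) (hst : s ≤ t) (ht : t ≤ β) : F.dist (γ s) (γ t) = ENNReal.ofReal (t - s) := by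
  refine le_antisymm (hγ.dist_le s t hs hst ht) ?_
  have := h.ofReal_arrival_sub_le_dist (γ s) (γ t)
  rwa [hγ.apply_eq s ⟨hs, hst.trans ht⟩, hγ.apply_eq t ⟨hs.trans hst, ht⟩] at this

theorem bounds_calibratedCurve (hγ : F.IsCalibratedCurve (arrival 𝔟 a f) γ α β) (hαβ : α ≤ β) :
    0 ≤ α ∧ β ≤ travelTime 𝔟 a b := by
  have h1 := h.arrival_nonneg (γ α)
  have h2 := h.arrival_le (γ β)
  rw [hγ.apply_eq α (left_mem_Icc.2 hαβ)] at h1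
  rw [hγ.apply_eq β (right_mem_Icc.2 hαβ)] at h2
  exact ⟨h1, h2⟩

/-- Only the ends of a calibrated curve can be critical: ρ = t lies strictly between 0 and R at
interior times. -/
theorem mem_regularRegion (hγ : F.IsCalibratedCurve (arrival 𝔟 a f) γ α β) {t : ℝ}
    (ht : t ∈ Ioo α β) {p : M} (hp : γ t ∈ (extChartAt (𝓡 n) p).source) :
    extChartAt (𝓡 n) p (γ t) ∈ regularRegion n f a b p := by
  refine ⟨(extChartAt (𝓡 n) p).map_source hp, ?_⟩
  rw [mem_preimage, (extChartAt (𝓡 n) p).left_inv hp, h.mem_Ioo_iff,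
    hγ.apply_eq t (Ioo_subset_Icc_self ht)]
  have h1 := h.bounds_calibratedCurve hγ (ht.1.trans ht.2).le
  exact ⟨h1.1.trans_lt ht.1, ht.2.trans_le h1.2⟩

variable [T2Space M]

theorem hasDerivAt_calibratedCurve (hγ : F.IsCalibratedCurve (arrival 𝔟 a f) γ α β) {t₀ : ℝ}
    (ht₀ : t₀ ∈ Ioo α β) {p : M} (hp : γ t₀ ∈ (extChartAt (𝓡 n) p).source)
    {X : EuclideanSpace ℝ (Fin n) → EuclideanSpace ℝ (Fin n)}
    (hX : IsFinslerEikonal (F.locNorm p) (regularRegion n f a b p)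
      (fun x => arrival 𝔟 a f ((extChartAt (𝓡 n) p).symm x)) X) :
    HasDerivAt (fun s => extChartAt (𝓡 n) p (γ s)) (X (extChartAt (𝓡 n) p (γ t₀))) t₀ := by
  have hI := Icc_mem_nhds ht₀.1 ht₀.2
  have hc : ContinuousAt γ t₀ := hγ.continuousOn.continuousAt hI
  refine hX.hasDerivAt_of_calibrated (c := fun s => extChartAt (𝓡 n) p (γ s))
    (h.mem_regularRegion hγ ht₀ hp) ((continuousAt_extChartAt' hp).comp hc) ?_
    fun η hη hη1 => hγ.eventually_locNorm_slope_le ht₀ hp hη hη1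
  filter_upwards [hI, hc (extChartAt_source_mem_nhds' hp)] with t ht hts
  rw [(extChartAt (𝓡 n) p).left_inv hts, (extChartAt (𝓡 n) p).left_inv hp, hγ.apply_eq t ht,
    hγ.apply_eq t₀ (Ioo_subset_Icc_self ht₀)]
  ring

/-- Smoothness is local and is checked in the chart at each point. The eikonal equation holds there
only in the regular region, but the family of norms is smooth on the whole chart, which admits end
points on critical levels. -/
theorem contMDiffOn_calibratedCurve (hγ : F.IsCalibratedCurve (arrival 𝔟 a f) γ α β)
    (hαβ : α < β) : ContMDiffOn 𝓘(ℝ, ℝ) (𝓡 n) ∞ γ (Icc α β) := by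
  intro t₀ ht₀
  set φ := extChartAt (𝓡 n) (γ t₀) with hφ
  obtain ⟨X, hX⟩ := h.exists_isFinslerEikonal (γ t₀)
  obtain ⟨ε, hε, hεs⟩ := Metric.mem_nhdsWithin_iff.1
    (hγ.continuousOn t₀ ht₀ (extChartAt_source_mem_nhds (I := 𝓡 n) (γ t₀)))
  set α' := max α (t₀ - ε / 2) with hα'
  set β' := min β (t₀ + ε / 2) with hβ'
  have hsub : Icc α' β' ⊆ Icc α β := Icc_subset_Icc (le_max_left _ _) (min_le_left _ _)
  have hsource : ∀ t ∈ Icc α' β', γ t ∈ φ.source := by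
    intro t ht
    refine hεs ⟨?_, hsub ht⟩
    have h1 := (le_max_right _ _).trans ht.1
    have h2 := ht.2.trans (min_le_right _ _)
    rw [Metric.mem_ball, Real.dist_eq, abs_lt]
    constructor <;> linarith
  have hγ' : F.IsCalibratedCurve (arrival 𝔟 a f) γ α' β' :=
    hγ.mono (le_max_left _ _) (min_le_left _ _)
  have ht₀' : t₀ ∈ Icc α' β' :=
    ⟨max_le ht₀.1 (by linarith), le_min ht₀.2 (by linarith)⟩
  have hαβ' : α' < β' := by
    rw [hα', hβ', max_lt_iff, lt_min_iff, lt_min_iff]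
    exact ⟨⟨hαβ, by linarith [ht₀.1]⟩, by linarith [ht₀.2], by linarith⟩
  have hcd : ContDiffWithinAt ℝ ∞ (fun s => φ (γ s)) (Icc α' β') t₀ := by
    refine hX.contDiffWithinAt_Icc (F.isMinkowskiFamily_locNorm (γ t₀)) hαβ' ?_
      (fun t ht => φ.map_source (hsource t ht)) (fun t ht => ?_) (fun t ht => ?_) ht₀'
    · exact (continuousOn_extChartAt (I := 𝓡 n) (γ t₀)).comp hγ'.continuousOn hsource
    · exact h.mem_regularRegion hγ' ht (hsource t (Ioo_subset_Icc_self ht))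
    · exact h.hasDerivAt_calibratedCurve hγ' ht (hsource t (Ioo_subset_Icc_self ht)) hX
  have hnhds : Icc α' β' ∈ 𝓝[Icc α β] t₀ := by
    rw [Metric.mem_nhdsWithin_iff]
    refine ⟨ε / 2, half_pos hε, fun t ht => ?_⟩
    have h1 := ht.1
    rw [Metric.mem_ball, Real.dist_eq, abs_lt] at h1
    exact ⟨max_le ht.2.1 (by linarith), le_min ht.2.2 (by linarith)⟩
  refine ContMDiffWithinAt.mono_of_mem_nhdsWithin (s := Icc α' β') ?_ hnhds
  have h1 : ContMDiffWithinAt 𝓘(ℝ, ℝ) (𝓡 n) ∞ (fun s => φ.symm (φ (γ s))) (Icc α' β') t₀ := by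
    refine ContMDiffWithinAt.comp t₀ (t := φ.target)
      (contMDiffOn_extChartAt_symm (γ t₀) _ (φ.map_source (hsource t₀ ht₀')))
      hcd.contMDiffWithinAt fun t ht => φ.map_source (hsource t ht)
  exact h1.congr (fun t ht => (φ.left_inv (hsource t ht)).symm)
    (φ.left_inv (hsource t₀ ht₀')).symm

theorem toFun_velocity_calibratedCurve (hγ : F.IsCalibratedCurve (arrival 𝔟 a f) γ α β) {t : ℝ}
    (ht : t ∈ Ioo α β) : F.toFun (velocity γ t) = 1 := by
  obtain ⟨X, hX⟩ := h.exists_isFinslerEikonal (γ t)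
  have hp : γ t ∈ (extChartAt (𝓡 n) (γ t)).source := mem_extChartAt_source (γ t)
  have hm : MDifferentiableAt 𝓘(ℝ, ℝ) (𝓡 n) γ t :=
    ((h.contMDiffOn_calibratedCurve hγ (ht.1.trans ht.2)).contMDiffAt
      (Icc_mem_nhds ht.1 ht.2)).mdifferentiableAt (by simp)
  rw [F.toFun_velocity hp hm, (h.hasDerivAt_calibratedCurve hγ ht hp hX).deriv,
    hX.norm_gradient _ (h.mem_regularRegion hγ ht hp)]

end IsRegularTransnormal

end FinslerStructure

/-! ### First variation of the distance and orthogonality -/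

namespace Finsler

variable {n : ℕ} {M : Type*} [TopologicalSpace M]
  [ChartedSpace (EuclideanSpace ℝ (Fin n)) M] [IsManifold (𝓡 n) ∞ M]

omit [IsManifold (𝓡 n) ∞ M]

/-- The curve `c` starts at `q` with right derivative `w`, in the chart at `q`. -/
structure HasRightDeriv (c : ℝ → M) (q : M) (w : EuclideanSpace ℝ (Fin n)) : Prop where
  eventually_mem : ∀ᶠ s in 𝓝[>] (0 : ℝ), c s ∈ (extChartAt (𝓡 n) q).source
  tendsto : Tendsto (fun s : ℝ => extChartAt (𝓡 n) q (c s)) (𝓝[>] 0) (𝓝 (extChartAt (𝓡 n) q q))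
  tendsto_slope : Tendsto
    (fun s : ℝ => s⁻¹ • (extChartAt (𝓡 n) q (c s) - extChartAt (𝓡 n) q q)) (𝓝[>] 0) (𝓝 w)

theorem hasRightDeriv_const (q : M) : HasRightDeriv (n := n) (fun _ => q) q 0 :=
  ⟨Eventually.of_forall fun _ => mem_extChartAt_source q, tendsto_const_nhds, by
    simp only [sub_self, smul_zero]; exact tendsto_const_nhds⟩

/-- With κ = 1 or κ = -1 the curve leaves γ(t) forward or backward in time; the set I admits
one-sided derivatives at the ends. -/
theorem HasDerivWithinAt.hasRightDeriv {γ : ℝ → M} {I : Set ℝ} {t κ : ℝ}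
    {w : EuclideanSpace ℝ (Fin n)}
    (hc : ContinuousWithinAt γ I t)
    (hw : HasDerivWithinAt (fun s => extChartAt (𝓡 n) (γ t) (γ s)) w I t)
    (hI : ∀ᶠ s in 𝓝[>] (0 : ℝ), t + κ * s ∈ I) :
    HasRightDeriv (fun s => γ (t + κ * s)) (γ t) (κ • w) := by
  have hcont : Continuous fun s : ℝ => t + κ * s := by fun_prop
  have h0 : Tendsto (fun s : ℝ => t + κ * s) (𝓝[>] 0) (𝓝[I] t) := by
    refine tendsto_nhdsWithin_iff.2 ⟨?_, hI⟩
    have := hcont.tendsto 0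
    simp only [mul_zero, add_zero] at this
    exact this.mono_left nhdsWithin_le_nhds
  refine ⟨(hc.tendsto.comp h0) (extChartAt_source_mem_nhds (γ t)),
    hw.continuousWithinAt.tendsto.comp h0, ?_⟩
  have hd : HasDerivWithinAt (fun s : ℝ => t + κ * s) κ (Ioi 0) 0 := by
    simpa using (((hasDerivAt_id (0 : ℝ)).const_mul κ).const_add t).hasDerivWithinAt
  have h1 : HasDerivWithinAt (fun s : ℝ => extChartAt (𝓡 n) (γ t) (γ (t + κ * s)))
      (κ • w) (Ioi 0 ∩ {s | t + κ * s ∈ I}) 0 := by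
    refine HasDerivWithinAt.scomp (t' := I) (h := fun s : ℝ => t + κ * s) 0
      (by simpa using hw) (hd.mono inter_subset_left) fun s hs => hs.2
  have h2 := hasDerivWithinAt_iff_tendsto_slope.1 h1
  have h3 : (Ioi (0 : ℝ) ∩ {s | t + κ * s ∈ I}) \ {0} ∈ 𝓝[>] (0 : ℝ) := by
    filter_upwards [hI, self_mem_nhdsWithin] with s hs h0
    exact ⟨⟨h0, hs⟩, (ne_of_gt h0)⟩
  refine (h2.mono_left (le_inf nhdsWithin_le_nhds (le_principal_iff.2 h3))).congr fun s => ?_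
  rw [slope_def_module]
  simp

end Finsler

namespace FinslerStructure

open Finsler

variable {n : ℕ} {M : Type*} [TopologicalSpace M]
  [ChartedSpace (EuclideanSpace ℝ (Fin n)) M] [IsManifold (𝓡 n) ∞ M]
  (F : FinslerStructure n M)

/-- Near q the distance is at most the norm at q of the coordinate difference, up to a small
relative error. Dividing by s and letting s → 0 leaves the norm of the difference of the
derivatives. -/
theorem le_locNorm_of_hasRightDeriv {q : M} {c₁ c₂ : ℝ → M} {w₁ w₂ : EuclideanSpace ℝ (Fin n)}
    (h₁ : HasRightDeriv c₁ q w₁) (h₂ : HasRightDeriv c₂ q w₂)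
    (hd : ∀ᶠ s in 𝓝[>] (0 : ℝ), ENNReal.ofReal s ≤ F.dist (c₁ s) (c₂ s)) :
    1 ≤ F.locNorm q (extChartAt (𝓡 n) q q) (w₂ - w₁) := by
  set φ := extChartAt (𝓡 n) q with hφ
  have hq : q ∈ φ.source := mem_extChartAt_source q
  have hN := F.isMinkowskiNorm_locNorm (φ.map_source hq)
  have key : ∀ η > 0, 1 ≤ F.locNorm q (φ q) (w₂ - w₁) + η * ‖w₂ - w₁‖ := by
    intro η hη
    obtain ⟨r, hr, hrV, hrd⟩ := F.exists_dist_le_locNorm hq hη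
    have hball := Metric.closedBall_mem_nhds (φ q) hr
    have hlim : Tendsto (fun s : ℝ => s⁻¹ • (φ (c₂ s) - φ (c₁ s))) (𝓝[>] 0) (𝓝 (w₂ - w₁)) :=
      (h₂.tendsto_slope.sub h₁.tendsto_slope).congr fun s => by
        rw [← smul_sub, sub_sub_sub_cancel_right]
    have hlim2 : Tendsto (fun s : ℝ => F.locNorm q (φ q) (s⁻¹ • (φ (c₂ s) - φ (c₁ s))) +
        η * ‖s⁻¹ • (φ (c₂ s) - φ (c₁ s))‖) (𝓝[>] 0)
        (𝓝 (F.locNorm q (φ q) (w₂ - w₁) + η * ‖w₂ - w₁‖)) :=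
      ((hN.continuous.tendsto _).comp hlim).add (hlim.norm.const_mul η)
    refine ge_of_tendsto hlim2 ?_
    filter_upwards [hd, h₁.eventually_mem, h₂.eventually_mem, h₁.tendsto hball, h₂.tendsto hball,
      self_mem_nhdsWithin] with s hs hs1 hs2 hb1 hb2 (hs0 : 0 < s)
    have h3 := hrd _ hb1 _ hb2
    rw [φ.left_inv hs1, φ.left_inv hs2] at h3
    have h4 := hs.trans h3
    rw [ENNReal.ofReal_le_ofReal_iff (add_nonneg (hN.nonneg _) (by positivity))] at h4
    rw [hN.homogeneous _ _ (inv_pos.2 hs0), norm_smul, Real.norm_of_nonneg (inv_pos.2 hs0).le,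
      mul_left_comm, ← mul_add, le_inv_mul_iff₀ hs0, mul_one]
    exact h4
  refine le_of_forall_pos_le_add fun ε hε => ?_
  have h5 : 0 < ‖w₂ - w₁‖ + 1 := by positivity
  have h6 := key (ε / (‖w₂ - w₁‖ + 1)) (by positivity)
  have h7 : ε / (‖w₂ - w₁‖ + 1) * ‖w₂ - w₁‖ ≤ ε := by
    rw [div_mul_eq_mul_div, div_le_iff₀ h5]
    nlinarith
  linarith

/-- The opposite comparison of distance and norm. It requires one of the two points to lie near q,
which is immediate when one curve rests at q. -/
theorem locNorm_le_of_hasRightDeriv [T2Space M] {q : M} {c₁ c₂ : ℝ → M}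
    {w₁ w₂ : EuclideanSpace ℝ (Fin n)}
    (h₁ : HasRightDeriv c₁ q w₁) (h₂ : HasRightDeriv c₂ q w₂) (hq : c₁ = (fun _ => q) ∨ c₂ = fun _ => q)
    (hd : ∀ᶠ s in 𝓝[>] (0 : ℝ), F.dist (c₁ s) (c₂ s) ≤ ENNReal.ofReal s) :
    F.locNorm q (extChartAt (𝓡 n) q q) (w₂ - w₁) ≤ 1 := by
  set φ := extChartAt (𝓡 n) q with hφ
  have hqs : q ∈ φ.source := mem_extChartAt_source q
  have hN := F.isMinkowskiNorm_locNorm (φ.map_source hqs)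
  have hlim : Tendsto (fun s : ℝ => s⁻¹ • (φ (c₂ s) - φ (c₁ s))) (𝓝[>] 0) (𝓝 (w₂ - w₁)) :=
    (h₂.tendsto_slope.sub h₁.tendsto_slope).congr fun s => by
      rw [← smul_sub, sub_sub_sub_cancel_right]
  have key : ∀ η : ℝ, 0 < η → η < 1 → (1 - η) * F.locNorm q (φ q) (w₂ - w₁) ≤ 1 := by
    intro η hη hη1
    obtain ⟨W, hW, δ, hδ, h⟩ := F.exists_locNorm_le_dist hqs hη hη1 univ_mem
    refine le_of_tendsto (((hN.continuous.tendsto _).comp hlim).const_mul (1 - η)) ?_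
    filter_upwards [hd, Ioo_mem_nhdsGT hδ] with s hs hsδ
    have hmem : c₁ s ∈ W ∨ c₂ s ∈ W := by
      rcases hq with rfl | rfl
      · exact Or.inl (mem_of_mem_nhds hW)
      · exact Or.inr (mem_of_mem_nhds hW)
    have h3 := (h _ _ hmem (hs.trans_lt ((ENNReal.ofReal_lt_ofReal_iff hδ).2 hsδ.2))).2.2.2.2.trans hs
    rw [ENNReal.ofReal_le_ofReal_iff hsδ.1.le] at h3
    rw [Function.comp_apply, hN.homogeneous _ _ (inv_pos.2 hsδ.1), mul_left_comm,
      inv_mul_le_iff₀ hsδ.1, mul_one]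
    exact h3
  by_contra! hlt
  set A := F.locNorm q (φ q) (w₂ - w₁) with hA
  -- If A > 1, this η gives (1 - η) A = (A + 1) / 2 > 1.
  have h1 := key ((A - 1) / (2 * A)) (by positivity [sub_pos.2 hlt]) (by
    rw [div_lt_one (by linarith)]; linarith)
  have h2 : (1 - (A - 1) / (2 * A)) * A = (A + 1) / 2 := by field_simp; ring
  rw [h2] at h1
  linarith

/-- A minimum of a Minkowski norm along a line is a zero of its Legendre transform. -/
theorem _root_.IsMinkowskiNorm.legendre_eq_zero_of_forall_le {E : Type*} [NormedAddCommGroup E]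
    [NormedSpace ℝ E] {N : E → ℝ} (hN : IsMinkowskiNorm N) {y v : E}
    (h : ∀ s : ℝ, N y ≤ N (y + s • v)) : minkowskiLegendre N y v = 0 := by
  have hmin : IsLocalMin (fun s : ℝ => N (y + s • v) ^ 2) 0 := by
    refine Eventually.of_forall fun s => ?_
    simp only [zero_smul, add_zero]
    exact pow_le_pow_left₀ (hN.nonneg y) (h s) 2
  unfold minkowskiLegendre
  rw [hmin.deriv_eq_zero, mul_zero]

/-- A curve in S can be run through its base point at any real rate e, also backward; hence every
multiple of v is the right derivative of a curve in S. -/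
theorem exists_hasRightDeriv_of_mem_tangentVectors {S : Set M} {q : M} {v : TangentSpace (𝓡 n) q}
    (hv : v ∈ tangentVectors S q) (e : ℝ) :
    ∃ c : ℝ → M, HasRightDeriv c q (e • vecCoord q ⟨q, v⟩) ∧ ∀ᶠ s in 𝓝[>] (0 : ℝ), c s ∈ S := by
  obtain ⟨σ, hσS, hσ, hσv⟩ := hv
  have h0 : σ 0 = q := congrArg Bundle.TotalSpace.proj hσv
  have hp : σ 0 ∈ (extChartAt (𝓡 n) q).source := by rw [h0]; exact mem_extChartAt_source q
  have h1 := vecCoord_velocity hp hσ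
  rw [hσv] at h1
  have h2 : DifferentiableAt ℝ (fun s => extChartAt (𝓡 n) q (σ s)) 0 := by
    rw [← mdifferentiableAt_iff_differentiableAt]
    exact ((contMDiffAt_extChartAt' (n := ∞) (by rwa [← extChartAt_source (𝓡 n)])).mdifferentiableAt
      (by simp)).comp 0 hσ
  have hlim : Tendsto (fun s : ℝ => 0 + e * s) (𝓝[>] 0) (𝓝 0) := by
    have : Continuous fun s : ℝ => 0 + e * s := by fun_prop
    simpa using (this.tendsto 0).mono_left (nhdsWithin_le_nhds (s := Ioi 0))
  refine ⟨fun s => σ (0 + e * s), ?_, hlim hσS⟩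
  rw [h1]
  have h3 := HasDerivWithinAt.hasRightDeriv (γ := σ) (I := univ) (t := 0) (κ := e)
    (w := deriv (fun s => extChartAt (𝓡 n) q (σ s)) 0) hσ.continuousAt.continuousWithinAt
    (by rw [h0]; exact h2.hasDerivAt.hasDerivWithinAt) (Eventually.of_forall fun _ => mem_univ _)
  rwa [h0] at h3

variable [T2Space M]

/-- A minimizing curve that arrives at a set, or departs from it, by the shortest way is orthogonal
to the set. -/
theorem isOrthogonal_derivOn {γ : ℝ → M} {T t : ℝ} (hT : 0 < T) (ht : t ∈ Icc 0 T)
    (hγ : MDifferentiableWithinAt 𝓘(ℝ, ℝ) (𝓡 n) γ (Icc 0 T) t)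
    (hd : ∀ s t, 0 ≤ s → s ≤ t → t ≤ T → F.dist (γ s) (γ t) = ENNReal.ofReal (t - s)) {S : Set M}
    (hS : (0 < t ∧ ∀ᶠ u in 𝓝[>] (0 : ℝ), ∀ x ∈ S, ENNReal.ofReal u ≤ F.dist (γ (t - u)) x) ∨
      (t < T ∧ ∀ᶠ u in 𝓝[>] (0 : ℝ), ∀ x ∈ S, ENNReal.ofReal u ≤ F.dist x (γ (t + u)))) :
    F.IsOrthogonal (γ t) (derivOn γ T t) S := by
  set φ := extChartAt (𝓡 n) (γ t) with hφ
  have hq : γ t ∈ φ.source := mem_extChartAt_source (γ t)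
  have hN := F.isMinkowskiNorm_locNorm (φ.map_source hq)
  have hw := vecCoord_derivOn hq hT ht hγ
  set w : EuclideanSpace ℝ (Fin n) := vecCoord (γ t) ⟨γ t, derivOn γ T t⟩ with hwdef
  have hdiff : DifferentiableWithinAt ℝ (fun s => φ (γ s)) (Icc 0 T) t := by
    rw [← mdifferentiableWithinAt_iff_differentiableWithinAt]
    exact ((contMDiffAt_extChartAt (n := ∞)).mdifferentiableAt
      (by simp)).comp_mdifferentiableWithinAt t hγ
  have hder : HasDerivWithinAt (fun s => φ (γ s)) w (Icc 0 T) t := by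
    rw [hw]; exact hdiff.hasDerivWithinAt
  have hright := fun κ => HasDerivWithinAt.hasRightDeriv (κ := κ) hγ.continuousWithinAt hder
  -- The velocity w has norm 1, and adding κ times the derivative of a curve in S cannot bring the
  -- norm below 1, since no point of S is nearer than γ(t) to the nearby points of γ. Here κ is 1 on
  -- arrival at S and -1 on departure.
  have main : F.locNorm (γ t) (φ (γ t)) w ≤ 1 ∧ 1 ≤ F.locNorm (γ t) (φ (γ t)) w ∧
      ∃ κ : ℝ, κ ≠ 0 ∧ ∀ (c : ℝ → M) (v : EuclideanSpace ℝ (Fin n)),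
      HasRightDeriv c (γ t) v → (∀ᶠ s in 𝓝[>] (0 : ℝ), c s ∈ S) →
      1 ≤ F.locNorm (γ t) (φ (γ t)) (w + κ • v) := by
    rcases hS with ⟨h0, hS⟩ | ⟨h0, hS⟩
    · have hI : ∀ᶠ s in 𝓝[>] (0 : ℝ), t + (-1) * s ∈ Icc 0 T := by
        filter_upwards [Ioo_mem_nhdsGT h0] with s hs
        constructor <;> linarith [hs.1, hs.2, ht.2]
      have h1 := hright (-1) hI
      have hd' : ∀ᶠ s in 𝓝[>] (0 : ℝ), F.dist (γ (t + (-1) * s)) (γ t) = ENNReal.ofReal s := by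
        filter_upwards [hI, self_mem_nhdsWithin] with s hs (hs0 : 0 < s)
        rw [hd _ _ hs.1 (by linarith) ht.2]
        congr 1
        ring
      have e1 : (0 : EuclideanSpace ℝ (Fin n)) - (-1 : ℝ) • w = w := by simp
      refine ⟨?_, ?_, 1, one_ne_zero, fun c v hc hcS => ?_⟩
      · rw [← e1]
        exact F.locNorm_le_of_hasRightDeriv h1 (hasRightDeriv_const _) (Or.inr rfl)
          (hd'.mono fun s hs => hs.le)
      · rw [← e1]
        exact F.le_locNorm_of_hasRightDeriv h1 (hasRightDeriv_const _) (hd'.mono fun s hs => hs.ge)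
      · have e2 : w + (1 : ℝ) • v = v - (-1 : ℝ) • w := by
          rw [one_smul, neg_one_smul, sub_neg_eq_add, add_comm]
        rw [e2]
        refine F.le_locNorm_of_hasRightDeriv h1 hc ?_
        filter_upwards [hcS, hS] with s hs1 hs2
        rw [neg_one_mul, ← sub_eq_add_neg]
        exact hs2 _ hs1
    · have hI : ∀ᶠ s in 𝓝[>] (0 : ℝ), t + 1 * s ∈ Icc 0 T := by
        filter_upwards [Ioo_mem_nhdsGT (sub_pos.2 h0)] with s hs
        constructor <;> linarith [hs.1, hs.2, ht.1]
      have h1 := hright 1 hI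
      have hd' : ∀ᶠ s in 𝓝[>] (0 : ℝ), F.dist (γ t) (γ (t + 1 * s)) = ENNReal.ofReal s := by
        filter_upwards [hI, self_mem_nhdsWithin] with s hs (hs0 : 0 < s)
        rw [hd _ _ ht.1 (by linarith) hs.2]
        congr 1
        ring
      have e1 : (1 : ℝ) • w - 0 = w := by simp
      refine ⟨?_, ?_, -1, by norm_num, fun c v hc hcS => ?_⟩
      · rw [← e1]
        exact F.locNorm_le_of_hasRightDeriv (hasRightDeriv_const _) h1 (Or.inl rfl)
          (hd'.mono fun s hs => hs.le)
      · rw [← e1]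
        exact F.le_locNorm_of_hasRightDeriv (hasRightDeriv_const _) h1 (hd'.mono fun s hs => hs.ge)
      · have e2 : w + (-1 : ℝ) • v = (1 : ℝ) • w - v := by
          rw [one_smul, neg_one_smul, sub_eq_add_neg]
        rw [e2]
        refine F.le_locNorm_of_hasRightDeriv hc h1 ?_
        filter_upwards [hcS, hS] with s hs1 hs2
        rw [one_mul]
        exact hs2 _ hs1
  obtain ⟨hw1, hw2, κ, hκ, hmain⟩ := main
  constructor
  · intro h0
    rw [hwdef, h0, F.locNorm_vecCoord hq] at hw2
    have h1 := F.locNorm_vecCoord hq (0 : TangentSpace (𝓡 n) (γ t))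
    rw [← h1, vecCoord_eq _ _ hq, map_zero, hN.map_zero] at hw2
    linarith
  · intro v hv
    rw [F.legendre_eq hq]
    refine hN.legendre_eq_zero_of_forall_le fun s => hw1.trans ?_
    -- The rate κ⁻¹ * s makes the perturbation exactly s • v, so w minimizes the norm on the whole
    -- line in the direction of v.
    obtain ⟨c, hc, hcS⟩ := exists_hasRightDeriv_of_mem_tangentVectors hv (κ⁻¹ * s)
    have h1 := hmain c _ hc hcS
    rwa [smul_smul, mul_inv_cancel_left₀ hκ] at h1

end FinslerStructure

/-! ### Wavefronts, wave rays and Huygens' principle -/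

namespace FinslerStructure

open Finsler

variable {n : ℕ} {M : Type*} [TopologicalSpace M]
  [ChartedSpace (EuclideanSpace ℝ (Fin n)) M] [IsManifold (𝓡 n) ∞ M]
  {F : FinslerStructure n M}

theorem distFrom_singleton (q p : M) : F.distFrom {q} p = F.dist q p := by
  simp [distFrom]

namespace IsRegularTransnormal

variable {f : M → ℝ} {𝔟 : ℝ → ℝ} {a b : ℝ} (h : F.IsRegularTransnormal f 𝔟 a b)
  [ConnectedSpace M] [T2Space M] {γ : ℝ → M} {T : ℝ}

include h

omit [T2Space M] in
theorem calibratedCurve_mem_level_iff (hγ : F.IsCalibratedCurve (arrival 𝔟 a f) γ 0 T) {t c : ℝ}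
    (ht : t ∈ Icc 0 T) (hc : c ∈ Icc a b) : f (γ t) = c ↔ t = travelTime 𝔟 a c := by
  rw [← h.arrival_eq_iff hc, hγ.apply_eq t ht]

theorem exists_calibratedCurve_of_ne (hforward : F.ForwardComplete)
    (hbackward : F.BackwardComplete) (hb : interior (f ⁻¹' {b}) = ∅) {q : M} (hq : a < f q) :
    ∃ γ : ℝ → M, F.IsCalibratedCurve (arrival 𝔟 a f) γ 0 (travelTime 𝔟 a b) ∧
      γ (arrival 𝔟 a f q) = q := by
  rcases (h.mem_Icc q).2.lt_or_eq with h1 | h1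
  · exact h.exists_calibratedCurve_through hforward hbackward ⟨hq, h1⟩
  · obtain ⟨γ, hγ, hγq⟩ := h.exists_calibratedCurve_last hforward hbackward hb h1
    refine ⟨γ, hγ, ?_⟩
    rw [arrival, h1, hγq]

/-- The distance from the first level set is the arrival time. -/
theorem distFrom_eq (hforward : F.ForwardComplete) (hbackward : F.BackwardComplete)
    (hb : interior (f ⁻¹' {b}) = ∅) (q : M) :
    F.distFrom (f ⁻¹' {a}) q = ENNReal.ofReal (arrival 𝔟 a f q) := by
  have ha := left_mem_Icc.2 h.lt.le
  apply le_antisymm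
  -- On f⁻¹(a) the distance is trivially 0. A calibrated curve through q need not exist there, as
  -- f⁻¹(a) may have interior points.
  · rcases (h.mem_Icc q).1.eq_or_lt with h1 | h1
    · refine (iInf₂_le q h1.symm).trans ?_
      rw [F.dist_self]
      exact bot_le
    · obtain ⟨γ, hγ, hγq⟩ := h.exists_calibratedCurve_of_ne hforward hbackward hb h1
      have h0 : (0 : ℝ) ∈ Icc 0 (travelTime 𝔟 a b) :=
        ⟨le_rfl, (h.arrival_nonneg q).trans (h.arrival_le q)⟩
      have h2 : f (γ 0) = a := (h.calibratedCurve_mem_level_iff hγ h0 ha).2 (travelTime_self a).symm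
      refine (iInf₂_le (γ 0) h2).trans ?_
      have := hγ.dist_le 0 _ le_rfl (h.arrival_nonneg q) (h.arrival_le q)
      rwa [hγq, sub_zero] at this
  · refine le_iInf₂ fun p hp => ?_
    have h1 := h.ofReal_arrival_sub_le_dist p q
    have h2 : arrival 𝔟 a f p = 0 := by rw [(h.arrival_eq_iff ha).2 hp, travelTime_self]
    rwa [h2, sub_zero] at h1

/-- The level sets are the wavefronts. -/
theorem wavefront_eq (hforward : F.ForwardComplete) (hbackward : F.BackwardComplete)
    (hb : interior (f ⁻¹' {b}) = ∅) {c : ℝ} (hc : c ∈ Icc a b) :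
    F.wavefront (f ⁻¹' {a}) (travelTime 𝔟 a c) = f ⁻¹' {c} := by
  obtain ⟨x, hx⟩ := h.exists_eq hc
  have h0 : 0 ≤ travelTime 𝔟 a c := by
    rw [← (h.arrival_eq_iff hc).2 hx]
    exact h.arrival_nonneg x
  ext q
  rw [wavefront, mem_ofPred_eq, h.distFrom_eq hforward hbackward hb,
    ENNReal.ofReal_eq_ofReal_iff (h.arrival_nonneg q) h0, h.arrival_eq_iff hc]
  rfl

theorem isGeodesic_of_calibrated (hγ : F.IsCalibratedCurve (arrival 𝔟 a f) γ 0 T) (hT : 0 < T) :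
    F.IsGeodesic γ T := by
  have hs := h.contMDiffOn_calibratedCurve hγ hT
  refine ⟨hs, fun s t h0 hst ht => ?_⟩
  rw [h.dist_calibratedCurve hγ h0 hst ht]
  exact F.length_eq_of_unitSpeed (.smooth hT.le hs)
    (fun u hu _ => h.toFun_velocity_calibratedCurve hγ hu) h0 ht

theorem isWaveRay_of_calibrated (hforward : F.ForwardComplete) (hbackward : F.BackwardComplete)
    (hb : interior (f ⁻¹' {b}) = ∅) (hγ : F.IsCalibratedCurve (arrival 𝔟 a f) γ 0 T)
    (hT : 0 < T) : F.IsWaveRay (f ⁻¹' {a}) γ T where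
  nonneg := hT.le
  piecewiseSmooth := .smooth hT.le (h.contMDiffOn_calibratedCurve hγ hT)
  unitSpeed := fun _ ht _ => h.toFun_velocity_calibratedCurve hγ ht
  source := (h.calibratedCurve_mem_level_iff hγ (left_mem_Icc.2 hT.le)
    (left_mem_Icc.2 h.lt.le)).2 (travelTime_self a).symm
  shortest := by
    rw [(h.isGeodesic_of_calibrated hγ hT).2 0 T le_rfl hT.le le_rfl,
      h.dist_calibratedCurve hγ le_rfl hT.le le_rfl, h.distFrom_eq hforward hbackward hb,
      hγ.apply_eq T (right_mem_Icc.2 hT.le), sub_zero]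

/-- Along the ray ρ grows from 0 to T during the time T, and never faster than at unit rate; so it
equals the time throughout. -/
theorem isCalibratedCurve_of_isWaveRay (hforward : F.ForwardComplete)
    (hbackward : F.BackwardComplete) (hb : interior (f ⁻¹' {b}) = ∅)
    (hγ : F.IsWaveRay (f ⁻¹' {a}) γ T) : F.IsCalibratedCurve (arrival 𝔟 a f) γ 0 T := by
  have hlen : ∀ s t, 0 ≤ s → t ≤ T → F.length γ s t = ENNReal.ofReal (t - s) := fun s t hs ht =>
    F.length_eq_of_unitSpeed hγ.piecewiseSmooth hγ.unitSpeed hs ht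
  have hdist : ∀ s t, 0 ≤ s → s ≤ t → t ≤ T → F.dist (γ s) (γ t) ≤ ENNReal.ofReal (t - s) :=
    fun s t hs hst ht => by
      rw [← hlen s t hs ht]
      exact F.dist_le_length (hγ.piecewiseSmooth.restrict hs hst ht)
  refine ⟨fun t ht => ?_, hdist⟩
  have h0 : arrival 𝔟 a f (γ 0) = 0 := by
    rw [(h.arrival_eq_iff (left_mem_Icc.2 h.lt.le)).2 hγ.source, travelTime_self]
  have hT : arrival 𝔟 a f (γ T) = T := by
    have h1 := hγ.shortest
    rw [hlen 0 T le_rfl le_rfl, h.distFrom_eq hforward hbackward hb, sub_zero,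
      ENNReal.ofReal_eq_ofReal_iff hγ.nonneg (h.arrival_nonneg _)] at h1
    exact h1.symm
  have h1 := h.arrival_sub_le (sub_nonneg.2 ht.1) (hdist 0 t le_rfl ht.1 ht.2)
  have h2 := h.arrival_sub_le (sub_nonneg.2 ht.2) (hdist t T ht.1 ht.2 le_rfl)
  linarith

/-- All points of the level have the same ρ, so none is nearer to γ than γ(t). For t > 0 the curve
is regarded as arriving at the level, for t = 0 as departing from it. -/
theorem isOrthogonal_level (hγ : F.IsCalibratedCurve (arrival 𝔟 a f) γ 0 T) (hT : 0 < T)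
    {t c : ℝ} (ht : t ∈ Icc 0 T) (hc : f (γ t) = c) :
    F.IsOrthogonal (γ t) (derivOn γ T t) (f ⁻¹' {c}) := by
  have hx : ∀ x ∈ f ⁻¹' {c}, arrival 𝔟 a f x = t := by
    intro x hx
    have h1 : f x = f (γ t) := by rw [hc]; exact hx
    rw [arrival, h1]
    exact hγ.apply_eq t ht
  refine F.isOrthogonal_derivOn hT ht
    ((h.contMDiffOn_calibratedCurve hγ hT t ht).mdifferentiableWithinAt (by simp))
    (fun s t hs hst ht => h.dist_calibratedCurve hγ hs hst ht) ?_
  rcases ht.1.eq_or_lt with h0 | h0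
  · refine Or.inr ⟨h0 ▸ hT, ?_⟩
    filter_upwards [Ioo_mem_nhdsGT hT] with u hu x hxc
    have h1 := h.ofReal_arrival_sub_le_dist x (γ (t + u))
    rwa [hx x hxc, hγ.apply_eq (t + u) (by rw [← h0, zero_add]; exact Ioo_subset_Icc_self hu),
      add_sub_cancel_left] at h1
  · refine Or.inl ⟨h0, ?_⟩
    filter_upwards [Ioo_mem_nhdsGT h0] with u hu x hxc
    have h1 := h.ofReal_arrival_sub_le_dist (γ (t - u)) x
    rwa [hx x hxc, hγ.apply_eq (t - u) ⟨by linarith [hu.2], by linarith [hu.1, ht.2]⟩,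
      sub_sub_cancel] at h1

/-- By the triangle inequality, no point at distance t - s from γ(s) can be nearer than u to γ(t -
u). -/
theorem isOrthogonal_wavefront (hγ : F.IsCalibratedCurve (arrival 𝔟 a f) γ 0 T) {s t : ℝ}
    (hs : 0 ≤ s) (hst : s < t) (ht : t ≤ T) :
    F.IsOrthogonal (γ t) (derivOn γ T t) (F.wavefront {γ s} (t - s)) := by
  have hT : 0 < T := by linarith
  have htT : t ∈ Icc 0 T := ⟨by linarith, ht⟩
  refine F.isOrthogonal_derivOn hT htT
    ((h.contMDiffOn_calibratedCurve hγ hT t htT).mdifferentiableWithinAt (by simp))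
    (fun s t hs hst ht => h.dist_calibratedCurve hγ hs hst ht) (Or.inl ⟨by linarith, ?_⟩)
  filter_upwards [Ioo_mem_nhdsGT (sub_pos.2 hst)] with u hu x hx
  rw [wavefront, mem_ofPred_eq, distFrom_singleton] at hx
  have h1 := F.dist_triangle (γ s) (γ (t - u)) x
  rw [hx, h.dist_calibratedCurve hγ hs (by linarith [hu.2]) (by linarith [hu.1])] at h1
  have h2 : ENNReal.ofReal (t - s) = ENNReal.ofReal (t - u - s) + ENNReal.ofReal u := by
    rw [← ENNReal.ofReal_add (by linarith [hu.2]) hu.1.le]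
    congr 1
    ring
  rw [h2] at h1
  exact (ENNReal.add_le_add_iff_left ENNReal.ofReal_ne_top).1 h1

theorem touchesAt (hγ : F.IsCalibratedCurve (arrival 𝔟 a f) γ 0 T) {s t d : ℝ}
    (hs : 0 ≤ s) (hst : s < t) (ht : t ≤ T) (hd : f (γ t) = d) :
    F.TouchesAt (γ s) (t - s) (f ⁻¹' {d}) (γ t) := by
  refine ⟨?_, derivOn γ T t, h.isOrthogonal_level hγ (by linarith) ⟨by linarith, ht⟩ hd,
    h.isOrthogonal_wavefront hγ hs hst ht⟩
  rw [wavefront, mem_ofPred_eq, distFrom_singleton, h.dist_calibratedCurve hγ hs hst.le ht]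

/-- Huygens' envelope principle. -/
theorem isHuygensEnvelope (hforward : F.ForwardComplete) (hbackward : F.BackwardComplete)
    (hb : interior (f ⁻¹' {b}) = ∅) {c d : ℝ} (hc : c ∈ Icc a b) (hd : d ∈ Icc a b)
    (hcd : c < d) :
    F.IsHuygensEnvelope (f ⁻¹' {a}) (travelTime 𝔟 a c) (travelTime 𝔟 c d) (f ⁻¹' {d}) := by
  have hadd := h.travelTime_add hc hd
  have hmono := h.strictMonoOn_travelTime
  have h0c : 0 ≤ travelTime 𝔟 a c := by
    rw [← travelTime_self (𝔟 := 𝔟) a]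
    exact hmono.monotoneOn (left_mem_Icc.2 h.lt.le) hc hc.1
  have hdR : travelTime 𝔟 a d ≤ travelTime 𝔟 a b :=
    hmono.monotoneOn hd (right_mem_Icc.2 h.lt.le) hd.2
  have hlt : travelTime 𝔟 a c < travelTime 𝔟 a d := hmono hc hd hcd
  have hsub : travelTime 𝔟 c d = travelTime 𝔟 a d - travelTime 𝔟 a c := by linarith
  have hwc := h.wavefront_eq hforward hbackward hb hc
  -- A calibrated curve that reaches p beyond level c has crossed level c at the time r_{a,c}; the
  -- crossing point is the q whose wavefront touches.
  have hray : ∀ p, c < f p → ∃ γ : ℝ → M,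
      F.IsCalibratedCurve (arrival 𝔟 a f) γ 0 (travelTime 𝔟 a b) ∧ γ (arrival 𝔟 a f p) = p ∧
      f (γ (travelTime 𝔟 a c)) = c := by
    intro p hp
    obtain ⟨γ, hγ, hγp⟩ :=
      h.exists_calibratedCurve_of_ne hforward hbackward hb (hc.1.trans_lt hp)
    exact ⟨γ, hγ, hγp,
      (h.calibratedCurve_mem_level_iff hγ ⟨h0c, (hlt.le.trans hdR)⟩ hc).2 rfl⟩
  have htangent : ∀ p ∈ f ⁻¹' {d}, ∃ q ∈ f ⁻¹' {c},
      F.TouchesAt q (travelTime 𝔟 c d) (f ⁻¹' {d}) p := by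
    intro p hp
    obtain ⟨γ, hγ, hγp, hγc⟩ := hray p (hcd.trans_eq (Eq.symm hp))
    rw [(h.arrival_eq_iff hd).2 hp] at hγp
    refine ⟨_, hγc, ?_⟩
    subst hγp
    rw [hsub]
    exact h.touchesAt hγ h0c hlt hdR hp
  have hlower : ∀ p, ∀ q ∈ f ⁻¹' {c},
      ENNReal.ofReal (arrival 𝔟 a f p - travelTime 𝔟 a c) ≤ F.dist q p := by
    intro p q hq
    have := h.ofReal_arrival_sub_le_dist q p
    rwa [(h.arrival_eq_iff hc).2 hq] at this
  refine ⟨fun p => ?_, by rwa [hwc], fun ht q hq => ?_⟩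
  · rw [hwc, h.distFrom_eq hforward hbackward hb]
    constructor
    · intro hp
      have hp' := (h.arrival_eq_iff hd).2 hp
      refine ⟨?_, ?_, fun q hq => ?_⟩
      · rw [hp']
        exact (ENNReal.ofReal_lt_ofReal_iff (h0c.trans_lt hlt)).2 hlt
      · obtain ⟨q, hq, hqp⟩ := htangent p hp
        exact ⟨q, hq, hqp.1⟩
      · rw [hsub, ← hp']
        exact hlower p q hq
    -- The wavefront through p bounds ρ(p) - r_{a,c} above by r_{c,d}. The crossing point of the ray
    -- to p has distance exactly ρ(p) - r_{a,c} from p, so being inside no wavefront gives the bound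
    -- below.
    · rintro ⟨h1, ⟨q, hq, hqp⟩, h2⟩
      have h1' : travelTime 𝔟 a c < arrival 𝔟 a f p := (ENNReal.ofReal_lt_ofReal_iff_of_nonneg h0c).1 h1
      have hcp : c < f p := (hmono.lt_iff_lt hc (h.mem_Icc p)).1 h1'
      rw [wavefront, mem_ofPred_eq, distFrom_singleton] at hqp
      have h3 := hlower p q hq
      rw [hqp, ENNReal.ofReal_le_ofReal_iff (by linarith)] at h3
      obtain ⟨γ, hγ, hγp, hγc⟩ := hray p hcp
      have h4 := h2 _ hγc
      have h5 := h.dist_calibratedCurve hγ h0c h1'.le (h.arrival_le p)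
      rw [hγp] at h5
      rw [h5, ENNReal.ofReal_le_ofReal_iff (by linarith)] at h4
      exact (h.arrival_eq_iff hd).1 (by linarith)
  · rw [hwc] at hq
    -- A positive time means c > a, so q is a regular point and its calibrated curve continues to
    -- level d.
    have hac : a < c := (hmono.lt_iff_lt (left_mem_Icc.2 h.lt.le) hc).1 (by
      rwa [travelTime_self])
    have hqI : f q ∈ Ioo a b := by
      rw [show f q = c from hq]
      exact ⟨hac, hcd.trans_le hd.2⟩
    obtain ⟨γ, hγ, hγq⟩ := h.exists_calibratedCurve_through hforward hbackward hqI
    rw [(h.arrival_eq_iff hc).2 hq] at hγq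
    subst hγq
    have hγd : f (γ (travelTime 𝔟 a d)) = d :=
      (h.calibratedCurve_mem_level_iff hγ ⟨(h0c.trans hlt.le), hdR⟩ hd).2 rfl
    refine ⟨_, hγd, ?_⟩
    rw [hsub]
    exact h.touchesAt hγ h0c hlt hdR hγd

/-- On f⁻¹(a) the ray is constant, of duration 0; elsewhere it is the initial part of a calibrated
curve. -/
theorem exists_isWaveRay (hforward : F.ForwardComplete) (hbackward : F.BackwardComplete)
    (hb : interior (f ⁻¹' {b}) = ∅) (q : M) :
    ∃ γ : ℝ → M, F.IsWaveRay (f ⁻¹' {a}) γ (arrival 𝔟 a f q) ∧ γ (arrival 𝔟 a f q) = q := by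
  rcases (h.mem_Icc q).1.eq_or_lt with h1 | h1
  · have h0 : arrival 𝔟 a f q = 0 := by rw [arrival, ← h1, travelTime_self]
    rw [h0]
    refine ⟨fun _ => q, ⟨le_rfl, .smooth le_rfl contMDiffOn_const, ?_, h1.symm, ?_⟩, rfl⟩
    · intro t ht
      exact absurd (ht.1.trans ht.2) (lt_irrefl _)
    · rw [h.distFrom_eq hforward hbackward hb, h0, length_eq_Ioo, Ioo_self]
      simp
  · obtain ⟨γ, hγ, hγq⟩ := h.exists_calibratedCurve_of_ne hforward hbackward hb h1
    refine ⟨γ, h.isWaveRay_of_calibrated hforward hbackward hb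
      (hγ.mono le_rfl (h.arrival_le q)) ?_, hγq⟩
    have := h.strictMonoOn_travelTime (left_mem_Icc.2 h.lt.le) (h.mem_Icc q) h1
    rwa [travelTime_self] at this

/-- The image of γ is a calibrated set, and its point at time T / 2 is regular, so it lies on a
calibrated curve defined on [0, R]. -/
theorem exists_calibratedCurve_extension (hforward : F.ForwardComplete)
    (hbackward : F.BackwardComplete) (hγ : F.IsCalibratedCurve (arrival 𝔟 a f) γ 0 T)
    (hT : 0 < T) : ∃ γ' : ℝ → M, EqOn γ' γ (Icc 0 T) ∧
      F.IsCalibratedCurve (arrival 𝔟 a f) γ' 0 (travelTime 𝔟 a b) := by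
  have hTR := (h.bounds_calibratedCurve hγ hT.le).2
  have hmid : T / 2 ∈ Icc 0 T := ⟨by linarith, by linarith⟩
  obtain ⟨γ', hγ', hC⟩ := h.exists_calibratedCurve hforward hbackward hγ.isCalibrated_image
    (mem_image_of_mem γ hmid) (h.mem_Ioo_iff.2 (by
      rw [hγ.apply_eq _ hmid]
      constructor <;> linarith))
  refine ⟨γ', fun t ht => ?_, hγ'⟩
  have := hC _ (mem_image_of_mem γ ht)
  rwa [hγ.apply_eq t ht] at this

end IsRegularTransnormal

/-- A nonconstant transnormal function with empty last level interior is regular. -/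
theorem IsTransnormal.isRegularTransnormal [Nonempty M] {f : M → ℝ} {𝔟 : ℝ → ℝ} {a b : ℝ}
    (hf : F.IsTransnormal f 𝔟) (hrange : range f = Icc a b) (hpos : ∀ s ∈ Ioo a b, 0 < 𝔟 s)
    (hb : interior (f ⁻¹' {b}) = ∅) : F.IsRegularTransnormal f 𝔟 a b := by
  refine ⟨hf, hrange, hpos, ?_⟩
  have hmem : ∀ x, f x ∈ Icc a b := fun x => hrange ▸ mem_range_self x
  by_contra! hle
  -- With b ≤ a, f would be constant and f⁻¹(b) all of M, which has nonempty interior.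
  have huniv : f ⁻¹' {b} = univ := by
    refine eq_univ_of_forall fun x => ?_
    exact le_antisymm (hmem x).2 (hle.trans (hmem x).1)
  rw [huniv, interior_univ] at hb
  exact univ_nonempty.ne_empty hb

end FinslerStructure

end

theorem proposition3p2 {n : ℕ} {M : Type*} [TopologicalSpace M] [T2Space M]
    [SecondCountableTopology M] [ConnectedSpace M]
    [ChartedSpace (EuclideanSpace ℝ (Fin n)) M] [IsManifold (𝓡 n) ∞ M]
    (F : FinslerStructure n M) (hforward : F.ForwardComplete) (hbackward : F.BackwardComplete)
    (f : M → ℝ) (𝔟 : ℝ → ℝ) (a b : ℝ)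
    (hf : F.IsTransnormal f 𝔟) (hrange : Set.range f = Set.Icc a b)
    (hpos : ∀ s ∈ Set.Ioo a b, 0 < 𝔟 s) (hb : interior (f ⁻¹' {b}) = ∅) :
    -- a) the level sets are the wavefronts
    (IntervalIntegrable (fun s => 1 / √(𝔟 s)) MeasureTheory.volume a b ∧
      ∀ c ∈ Set.Icc a b, f ⁻¹' {c} = F.wavefront (f ⁻¹' {a}) (Finsler.travelTime 𝔟 a c)) ∧
    -- b) Huygens' envelope principle
    (∀ c ∈ Set.Icc a b, ∀ d ∈ Set.Icc a b, c < d →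
      F.IsHuygensEnvelope (f ⁻¹' {a}) (Finsler.travelTime 𝔟 a c) (Finsler.travelTime 𝔟 c d) (f ⁻¹' {d})) ∧
    -- c) every point is reached by a wave ray
    (∀ q : M, ∃ γ : ℝ → M, F.IsWaveRay (f ⁻¹' {a}) γ (Finsler.travelTime 𝔟 a (f q)) ∧
      γ (Finsler.travelTime 𝔟 a (f q)) = q) ∧
    -- c) every wave ray of positive duration ...
    (∀ (γ : ℝ → M) (T : ℝ), 0 < T → F.IsWaveRay (f ⁻¹' {a}) γ T →
      -- is a geodesic,
      F.IsGeodesic γ T ∧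
      -- meets the wavefronts one after the other and orthogonally,
      (∀ c ∈ Set.Icc a b, ∀ t ∈ Set.Icc 0 T, f (γ t) = c ↔ t = Finsler.travelTime 𝔟 a c) ∧
      (∀ c ∈ Set.Icc a b, ∀ t ∈ Set.Icc 0 T, f (γ t) = c →
        F.IsOrthogonal (γ t) (Finsler.derivOn γ T t) (f ⁻¹' {c})) ∧
      -- and is part of a wave ray that joins the first level set to the last one
      ∃ γ' : ℝ → M, Set.EqOn γ' γ (Set.Icc 0 T) ∧ T ≤ Finsler.travelTime 𝔟 a b ∧
        F.IsWaveRay (f ⁻¹' {a}) γ' (Finsler.travelTime 𝔟 a b) ∧ f (γ' (Finsler.travelTime 𝔟 a b)) = b) := by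
  have h : F.IsRegularTransnormal f 𝔟 a b := hf.isRegularTransnormal hrange hpos hb
  have ha' := left_mem_Icc.2 h.lt.le
  have hb' := right_mem_Icc.2 h.lt.le
  refine ⟨⟨h.intervalIntegrable ha' hb',
      fun c hc => (h.wavefront_eq hforward hbackward hb hc).symm⟩,
    fun c hc d hd hcd => h.isHuygensEnvelope hforward hbackward hb hc hd hcd,
    fun q => h.exists_isWaveRay hforward hbackward hb q, fun γ T hT hray => ?_⟩
  have hγ := h.isCalibratedCurve_of_isWaveRay hforward hbackward hb hray
  obtain ⟨γ', hγγ', hγ'⟩ := h.exists_calibratedCurve_extension hforward hbackward hγ hT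
  have hR : 0 < Finsler.travelTime 𝔟 a b := h.travelTime_pos ha' hb' h.lt
  exact ⟨h.isGeodesic_of_calibrated hγ hT,
    fun c hc t ht => h.calibratedCurve_mem_level_iff hγ ht hc,
    fun c _ t ht hc => h.isOrthogonal_level hγ hT ht hc,
    γ', hγγ', (h.bounds_calibratedCurve hγ hT.le).2,
    h.isWaveRay_of_calibrated hforward hbackward hb hγ' hR,
    (h.calibratedCurve_mem_level_iff hγ' (right_mem_Icc.2 hR.le) hb').2 rfl⟩
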